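/- Let $m\neq 0$ and $e$ be real numbers and let $\eta=\mathrm{diag}(1,-1,-1,-1)$. Consider on Minkowski space $\mathbb R^{4}$ a complex vector field $W^+_\mu$, with $W^-_\mu=\overline{W^+_\mu}$, and a real potential $A_\mu$ ($\mu=0,1,2,3$), with the action $$S=\int d^4x\Big[-\tfrac12\eta^{\mu\rho}\eta^{\nu\sigma}W^-_{\mu\nu}W^+_{\rho\sigma}+m^2\eta^{\mu\nu}W^-_\mu W^+_\nu-\tfrac14F^{\mu\nu}F_{\mu\nu}\Big],$$ where $F_{\mu\nu}=\partial_\mu A_\nu-\partial_\nu A_\mu$, $D_\mu W^\pm_\nu=\partial_\mu W^\pm_\nu\mp ieA_\mu W^\pm_\nu$ and $W^\pm_{\mu\nu}=D_\mu W^\pm_\nu-D_\nu W^\pm_\mu$. Suppose that $W^\pm_\mu$, $A_\mu$ are $C^\infty$ on $\mathbb R^4$, satisfy the equations of motion (the Euler--Lagrange equations of $S$), and tend to $0$ as $|\vec x|\to\infty$ for every $t$. Suppose that they are periodic in time up to a spatial rotation and a coordinate shift: there are $\tilde T\in(0,\infty)$, $\Omega\in SO(3)$ and $\vec l\in\mathbb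 R^3$ with $\Omega\vec l=\vec l$ and $|\vec l|/\tilde T<1$ such that $$\Psi(t+\tilde T,\vec x)=\Lambda(\Omega)\,\Psi(t,\Omega^{-1}\vec x-\vec l)\qquad\text{for all }t,\vec x,$$ for $\Psi=W^\pm$ and $\Psi=A$, where $\Lambda(\Omega)$ leaves the component $\Psi_0$ unchanged and rotates $(\Psi_1,\Psi_2,\Psi_3)$ by $\Omega$. Pass by the Lorentz boost with velocity $\vec l/\tilde T$ to the inertial frame in which the shift is zero; the period there is $T=\tilde T\sqrt{1-|\vec l|^2/\tilde T^2}$. Suppose that, for the fields in that frame (sums over $i,j=1,2,3$), the integrals $$\int_0^T\!dt\int d^3x\,W^-_{0i}W^+_{0i},\quad \int_0^T\!dt\int d^3x\,\tfrac12W^-_{ij}W^+_{ij},\quad m^2\!\int_0^T\!dt\int d^3x\,W^-_0W^+_0,$$ $$m^2\!\int_0^T\!dt\int d^3x\,W^-_iW^+_i,\quad \int_0^T\!dt\int d^3x\,\tfrac12F_{0i}F_{0i},\quad \int_0^T\!dt\int d^3x\,\tfrac14F_{ij}F_{ij}$$ are finite. Then the solution is trivial: $W^\pm_\mu\equiv0$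 and $F_{\mu\nu}\equiv0$, and $A_\mu$ is a pure gauge, $A_\mu=\partial_\mu\chi$ for a smooth function $\chi:\mathbb R^4\to\mathbb R$. In other words, there are no non-trivial non-topological solitons of this kind. -/

import Mathlib

open scoped ContDiff Topology

namespace ChargedVector

noncomputable section

/-- Minkowski space-time with inertial coordinates `x 0 = t` and `x 1, x 2, x 3` (units `c = 1`). -/
abbrev Spacetime := Fin 4 → ℝ

/-- The event with time `t` and spatial position `x`. -/
def event (t : ℝ) (x : Fin 3 → ℝ) : Spacetime := Matrix.vecCons t x

/-- The values `(W⁺_μ, A_μ)` of the complex vector field and of the real electromagnetic potential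
(components with lower indices). The field `W⁻_μ` is the complex conjugate of `W⁺_μ`. -/
abbrev FieldValue := (Fin 4 → ℂ) × (Fin 4 → ℝ)

/-- The partial derivative `∂_μ` of a function on space-time. -/
def partialDeriv {V : Type*} [NormedAddCommGroup V] [NormedSpace ℝ V]
    (μ : Fin 4) (f : Spacetime → V) (x : Spacetime) : V :=
  fderiv ℝ f x (Pi.single μ 1)

/-- The collection of all first derivatives, `grad Ψ x μ = ∂_μ Ψ (x)`. -/
def grad {V : Type*} [NormedAddCommGroup V] [NormedSpace ℝ V]
    (Ψ : Spacetime → V) (x : Spacetime) : Fin 4 → V :=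
  fun μ => partialDeriv μ Ψ x

/-- The Euler-Lagrange equations of the action `∫ d⁴x L(Ψ, ∂Ψ)`, for a Lagrangian density `L` that
depends on the field value and on its first derivatives:
`∑_μ ∂_μ (∂L/∂(∂_μ Ψ) · v) = ∂L/∂Ψ · v` at every point and for every direction `v`. -/
def EulerLagrange {V : Type*} [NormedAddCommGroup V] [NormedSpace ℝ V]
    (L : V → (Fin 4 → V) → ℝ) (Ψ : Spacetime → V) : Prop :=
  ∀ (x : Spacetime) (v : V),
    ∑ μ, partialDeriv μ
        (fun y => lineDeriv ℝ (fun p => L (Ψ y) p) (grad Ψ y) (Pi.single μ v)) x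
      = lineDeriv ℝ (fun u => L u (grad Ψ x)) (Ψ x) v

/-- The diagonal of the Minkowski metric `η = diag(1, -1, -1, -1)`. -/
def eta : Fin 4 → ℝ := ![1, -1, -1, -1]

/-- `D_μ W⁺_ν = ∂_μ W⁺_ν - i e A_μ W⁺_ν`, where `u` is the value of the fields and `p μ` is the
value of their derivatives `∂_μ`. -/
def covDeriv (e : ℝ) (u : FieldValue) (p : Fin 4 → FieldValue) (μ ν : Fin 4) : ℂ :=
  (p μ).1 ν - Complex.I * e * u.2 μ * u.1 ν

/-- `W⁺_{μν} = D_μ W⁺_ν - D_ν W⁺_μ`; the complex conjugate of this is `W⁻_{μν}`. -/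
def strengthW (e : ℝ) (u : FieldValue) (p : Fin 4 → FieldValue) (μ ν : Fin 4) : ℂ :=
  covDeriv e u p μ ν - covDeriv e u p ν μ

/-- `F_{μν} = ∂_μ A_ν - ∂_ν A_μ`. -/
def strengthF (p : Fin 4 → FieldValue) (μ ν : Fin 4) : ℝ :=
  (p μ).2 ν - (p ν).2 μ

/-- The Lagrangian density
`-(1/2) W⁻^{μν} W⁺_{μν} + m² W⁻^μ W⁺_μ - (1/4) F^{μν} F_{μν}`;
indices are raised with `η`, and `W⁻_{μν} W⁺_{μν} = |W⁺_{μν}|²` (no sum),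
`W⁻_μ W⁺_μ = |W⁺_μ|²` (no sum). -/
def lagrangian (e m : ℝ) (u : FieldValue) (p : Fin 4 → FieldValue) : ℝ :=
  -(1 / 2) * ∑ μ, ∑ ν, eta μ * eta ν * ‖strengthW e u p μ ν‖ ^ 2
    + m ^ 2 * ∑ μ, eta μ * ‖u.1 μ‖ ^ 2
    - (1 / 4) * ∑ μ, ∑ ν, eta μ * eta ν * strengthF p μ ν ^ 2

/-- The integrands of `Π_{W0}, Π_{W1}, V₀, V₁, Π_{A0}, Π_{A1}`, in this order. The spatial index
`i = 1, 2, 3` is `Fin.succ i` with `i : Fin 3`. -/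
def density (e m : ℝ) (u : FieldValue) (p : Fin 4 → FieldValue) : Fin 6 → ℝ :=
  ![∑ i : Fin 3, ‖strengthW e u p 0 i.succ‖ ^ 2,
    ∑ i : Fin 3, ∑ j : Fin 3, (1 / 2) * ‖strengthW e u p i.succ j.succ‖ ^ 2,
    m ^ 2 * ‖u.1 0‖ ^ 2,
    m ^ 2 * ∑ i : Fin 3, ‖u.1 i.succ‖ ^ 2,
    ∑ i : Fin 3, (1 / 2) * strengthF p 0 i.succ ^ 2,
    ∑ i : Fin 3, ∑ j : Fin 3, (1 / 4) * strengthF p i.succ j.succ ^ 2]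

/-- All six integrals over `0 ≤ t ≤ T`, `x ∈ ℝ³` are finite. -/
def FiniteIntegrals (e m T : ℝ) (Ψ : Spacetime → FieldValue) : Prop :=
  ∀ k : Fin 6, MeasureTheory.IntegrableOn (fun x => density e m (Ψ x) (grad Ψ x) k)
    {x : Spacetime | 0 ≤ x 0 ∧ x 0 ≤ T}

/-- All the fields tend to zero at spatial infinity, at every time. -/
def VanishesAtSpatialInfinity (Ψ : Spacetime → FieldValue) : Prop :=
  ∀ t : ℝ, Filter.Tendsto (fun x : Fin 3 → ℝ => Ψ (event t x))
    (Filter.cocompact (Fin 3 → ℝ)) (𝓝 0)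

/-- The representation of the rotation group carried by a four-vector: the time component is a
scalar, the spatial components are a vector. -/
def rotate {K : Type*} [Semiring K] [Algebra ℝ K] (Ω : Matrix.specialOrthogonalGroup (Fin 3) ℝ)
    (a : Fin 4 → K) : Fin 4 → K :=
  Matrix.vecCons (a 0) (fun i : Fin 3 => ∑ j : Fin 3, Ω.1 i j • a j.succ)

/-- Periodicity in time with period `T`, up to the rotation `Ω` and the shift `l`:
`Ψ(t + T, x) = Λ(Ω) Ψ(t, Ω⁻¹ x - l)`. -/
def PeriodicUpTo (T : ℝ) (Ω : Matrix.specialOrthogonalGroup (Fin 3) ℝ) (l : Fin 3 → ℝ)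
    (Ψ : Spacetime → FieldValue) : Prop :=
  ∀ (t : ℝ) (x : Fin 3 → ℝ),
    (Ψ (event (t + T) x)).1 = rotate Ω (Ψ (event t ((Ω⁻¹).1.mulVec x - l))).1 ∧
    (Ψ (event (t + T) x)).2 = rotate Ω (Ψ (event t ((Ω⁻¹).1.mulVec x - l))).2

/-- The Lorentz factor of the velocity `v`. -/
def lorentzFactor (v : Fin 3 → ℝ) : ℝ := 1 / √(1 - v ⬝ᵥ v)

/-- The Lorentz boost that takes the coordinates `(t', x')` of the inertial frame moving with
velocity `v` to the original coordinates:
`t = γ (t' + v · x')`, `x = x' + (γ² / (1 + γ)) (v · x') v + γ t' v`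
(and `γ² / (1 + γ) = (γ - 1) / |v|²` when `v ≠ 0`). -/
def boost (v : Fin 3 → ℝ) : Matrix (Fin 4) (Fin 4) ℝ :=
  let γ := lorentzFactor v
  Matrix.of (Matrix.vecCons (Matrix.vecCons γ (fun j => γ * v j))
    (fun i : Fin 3 => Matrix.vecCons (γ * v i)
      (fun j : Fin 3 => (if i = j then 1 else 0) + γ ^ 2 / (1 + γ) * v i * v j)))

/-- The fields in the primed coordinates, when the original coordinates are `x = M x'`; the fields
are covectors: `W'_μ(x') = ∑_ν (∂x^ν/∂x'^μ) W_ν(M x')`, and likewise for `A`. -/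
def changeFrame (M : Matrix (Fin 4) (Fin 4) ℝ) (Ψ : Spacetime → FieldValue) :
    Spacetime → FieldValue :=
  fun y => (fun μ => ∑ ν, M ν μ • (Ψ (M.mulVec y)).1 ν, fun μ => ∑ ν, M ν μ * (Ψ (M.mulVec y)).2 ν)

end

end ChargedVector

/-! The argument is a pair of virial identities in the frame where the shift is zero. Write G for
the field strength of W, F for the electromagnetic one, and d₀, …, d₅ for the six nonnegative
densities, in the order of `density`.

The basic tool is `integral_slab_divergence_eq_zero`. Suppose the time component of a current agrees
on the two faces of one period up to a rotation, and its spatial components are bounded by (1 + |x|)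
times an integrable function. Then its divergence, if integrable, integrates to zero. Multiply by a
radial cutoff at radius R: the cutoff's gradient is of order 1/R and is supported where |x| ~ R,
which offsets the growth in |x|, so the error tends to zero by dominated convergence.

First identity. Two consequences of the field equations are combined. Contracting the equation for W
with the conjugate of W gives a current with divergence -d₀ + d₁ - d₂ + d₃
(`divergence_virialCurrent_eq_density`). Conservation of the stress-energy tensor
(`FieldEquations.stress_conservation`), contracted with the spatial position, gives its spatial
trace d₀ + d₁ + 3d₂ - d₃ + d₄ + d₅ (`stress_trace`). In the sum the terms d₀ and d₃ cancel, and the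
current `dilationCurrent` has divergence 2d₁ + 2d₂ + d₄ + d₅. Every term is nonnegative and the
integral is zero, so G_ij = 0, W_0 = 0 and F = 0 inside the slab.

Second identity. With these components gone, the field G_0i has zero covariant divergence (the
equation for W_0) and zero covariant curl (the Bianchi identity). Its Maxwell-type stress is
therefore conserved on each time slice, with trace -d₀. The same tool applied to this stress
contracted with position gives d₀ = 0 (`fieldDensity_zero_vanish`). Now G = 0 on an open set, and
the equation for W reduces to m² W = 0.

Continuity carries the result to the closed slab and periodicity to all times (`fields_vanish`). The
rest frame is reached by Lorentz covariance (`IsFrameChange.fieldEquations`) and by the fact that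
the boost commutes with Ω (`isFrameChange_boosted`); the inverse boost leads back. Finally F = 0
makes A a closed one-form on ℝ⁴, hence exact (`exists_potential`). -/

namespace ChargedVector

noncomputable section

/-! ### Calculus of partial derivatives on space-time. -/

section PartialDeriv

variable {V : Type*} [NormedAddCommGroup V] [NormedSpace ℝ V]

theorem contDiff_partialDeriv {f : Spacetime → V} (hf : ContDiff ℝ ∞ f) (μ : Fin 4) :
    ContDiff ℝ ∞ (partialDeriv μ f) :=
  (hf.fderiv_right (m := ∞) (by simp)).clm_apply contDiff_const

theorem _root_.ContDiff.differentiableAt_infty {E : Type*} [NormedAddCommGroup E] [NormedSpace ℝ E]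
    {f : E → V} (hf : ContDiff ℝ ∞ f) {x : E} : DifferentiableAt ℝ f x :=
  (hf.differentiable (by simp)).differentiableAt

theorem partialDeriv_comm {f : Spacetime → V} (hf : ContDiff ℝ ∞ f) (μ ν : Fin 4) :
    partialDeriv μ (partialDeriv ν f) = partialDeriv ν (partialDeriv μ f) := by
  funext x
  have hd : DifferentiableAt ℝ (fderiv ℝ f) x :=
    (hf.fderiv_right (m := ∞) (by simp)).differentiableAt_infty
  have key : ∀ α β : Fin 4, partialDeriv α (partialDeriv β f) x
      = fderiv ℝ (fderiv ℝ f) x (Pi.single α 1) (Pi.single β 1) := by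
    intro α β
    have : HasFDerivAt (partialDeriv β f)
        ((ContinuousLinearMap.apply ℝ V (Pi.single β 1 : Spacetime)).comp
          (fderiv ℝ (fderiv ℝ f) x)) x :=
      (ContinuousLinearMap.apply ℝ V (Pi.single β 1 : Spacetime)).hasFDerivAt.comp x
        hd.hasFDerivAt
    rw [partialDeriv, this.fderiv]
    rfl
  rw [key, key]
  exact second_derivative_symmetric (𝕜 := ℝ)
    (fun y => (hf.differentiableAt_infty (x := y)).hasFDerivAt) hd.hasFDerivAt _ _

theorem partialDeriv_clm {V' : Type*} [NormedAddCommGroup V'] [NormedSpace ℝ V']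
    (L : V →L[ℝ] V') {f : Spacetime → V} {x : Spacetime} (hf : DifferentiableAt ℝ f x)
    (μ : Fin 4) : partialDeriv μ (fun y => L (f y)) x = L (partialDeriv μ f x) := by
  have := (L.hasFDerivAt.comp x hf.hasFDerivAt).fderiv
  rw [partialDeriv]
  change fderiv ℝ (L ∘ f) x _ = _
  rw [this]; rfl

theorem partialDeriv_add {f g : Spacetime → V} {x : Spacetime} (hf : DifferentiableAt ℝ f x)
    (hg : DifferentiableAt ℝ g x) (μ : Fin 4) :
    partialDeriv μ (fun y => f y + g y) x = partialDeriv μ f x + partialDeriv μ g x := by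
  simp only [partialDeriv, fderiv_fun_add hf hg, add_apply]

theorem partialDeriv_sub {f g : Spacetime → V} {x : Spacetime} (hf : DifferentiableAt ℝ f x)
    (hg : DifferentiableAt ℝ g x) (μ : Fin 4) :
    partialDeriv μ (fun y => f y - g y) x = partialDeriv μ f x - partialDeriv μ g x := by
  simp only [partialDeriv, fderiv_fun_sub hf hg, sub_apply]

theorem partialDeriv_sum {ι : Type*} (s : Finset ι) {f : ι → Spacetime → V} {x : Spacetime}
    (hf : ∀ i ∈ s, DifferentiableAt ℝ (f i) x) (μ : Fin 4) :
    partialDeriv μ (fun y => ∑ i ∈ s, f i y) x = ∑ i ∈ s, partialDeriv μ (f i) x := by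
  simp only [partialDeriv, fderiv_fun_sum hf, sum_apply]

theorem partialDeriv_mul {K : Type*} [NormedCommRing K] [NormedAlgebra ℝ K]
    {f g : Spacetime → K} {x : Spacetime}
    (hf : DifferentiableAt ℝ f x) (hg : DifferentiableAt ℝ g x) (μ : Fin 4) :
    partialDeriv μ (fun y => f y * g y) x
      = partialDeriv μ f x * g x + f x * partialDeriv μ g x := by
  simp only [partialDeriv, fderiv_fun_mul hf hg, add_apply,
    smul_apply, smul_eq_mul]
  ring

theorem partialDeriv_const_mul {K : Type*} [NormedCommRing K] [NormedAlgebra ℝ K]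
    {f : Spacetime → K} {x : Spacetime}
    (hf : DifferentiableAt ℝ f x) (c : K) (μ : Fin 4) :
    partialDeriv μ (fun y => c * f y) x = c * partialDeriv μ f x := by
  simp only [partialDeriv, fderiv_const_mul hf, smul_apply, smul_eq_mul]

theorem partialDeriv_coord (μ ν : Fin 4) (x : Spacetime) :
    partialDeriv μ (fun y : Spacetime => y ν) x = if μ = ν then 1 else 0 := by
  have := (ContinuousLinearMap.proj (R := ℝ) (φ := fun _ : Fin 4 => ℝ) ν).hasFDerivAt (x := x)
  rw [partialDeriv, show (fun y : Spacetime => y ν) =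
    ⇑(ContinuousLinearMap.proj (R := ℝ) (φ := fun _ : Fin 4 => ℝ) ν) from rfl, this.fderiv]
  simp [Pi.single_apply, eq_comm]

theorem partialDeriv_congr {f g : Spacetime → V} {x : Spacetime} (h : f =ᶠ[𝓝 x] g) (μ : Fin 4) :
    partialDeriv μ f x = partialDeriv μ g x := by
  rw [partialDeriv, h.fderiv_eq, partialDeriv]

theorem partialDeriv_ofReal {f : Spacetime → ℝ} {x : Spacetime} (hf : DifferentiableAt ℝ f x)
    (μ : Fin 4) : partialDeriv μ (fun y => (f y : ℂ)) x = ((partialDeriv μ f x : ℝ) : ℂ) :=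
  partialDeriv_clm Complex.ofRealCLM hf μ

/-- The derivative of a function precomposed with an affine map `y ↦ M y + c`. -/
theorem partialDeriv_comp_mulVec {f : Spacetime → V} (hf : Differentiable ℝ f)
    (M : Matrix (Fin 4) (Fin 4) ℝ) (c : Spacetime) (μ : Fin 4) (x : Spacetime) :
    partialDeriv μ (fun y => f (M.mulVec y + c)) x
      = ∑ α, M α μ • partialDeriv α f (M.mulVec x + c) := by
  have h1 : HasFDerivAt (fun y : Spacetime => M.mulVec y + c)
      (Matrix.toLin' M).toContinuousLinearMap x :=
    ((Matrix.toLin' M).toContinuousLinearMap.hasFDerivAt).add_const c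
  have h2 := ((hf (M.mulVec x + c)).hasFDerivAt.comp x h1).fderiv
  rw [partialDeriv]
  change fderiv ℝ (f ∘ fun y : Spacetime => M.mulVec y + c) x _ = _
  rw [h2]
  have : M.mulVec (Pi.single μ 1) = ∑ α, M α μ • (Pi.single α 1 : Spacetime) := by
    ext β
    simp [Pi.single_apply]
  simp only [ContinuousLinearMap.coe_comp, Function.comp_apply,
    LinearMap.coe_toContinuousLinearMap', Matrix.toLin'_apply, this, map_sum, map_smul,
    partialDeriv]

end PartialDeriv

/-! ### The real inner product on ℂ and gauge-covariant derivatives. -/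

/-- The real part of `conj a * b`. -/
def reDot (a b : ℂ) : ℝ := a.re * b.re + a.im * b.im

/-- The imaginary part of `conj a * b`. -/
def imDot (a b : ℂ) : ℝ := a.re * b.im - a.im * b.re

theorem reDot_self (a : ℂ) : reDot a a = ‖a‖ ^ 2 := by
  rw [← Complex.normSq_eq_norm_sq, Complex.normSq_apply, reDot]

theorem abs_reDot_le (a b : ℂ) : |reDot a b| ≤ ‖a‖ ^ 2 + ‖b‖ ^ 2 := by
  rw [← reDot_self, ← reDot_self, abs_le]
  simp only [reDot]
  constructor <;>
  nlinarith [sq_nonneg (a.re - b.re), sq_nonneg (a.im - b.im), sq_nonneg (a.re + b.re),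
    sq_nonneg (a.im + b.im), sq_nonneg a.re, sq_nonneg a.im, sq_nonneg b.re, sq_nonneg b.im]

theorem contDiff_re {E : Type*} [NormedAddCommGroup E] [NormedSpace ℝ E] {f : E → ℂ}
    (hf : ContDiff ℝ ∞ f) : ContDiff ℝ ∞ fun y => (f y).re :=
  Complex.reCLM.contDiff.comp hf

theorem contDiff_im {E : Type*} [NormedAddCommGroup E] [NormedSpace ℝ E] {f : E → ℂ}
    (hf : ContDiff ℝ ∞ f) : ContDiff ℝ ∞ fun y => (f y).im :=
  Complex.imCLM.contDiff.comp hf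

theorem contDiff_reDot {E : Type*} [NormedAddCommGroup E] [NormedSpace ℝ E] {f g : E → ℂ}
    (hf : ContDiff ℝ ∞ f) (hg : ContDiff ℝ ∞ g) : ContDiff ℝ ∞ fun y => reDot (f y) (g y) :=
  ((contDiff_re hf).mul (contDiff_re hg)).add ((contDiff_im hf).mul (contDiff_im hg))

/-- The gauge-covariant derivative of a complex function of charge `e`. -/
def gaugeDeriv (e : ℝ) (A : Spacetime → Fin 4 → ℝ) (μ : Fin 4) (f : Spacetime → ℂ) :
    Spacetime → ℂ :=
  fun y => partialDeriv μ f y - Complex.I * e * A y μ * f y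

section GaugeDeriv

variable {e : ℝ} {A : Spacetime → Fin 4 → ℝ}

theorem contDiff_gaugeDeriv (hA : ∀ μ, ContDiff ℝ ∞ fun y => A y μ) {f : Spacetime → ℂ}
    (hf : ContDiff ℝ ∞ f) (μ : Fin 4) : ContDiff ℝ ∞ (gaugeDeriv e A μ f) :=
  (contDiff_partialDeriv hf μ).sub
    ((contDiff_const.mul (Complex.ofRealCLM.contDiff.comp (hA μ))).mul hf)

theorem gaugeDeriv_sub {f g : Spacetime → ℂ} (hf : ContDiff ℝ ∞ f) (hg : ContDiff ℝ ∞ g)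
    (μ : Fin 4) (x : Spacetime) :
    gaugeDeriv e A μ (fun y => f y - g y) x = gaugeDeriv e A μ f x - gaugeDeriv e A μ g x := by
  simp only [gaugeDeriv, partialDeriv_sub hf.differentiableAt_infty hg.differentiableAt_infty]
  ring

theorem gaugeDeriv_sum {ι : Type*} (s : Finset ι) {f : ι → Spacetime → ℂ}
    (hf : ∀ i, ContDiff ℝ ∞ (f i)) (μ : Fin 4) (x : Spacetime) :
    gaugeDeriv e A μ (fun y => ∑ i ∈ s, f i y) x = ∑ i ∈ s, gaugeDeriv e A μ (f i) x := by
  simp only [gaugeDeriv, partialDeriv_sum s (fun i _ => (hf i).differentiableAt_infty),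
    Finset.mul_sum, Finset.sum_sub_distrib]

theorem gaugeDeriv_const_mul {f : Spacetime → ℂ} (hf : ContDiff ℝ ∞ f) (c : ℂ)
    (μ : Fin 4) (x : Spacetime) :
    gaugeDeriv e A μ (fun y => c * f y) x = c * gaugeDeriv e A μ f x := by
  simp only [gaugeDeriv, partialDeriv_const_mul hf.differentiableAt_infty]
  ring

theorem gaugeDeriv_congr {f g : Spacetime → ℂ} {x : Spacetime} (h : f =ᶠ[𝓝 x] g) (μ : Fin 4) :
    gaugeDeriv e A μ f x = gaugeDeriv e A μ g x := by
  simp only [gaugeDeriv, partialDeriv_congr h, h.eq_of_nhds]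

theorem gaugeDeriv_zero (μ : Fin 4) (x : Spacetime) : gaugeDeriv e A μ (fun _ => 0) x = 0 := by
  simp [gaugeDeriv, partialDeriv]

/-- The commutator of two gauge-covariant derivatives is the field strength. -/
theorem gaugeDeriv_comm (hA : ∀ μ, ContDiff ℝ ∞ fun y => A y μ) {f : Spacetime → ℂ}
    (hf : ContDiff ℝ ∞ f) (μ ν : Fin 4) (x : Spacetime) :
    gaugeDeriv e A μ (gaugeDeriv e A ν f) x - gaugeDeriv e A ν (gaugeDeriv e A μ f) x
      = -(Complex.I * e * ((partialDeriv μ (fun y => A y ν) x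
          - partialDeriv ν (fun y => A y μ) x : ℝ) : ℂ) * f x) := by
  have key : ∀ α β : Fin 4, partialDeriv α (gaugeDeriv e A β f) x
      = partialDeriv α (partialDeriv β f) x
        - Complex.I * e * (partialDeriv α (fun y => A y β) x * f x
          + A x β * partialDeriv α f x) := by
    intro α β
    have hAc : DifferentiableAt ℝ (fun y => (A y β : ℂ)) x :=
      (Complex.ofRealCLM.contDiff.comp (hA β)).differentiableAt_infty
    have hAf : DifferentiableAt ℝ (fun y => (A y β : ℂ) * f y) x :=
      hAc.fun_mul hf.differentiableAt_infty
    have : gaugeDeriv e A β f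
        = fun y => partialDeriv β f y - Complex.I * e * ((A y β : ℂ) * f y) := by
      funext y; simp only [gaugeDeriv]; ring
    rw [this, partialDeriv_sub (contDiff_partialDeriv hf β).differentiableAt_infty
      (hAf.const_mul _), partialDeriv_const_mul hAf,
      partialDeriv_mul hAc hf.differentiableAt_infty,
      partialDeriv_ofReal (hA β).differentiableAt_infty]
  have hc := congrFun (partialDeriv_comm hf μ ν) x
  have expand : ∀ α h, gaugeDeriv e A α h x
      = partialDeriv α h x - Complex.I * e * A x α * h x := fun _ _ => rfl
  rw [expand μ (gaugeDeriv e A ν f), expand ν (gaugeDeriv e A μ f), key, key, hc, expand, expand]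
  push_cast
  ring

/-- The connection acts through the imaginary factor `I * e * A`, so its contributions to the two
summands cancel. The charge and the potential may therefore be chosen freely. -/
theorem partialDeriv_reDot {f g : Spacetime → ℂ} (hf : ContDiff ℝ ∞ f) (hg : ContDiff ℝ ∞ g)
    (e : ℝ) (A : Spacetime → Fin 4 → ℝ) (μ : Fin 4) (x : Spacetime) :
    partialDeriv μ (fun y => reDot (f y) (g y)) x
      = reDot (gaugeDeriv e A μ f x) (g x) + reDot (f x) (gaugeDeriv e A μ g x) := by
  have re : ∀ {h : Spacetime → ℂ}, ContDiff ℝ ∞ h →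
      partialDeriv μ (fun y => (h y).re) x = (partialDeriv μ h x).re := fun hh =>
    partialDeriv_clm Complex.reCLM hh.differentiableAt_infty μ
  have im : ∀ {h : Spacetime → ℂ}, ContDiff ℝ ∞ h →
      partialDeriv μ (fun y => (h y).im) x = (partialDeriv μ h x).im := fun hh =>
    partialDeriv_clm Complex.imCLM hh.differentiableAt_infty μ
  have dfr := (contDiff_re hf).differentiableAt_infty (x := x)
  have dfi := (contDiff_im hf).differentiableAt_infty (x := x)
  have dgr := (contDiff_re hg).differentiableAt_infty (x := x)
  have dgi := (contDiff_im hg).differentiableAt_infty (x := x)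
  simp only [reDot]
  rw [partialDeriv_add (dfr.fun_mul dgr) (dfi.fun_mul dgi), partialDeriv_mul dfr dgr,
    partialDeriv_mul dfi dgi, re hf, re hg, im hf, im hg]
  simp [gaugeDeriv]
  ring

end GaugeDeriv

/-! ### Field strengths, field equations and Bianchi identities. -/

section Fields

variable (e m : ℝ) (Ψ : Spacetime → FieldValue)

/-- The field strength `W⁺_{μν}` of a field configuration as a function on space-time. -/
def fieldG (μ ν : Fin 4) (x : Spacetime) : ℂ := strengthW e (Ψ x) (grad Ψ x) μ ν

/-- The electromagnetic field strength `F_{μν}` of a field configuration. -/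
def fieldF (μ ν : Fin 4) (x : Spacetime) : ℝ := strengthF (grad Ψ x) μ ν

/-- The field equations of a charged massive vector field and of the electromagnetic field. -/
structure FieldEquations : Prop where
  vector : ∀ x ν, ∑ μ, (eta μ : ℂ) * gaugeDeriv e (fun y => (Ψ y).2) μ (fieldG e Ψ μ ν) x
    + m ^ 2 * (Ψ x).1 ν = 0
  maxwell : ∀ x ρ, ∑ μ, eta μ * partialDeriv μ (fieldF Ψ μ ρ) x
    = 2 * e * ∑ σ, eta σ * imDot (fieldG e Ψ ρ σ x) ((Ψ x).1 σ)

variable {e m Ψ}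

theorem contDiff_W (hΨ : ContDiff ℝ ∞ Ψ) (ν : Fin 4) : ContDiff ℝ ∞ fun y => (Ψ y).1 ν :=
  contDiff_pi.1 hΨ.fst ν

theorem contDiff_A (hΨ : ContDiff ℝ ∞ Ψ) (ν : Fin 4) : ContDiff ℝ ∞ fun y => (Ψ y).2 ν :=
  contDiff_pi.1 hΨ.snd ν

theorem grad_fst (hΨ : ContDiff ℝ ∞ Ψ) (x : Spacetime) (μ ν : Fin 4) :
    (grad Ψ x μ).1 ν = partialDeriv μ (fun y => (Ψ y).1 ν) x :=
  (partialDeriv_clm ((ContinuousLinearMap.proj (R := ℝ) (φ := fun _ : Fin 4 => ℂ) ν).comp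
    (ContinuousLinearMap.fst ℝ (Fin 4 → ℂ) (Fin 4 → ℝ))) hΨ.differentiableAt_infty μ).symm

theorem grad_snd (hΨ : ContDiff ℝ ∞ Ψ) (x : Spacetime) (μ ν : Fin 4) :
    (grad Ψ x μ).2 ν = partialDeriv μ (fun y => (Ψ y).2 ν) x :=
  (partialDeriv_clm ((ContinuousLinearMap.proj (R := ℝ) (φ := fun _ : Fin 4 => ℝ) ν).comp
    (ContinuousLinearMap.snd ℝ (Fin 4 → ℂ) (Fin 4 → ℝ))) hΨ.differentiableAt_infty μ).symm

theorem fieldG_eq (hΨ : ContDiff ℝ ∞ Ψ) (μ ν : Fin 4) :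
    fieldG e Ψ μ ν = fun y => gaugeDeriv e (fun y => (Ψ y).2) μ (fun y => (Ψ y).1 ν) y
      - gaugeDeriv e (fun y => (Ψ y).2) ν (fun y => (Ψ y).1 μ) y := by
  funext y
  simp only [fieldG, strengthW, covDeriv, gaugeDeriv, grad_fst hΨ]

theorem fieldF_eq (hΨ : ContDiff ℝ ∞ Ψ) (μ ν : Fin 4) :
    fieldF Ψ μ ν = fun y => partialDeriv μ (fun y => (Ψ y).2 ν) y
      - partialDeriv ν (fun y => (Ψ y).2 μ) y := by
  funext y
  simp only [fieldF, strengthF, grad_snd hΨ]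

theorem contDiff_fieldG (hΨ : ContDiff ℝ ∞ Ψ) (μ ν : Fin 4) : ContDiff ℝ ∞ (fieldG e Ψ μ ν) := by
  rw [fieldG_eq hΨ]
  exact (contDiff_gaugeDeriv (contDiff_A hΨ) (contDiff_W hΨ ν) μ).sub
    (contDiff_gaugeDeriv (contDiff_A hΨ) (contDiff_W hΨ μ) ν)

theorem contDiff_fieldF (hΨ : ContDiff ℝ ∞ Ψ) (μ ν : Fin 4) : ContDiff ℝ ∞ (fieldF Ψ μ ν) := by
  rw [fieldF_eq hΨ]
  exact (contDiff_partialDeriv (contDiff_A hΨ ν) μ).sub (contDiff_partialDeriv (contDiff_A hΨ μ) ν)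

theorem fieldG_antisymm (μ ν : Fin 4) (x : Spacetime) :
    fieldG e Ψ μ ν x = -fieldG e Ψ ν μ x := by
  simp [fieldG, strengthW]

theorem fieldF_antisymm (μ ν : Fin 4) (x : Spacetime) :
    fieldF Ψ μ ν x = -fieldF Ψ ν μ x := by
  simp [fieldF, strengthF]

theorem gaugeDeriv_fieldG (hΨ : ContDiff ℝ ∞ Ψ) (ρ μ ν : Fin 4) (x : Spacetime) :
    gaugeDeriv e (fun y => (Ψ y).2) ρ (fieldG e Ψ μ ν) x
      = gaugeDeriv e (fun y => (Ψ y).2) ρ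
          (gaugeDeriv e (fun y => (Ψ y).2) μ (fun y => (Ψ y).1 ν)) x
        - gaugeDeriv e (fun y => (Ψ y).2) ρ
          (gaugeDeriv e (fun y => (Ψ y).2) ν (fun y => (Ψ y).1 μ)) x := by
  rw [fieldG_eq hΨ]
  exact gaugeDeriv_sub (contDiff_gaugeDeriv (contDiff_A hΨ) (contDiff_W hΨ ν) μ)
    (contDiff_gaugeDeriv (contDiff_A hΨ) (contDiff_W hΨ μ) ν) ρ x

theorem gaugeDeriv_fieldG_antisymm (hΨ : ContDiff ℝ ∞ Ψ) (ρ μ ν : Fin 4) (x : Spacetime) :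
    gaugeDeriv e (fun y => (Ψ y).2) ρ (fieldG e Ψ μ ν) x
      = -gaugeDeriv e (fun y => (Ψ y).2) ρ (fieldG e Ψ ν μ) x := by
  rw [gaugeDeriv_fieldG hΨ, gaugeDeriv_fieldG hΨ]; ring

theorem partialDeriv_fieldF (hΨ : ContDiff ℝ ∞ Ψ) (ρ μ ν : Fin 4) (x : Spacetime) :
    partialDeriv ρ (fieldF Ψ μ ν) x
      = partialDeriv ρ (partialDeriv μ (fun y => (Ψ y).2 ν)) x
        - partialDeriv ρ (partialDeriv ν (fun y => (Ψ y).2 μ)) x := by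
  rw [fieldF_eq hΨ]
  exact partialDeriv_sub (contDiff_partialDeriv (contDiff_A hΨ ν) μ).differentiableAt_infty
    (contDiff_partialDeriv (contDiff_A hΨ μ) ν).differentiableAt_infty ρ

theorem partialDeriv_fieldF_antisymm (hΨ : ContDiff ℝ ∞ Ψ) (ρ μ ν : Fin 4) (x : Spacetime) :
    partialDeriv ρ (fieldF Ψ μ ν) x = -partialDeriv ρ (fieldF Ψ ν μ) x := by
  rw [partialDeriv_fieldF hΨ, partialDeriv_fieldF hΨ]; ring

theorem fieldF_bianchi (hΨ : ContDiff ℝ ∞ Ψ) (μ ν ρ : Fin 4) (x : Spacetime) :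
    partialDeriv μ (fieldF Ψ ν ρ) x + partialDeriv ν (fieldF Ψ ρ μ) x
      + partialDeriv ρ (fieldF Ψ μ ν) x = 0 := by
  simp only [partialDeriv_fieldF hΨ]
  rw [partialDeriv_comm (contDiff_A hΨ ρ) μ ν, partialDeriv_comm (contDiff_A hΨ ν) μ ρ,
    partialDeriv_comm (contDiff_A hΨ μ) ν ρ]
  ring

/-- The six second covariant derivatives of W group into three commutators, and each commutator is F
times a component of W. -/
theorem fieldG_bianchi (hΨ : ContDiff ℝ ∞ Ψ) (μ ν ρ : Fin 4) (x : Spacetime) :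
    gaugeDeriv e (fun y => (Ψ y).2) μ (fieldG e Ψ ν ρ) x
      + gaugeDeriv e (fun y => (Ψ y).2) ν (fieldG e Ψ ρ μ) x
      + gaugeDeriv e (fun y => (Ψ y).2) ρ (fieldG e Ψ μ ν) x
    = -(Complex.I * e * (fieldF Ψ μ ν x * (Ψ x).1 ρ + fieldF Ψ ν ρ x * (Ψ x).1 μ
        + fieldF Ψ ρ μ x * (Ψ x).1 ν)) := by
  simp only [gaugeDeriv_fieldG hΨ, fieldF_eq hΨ]
  have h1 := gaugeDeriv_comm (e := e) (contDiff_A hΨ) (contDiff_W hΨ ρ) μ ν x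
  have h2 := gaugeDeriv_comm (e := e) (contDiff_A hΨ) (contDiff_W hΨ μ) ν ρ x
  have h3 := gaugeDeriv_comm (e := e) (contDiff_A hΨ) (contDiff_W hΨ ν) ρ μ x
  linear_combination h1 + h2 + h3

theorem sum_sum_swap {R : Type*} [CommRing R] (f : Fin 4 → Fin 4 → R) :
    ∑ μ, ∑ ν, f ν μ = ∑ μ, ∑ ν, f μ ν := Finset.sum_comm

/-- The covariant divergence of the equation for W contains D_ν D_μ contracted with the
antisymmetric G, that is, half a commutator, which is F. For F = 0 this is the usual constraint of a
massive vector field. -/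
theorem FieldEquations.divergence (h : FieldEquations e m Ψ) (hΨ : ContDiff ℝ ∞ Ψ)
    (x : Spacetime) :
    m ^ 2 * ∑ ν, (eta ν : ℂ) * gaugeDeriv e (fun y => (Ψ y).2) ν (fun y => (Ψ y).1 ν) x
      = -(Complex.I * e / 2 * ∑ μ, ∑ ν, (eta μ : ℂ) * eta ν * fieldF Ψ μ ν x * fieldG e Ψ μ ν x) := by
  set D := gaugeDeriv e (fun y => (Ψ y).2) with hD
  have h1 : ∀ ν, ∑ μ, (eta μ : ℂ) * D ν (D μ (fieldG e Ψ μ ν)) x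
      = -(m ^ 2 * D ν (fun y => (Ψ y).1 ν) x) := by
    intro ν
    have e1 : (fun y => ∑ μ, (eta μ : ℂ) * D μ (fieldG e Ψ μ ν) y)
        = fun y => (-(m : ℂ) ^ 2) * (Ψ y).1 ν := by
      funext y; linear_combination h.vector y ν
    have e2 := congrArg (fun f => D ν f x) e1
    rw [hD, gaugeDeriv_sum, gaugeDeriv_const_mul (contDiff_W hΨ ν)] at e2
    · rw [hD, neg_mul_eq_neg_mul, ← e2]
      refine Finset.sum_congr rfl fun μ _ => ?_
      rw [gaugeDeriv_const_mul
        (contDiff_gaugeDeriv (contDiff_A hΨ) (contDiff_fieldG hΨ μ ν) μ)]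
    · exact fun μ => contDiff_const.mul
        (contDiff_gaugeDeriv (contDiff_A hΨ) (contDiff_fieldG hΨ μ ν) μ)
  have hanti : ∀ μ ν, D ν (D μ (fieldG e Ψ ν μ)) x = -D ν (D μ (fieldG e Ψ μ ν)) x := by
    intro μ ν
    have : D μ (fieldG e Ψ ν μ) = fun y => (-1 : ℂ) * D μ (fieldG e Ψ μ ν) y := by
      funext y; rw [hD, gaugeDeriv_fieldG_antisymm hΨ]; ring
    rw [this, hD, gaugeDeriv_const_mul
      (contDiff_gaugeDeriv (contDiff_A hΨ) (contDiff_fieldG hΨ μ ν) μ)]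
    ring
  have h2 : m ^ 2 * ∑ ν, (eta ν : ℂ) * D ν (fun y => (Ψ y).1 ν) x
      = -∑ μ, ∑ ν, (eta μ : ℂ) * eta ν * D ν (D μ (fieldG e Ψ μ ν)) x := by
    rw [Finset.sum_comm, Finset.mul_sum, ← Finset.sum_neg_distrib]
    refine Finset.sum_congr rfl fun ν _ => ?_
    have := h1 ν
    have e3 : ∑ μ, (eta μ : ℂ) * eta ν * D ν (D μ (fieldG e Ψ μ ν)) x
        = eta ν * ∑ μ, (eta μ : ℂ) * D ν (D μ (fieldG e Ψ μ ν)) x := by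
      rw [Finset.mul_sum]; exact Finset.sum_congr rfl fun μ _ => by ring
    rw [e3, this]; ring
  have h3 : ∑ μ, ∑ ν, (eta μ : ℂ) * eta ν * D ν (D μ (fieldG e Ψ μ ν)) x
      = -∑ μ, ∑ ν, (eta μ : ℂ) * eta ν * D μ (D ν (fieldG e Ψ μ ν)) x := by
    rw [← sum_sum_swap, ← Finset.sum_neg_distrib]
    refine Finset.sum_congr rfl fun μ _ => ?_
    rw [← Finset.sum_neg_distrib]
    refine Finset.sum_congr rfl fun ν _ => ?_
    rw [hanti ν μ]; ring
  have h4 : ∑ μ, ∑ ν, (eta μ : ℂ) * eta ν * D μ (D ν (fieldG e Ψ μ ν)) x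
      - ∑ μ, ∑ ν, (eta μ : ℂ) * eta ν * D ν (D μ (fieldG e Ψ μ ν)) x
      = -(Complex.I * e * ∑ μ, ∑ ν, (eta μ : ℂ) * eta ν * fieldF Ψ μ ν x * fieldG e Ψ μ ν x) := by
    rw [← Finset.sum_sub_distrib, Finset.mul_sum, ← Finset.sum_neg_distrib]
    refine Finset.sum_congr rfl fun μ _ => ?_
    rw [← Finset.sum_sub_distrib, Finset.mul_sum, ← Finset.sum_neg_distrib]
    refine Finset.sum_congr rfl fun ν _ => ?_
    have := gaugeDeriv_comm (e := e) (contDiff_A hΨ) (contDiff_fieldG (e := e) hΨ μ ν) μ ν x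
    rw [fieldF_eq hΨ]
    linear_combination ((eta μ : ℂ) * eta ν) * this
  rw [h2]
  linear_combination (1 / 2 : ℂ) * h4 - (1 / 2 : ℂ) * h3

end Fields

/-! ### The divergence theorem on a slab and the virial theorem. -/

section Slab

open MeasureTheory

/-- The slab `0 ≤ t ≤ T` of space-time. -/
def slab (T : ℝ) : Set Spacetime := {x | 0 ≤ x 0 ∧ x 0 ≤ T}

theorem measurableSet_slab (T : ℝ) : MeasurableSet (slab T) :=
  (measurableSet_le measurable_const (measurable_pi_apply 0)).inter
    (measurableSet_le (measurable_pi_apply 0) measurable_const)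

theorem contDiff_event (t : ℝ) : ContDiff ℝ ∞ (event t) := by
  rw [contDiff_pi]
  intro μ
  refine Fin.cases ?_ (fun j => ?_) μ
  · exact contDiff_const
  · exact contDiff_apply ℝ ℝ j

theorem integral_comp_rotation (Ω : Matrix.specialOrthogonalGroup (Fin 3) ℝ)
    {f : (Fin 3 → ℝ) → ℝ} (hf : Continuous f) :
    ∫ x, f (Ω.1.mulVec x) = ∫ x, f x := by
  have hdet : Ω.1.det = 1 := (Matrix.mem_specialOrthogonalGroup_iff.1 Ω.2).2
  have h := Real.map_matrix_volume_pi_eq_smul_volume_pi (M := Ω.1) (by rw [hdet]; exact one_ne_zero)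
  rw [hdet] at h
  simp only [inv_one, abs_one, ENNReal.ofReal_one, one_smul] at h
  have hc : Continuous (Matrix.toLin' Ω.1) := LinearMap.continuous_of_finiteDimensional _
  conv_rhs => rw [← h]
  rw [integral_map hc.measurable.aemeasurable hf.aestronglyMeasurable]
  rfl

/-- The divergence theorem on a slab for a vector field supported in a spatial box. -/
theorem integral_slab_divergence {f : Fin 4 → Spacetime → ℝ} (hf : ∀ μ, ContDiff ℝ ∞ (f μ))
    {T B : ℝ} (hT : 0 ≤ T) (hB : 0 ≤ B)
    (hsupp : ∀ μ y (j : Fin 3), B ≤ |y j.succ| → f μ y = 0) :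
    ∫ y in slab T, ∑ μ, partialDeriv μ (f μ) y
      = (∫ x, f 0 (event T x)) - ∫ x, f 0 (event 0 x) := by
  set a : Fin 4 → ℝ := event 0 (fun _ => -B) with ha
  set b : Fin 4 → ℝ := event T (fun _ => B) with hb
  have hab : a ≤ b := by
    intro μ
    refine Fin.cases ?_ (fun j => ?_) μ
    · simpa [ha, hb, event] using hT
    · simp [ha, hb, event]; linarith
  have hcont : Continuous fun y => ∑ μ, partialDeriv μ (f μ) y :=
    continuous_finsetSum _ fun μ _ => (contDiff_partialDeriv (hf μ) μ).continuous
  have hsub : Set.Icc a b ⊆ slab T := fun y hy => ⟨by simpa [ha, event] using hy.1 0,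
    by simpa [hb, event] using hy.2 0⟩
  have h1 : ∫ y in slab T, ∑ μ, partialDeriv μ (f μ) y
      = ∫ y in Set.Icc a b, ∑ μ, partialDeriv μ (f μ) y := by
    refine setIntegral_eq_of_subset_of_forall_sdiff_eq_zero (measurableSet_slab T) hsub ?_
    rintro y ⟨hy, hny⟩
    have : ∃ j : Fin 3, B < |y j.succ| := by
      by_contra! hcon
      refine hny ⟨fun μ => ?_, fun μ => ?_⟩
      · refine Fin.cases ?_ (fun j => ?_) μ
        · simpa [ha, event] using hy.1
        · simpa [ha, event] using (abs_le.1 (hcon j)).1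
      · refine Fin.cases ?_ (fun j => ?_) μ
        · simpa [hb, event] using hy.2
        · simpa [hb, event] using (abs_le.1 (hcon j)).2
    obtain ⟨j, hj⟩ := this
    refine Finset.sum_eq_zero fun μ _ => ?_
    have hev : f μ =ᶠ[𝓝 y] fun _ => 0 := by
      have ho : IsOpen {z : Spacetime | B < |z j.succ|} :=
        isOpen_lt continuous_const (continuous_apply _).abs
      filter_upwards [ho.mem_nhds hj] with z hz using hsupp μ z j (le_of_lt hz)
    rw [partialDeriv_congr hev]
    simp [partialDeriv]
  have h2 := integral_divergence_of_hasFDerivAt_off_countable' (n := 3) a b hab f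
    (fun μ y => fderiv ℝ (f μ) y) ∅ Set.countable_empty
    (fun μ => (hf μ).continuous.continuousOn)
    (fun x _ μ => ((hf μ).differentiableAt_infty (x := x)).hasFDerivAt)
    (hcont.continuousOn.integrableOn_compact isCompact_Icc)
  rw [h1]
  change ∫ y in Set.Icc a b, ∑ μ, fderiv ℝ (f μ) y (Pi.single μ 1) = _
  rw [h2, Fin.sum_univ_succ]
  -- On the lateral faces one coordinate has absolute value exactly `B`; the non-strict inequality
  -- in `hsupp` covers this case.
  have hside : ∀ i : Fin 3,
      (∫ x in Set.Icc (a ∘ i.succ.succAbove) (b ∘ i.succ.succAbove),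
        f i.succ (Fin.insertNth i.succ (b i.succ) x))
      - ∫ x in Set.Icc (a ∘ i.succ.succAbove) (b ∘ i.succ.succAbove),
        f i.succ (Fin.insertNth i.succ (a i.succ) x) = 0 := by
    intro i
    have e1 : ∀ x : Fin 3 → ℝ, f i.succ (Fin.insertNth i.succ (b i.succ) x) = 0 := fun x =>
      hsupp _ _ i (by simp [hb, event, le_abs_self])
    have e2 : ∀ x : Fin 3 → ℝ, f i.succ (Fin.insertNth i.succ (a i.succ) x) = 0 := fun x =>
      hsupp _ _ i (by simp [ha, event, le_abs_self])
    simp only [e1, e2, sub_self]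
  rw [Finset.sum_congr rfl fun i _ => hside i, Finset.sum_const_zero, add_zero]
  have hface : ∀ t : ℝ, ∫ x in Set.Icc (a ∘ (0 : Fin 4).succAbove) (b ∘ (0 : Fin 4).succAbove),
      f 0 (Fin.insertNth 0 t x) = ∫ x, f 0 (event t x) := by
    intro t
    have : ∀ x : Fin 3 → ℝ, (Fin.insertNth 0 t x : Fin 4 → ℝ) = event t x := fun x => by
      rw [Fin.insertNth_zero']; rfl
    simp only [this]
    refine setIntegral_eq_integral_of_forall_compl_eq_zero fun x hx => ?_
    have : ∃ j : Fin 3, B < |x j| := by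
      by_contra! hcon
      refine hx ⟨fun j => ?_, fun j => ?_⟩
      · simpa [ha, event] using (abs_le.1 (hcon j)).1
      · simpa [hb, event] using (abs_le.1 (hcon j)).2
    obtain ⟨j, hj⟩ := this
    exact hsupp 0 _ j (by simpa [event] using hj.le)
  have hb0 : b 0 = T := rfl
  have ha0 : a 0 = 0 := rfl
  rw [hb0, ha0, hface, hface]

/-- The square of the spatial distance to the origin. -/
def spatialSq (y : Spacetime) : ℝ := ∑ j : Fin 3, y j.succ ^ 2

theorem contDiff_spatialSq : ContDiff ℝ ∞ spatialSq :=
  ContDiff.sum fun j _ => (contDiff_apply ℝ ℝ j.succ).pow 2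

theorem sq_le_spatialSq (y : Spacetime) (j : Fin 3) : y j.succ ^ 2 ≤ spatialSq y :=
  Finset.single_le_sum (f := fun j : Fin 3 => y j.succ ^ 2) (fun _ _ => sq_nonneg _)
    (Finset.mem_univ j)

theorem spatialSq_event_rotation (Ω : Matrix.specialOrthogonalGroup (Fin 3) ℝ) (s t : ℝ)
    (x : Fin 3 → ℝ) : spatialSq (event t (Ω.1.mulVec x)) = spatialSq (event s x) := by
  have h1 : Ω.1.transpose * Ω.1 = 1 := by
    have := (Matrix.mem_orthogonalGroup_iff' (Fin 3) ℝ).1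
      (Matrix.mem_specialOrthogonalGroup_iff.1 Ω.2).1
    simpa [Matrix.star_eq_conjTranspose] using this
  have h2 : ∀ (r : ℝ) (z : Fin 3 → ℝ), spatialSq (event r z) = z ⬝ᵥ z := by
    intro r z
    simp [spatialSq, event, dotProduct, sq]
  rw [h2, h2, Matrix.dotProduct_mulVec, Matrix.vecMul_mulVec, h1, Matrix.vecMul_one]

theorem partialDeriv_spatialSq (y : Spacetime) (μ : Fin 4) :
    partialDeriv μ spatialSq y = if μ = 0 then 0 else 2 * y μ := by
  have hd : ∀ ν : Fin 4, DifferentiableAt ℝ (fun z : Spacetime => z ν) y := fun ν =>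
    (contDiff_apply ℝ ℝ (n := ∞) ν).differentiableAt_infty
  have : spatialSq = fun z => ∑ j : Fin 3, z j.succ * z j.succ := by
    funext z; simp [spatialSq, sq]
  rw [this, partialDeriv_sum _ fun j _ => (hd _).fun_mul (hd _)]
  simp only [partialDeriv_mul (hd _) (hd _), partialDeriv_coord]
  refine Fin.cases ?_ (fun k => ?_) μ
  · simp [(Fin.succ_ne_zero _).symm]
  · simp [Finset.sum_add_distrib, two_mul]

/-- A smooth function of a real variable that is `1` on `s ≤ 1` and `0` on `2 ≤ s`. -/
def cutoff (s : ℝ) : ℝ := Real.smoothTransition (2 - s)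

theorem contDiff_cutoff : ContDiff ℝ ∞ cutoff :=
  Real.smoothTransition.contDiff.comp (contDiff_const.sub contDiff_id)

theorem cutoff_of_le {s : ℝ} (h : s ≤ 1) : cutoff s = 1 :=
  Real.smoothTransition.one_of_one_le (by linarith)

theorem cutoff_of_ge {s : ℝ} (h : 2 ≤ s) : cutoff s = 0 :=
  Real.smoothTransition.zero_of_nonpos (by linarith)

theorem deriv_cutoff_of_lt {s : ℝ} (h : s < 1) : deriv cutoff s = 0 := by
  have : cutoff =ᶠ[𝓝 s] fun _ => 1 := by
    filter_upwards [Iio_mem_nhds h] with r hr using cutoff_of_le (le_of_lt hr)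
  rw [this.deriv_eq, deriv_const]

theorem deriv_cutoff_of_gt {s : ℝ} (h : 2 < s) : deriv cutoff s = 0 := by
  have : cutoff =ᶠ[𝓝 s] fun _ => 0 := by
    filter_upwards [Ioi_mem_nhds h] with r hr using cutoff_of_ge (le_of_lt hr)
  rw [this.deriv_eq, deriv_const]

theorem exists_bound_deriv_cutoff : ∃ K, 0 ≤ K ∧ ∀ s, |deriv cutoff s| ≤ K := by
  obtain ⟨K, hK⟩ := (isCompact_Icc (a := (1 : ℝ)) (b := 2)).exists_bound_of_continuousOn
    (contDiff_cutoff.continuous_deriv (by simp)).continuousOn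
  refine ⟨max K 0, le_max_right _ _, fun s => ?_⟩
  by_cases h1 : s < 1
  · simp [deriv_cutoff_of_lt h1]
  by_cases h2 : 2 < s
  · simp [deriv_cutoff_of_gt h2]
  · exact (hK s ⟨not_lt.1 h1, not_lt.1 h2⟩).trans (le_max_left _ _)

/-- The cutoff function at radius `R`. -/
def radialCutoff (R : ℝ) (y : Spacetime) : ℝ := cutoff (spatialSq y / R ^ 2)

theorem contDiff_radialCutoff (R : ℝ) : ContDiff ℝ ∞ (radialCutoff R) :=
  contDiff_cutoff.comp (contDiff_spatialSq.div_const _)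

theorem abs_radialCutoff_le (R : ℝ) (y : Spacetime) : |radialCutoff R y| ≤ 1 :=
  abs_le.2 ⟨by linarith [Real.smoothTransition.nonneg (2 - spatialSq y / R ^ 2),
    show radialCutoff R y = Real.smoothTransition (2 - spatialSq y / R ^ 2) from rfl],
    Real.smoothTransition.le_one _⟩

theorem partialDeriv_radialCutoff (R : ℝ) (y : Spacetime) (μ : Fin 4) :
    partialDeriv μ (radialCutoff R) y
      = deriv cutoff (spatialSq y / R ^ 2) * (partialDeriv μ spatialSq y / R ^ 2) := by
  have h1 := (contDiff_cutoff.differentiableAt_infty (x := spatialSq y * (R ^ 2)⁻¹)).hasDerivAt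
  have h2 := ((contDiff_spatialSq.differentiableAt_infty (x := y)).hasFDerivAt).mul_const
    ((R ^ 2)⁻¹)
  have h3 := h1.comp_hasFDerivAt (f := fun z => spatialSq z * (R ^ 2)⁻¹) y h2
  rw [partialDeriv, show radialCutoff R = cutoff ∘ fun z => spatialSq z * (R ^ 2)⁻¹ by
    funext z; simp [radialCutoff, div_eq_mul_inv], h3.fderiv]
  simp only [partialDeriv, div_eq_mul_inv, smul_apply, smul_eq_mul]
  ring

/-- The virial theorem: the divergence of a vector field that is periodic in time up to a rotation
and whose spatial components grow at most like the distance times an integrable function has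
vanishing integral over one period. -/
theorem integral_slab_divergence_eq_zero {J : Fin 4 → Spacetime → ℝ}
    (hJ : ∀ μ, ContDiff ℝ ∞ (J μ)) {T : ℝ} (hT : 0 ≤ T)
    (Ω : Matrix.specialOrthogonalGroup (Fin 3) ℝ)
    (hper : ∀ x : Fin 3 → ℝ, J 0 (event T (Ω.1.mulVec x)) = J 0 (event 0 x))
    {ε : Spacetime → ℝ} (hε : IntegrableOn ε (slab T))
    (hbound : ∀ y (j : Fin 3), |J j.succ y| ≤ (1 + ∑ k : Fin 3, |y k.succ|) * ε y)
    (hdiv : IntegrableOn (fun y => ∑ μ, partialDeriv μ (J μ) y) (slab T)) :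
    ∫ y in slab T, ∑ μ, partialDeriv μ (J μ) y = 0 := by
  obtain ⟨K, hK0, hK⟩ := exists_bound_deriv_cutoff
  have hεn : ∀ y, 0 ≤ ε y := fun y => by
    have h1 : 0 ≤ (1 + ∑ k : Fin 3, |y k.succ|) * ε y := (abs_nonneg _).trans (hbound y 0)
    have h2 : 0 < 1 + ∑ k : Fin 3, |y k.succ| := by positivity
    exact nonneg_of_mul_nonneg_right h1 h2
  set Rn : ℕ → ℝ := fun n => n + 1 with hRn
  have hR1 : ∀ n, 1 ≤ Rn n := fun n => by simp [hRn]
  have hdivR : ∀ R y, ∑ μ, partialDeriv μ (fun z => radialCutoff R z * J μ z) y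
      = radialCutoff R y * ∑ μ, partialDeriv μ (J μ) y
        + ∑ j : Fin 3, deriv cutoff (spatialSq y / R ^ 2) * (2 * y j.succ / R ^ 2) * J j.succ y := by
    intro R y
    have : ∀ μ, partialDeriv μ (fun z => radialCutoff R z * J μ z) y
        = partialDeriv μ (radialCutoff R) y * J μ y + radialCutoff R y * partialDeriv μ (J μ) y :=
      fun μ => partialDeriv_mul (contDiff_radialCutoff R).differentiableAt_infty
        (hJ μ).differentiableAt_infty μ
    simp only [this, Finset.sum_add_distrib, Finset.mul_sum]
    rw [add_comm]
    congr 1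
    rw [Fin.sum_univ_succ]
    simp [partialDeriv_radialCutoff, partialDeriv_spatialSq]
  -- After the cutoff only the two time faces contribute. The substitution x ↦ Ωx on the later face
  -- turns it into the earlier one, because the cutoff is radial.
  have hzero : ∀ n, ∫ y in slab T, ∑ μ, partialDeriv μ (fun z => radialCutoff (Rn n) z * J μ z) y
      = 0 := by
    intro n
    have hR := hR1 n
    rw [integral_slab_divergence (B := 2 * Rn n)
      (fun μ => (contDiff_radialCutoff _).mul (hJ μ)) hT (by linarith)]
    · rw [sub_eq_zero, ← integral_comp_rotation Ω]
      · refine integral_congr_ae (Filter.Eventually.of_forall fun x => ?_)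
        simp only [hper, radialCutoff]
        rw [spatialSq_event_rotation Ω 0 T x]
      · exact (((contDiff_radialCutoff _).mul (hJ 0)).comp (contDiff_event T)).continuous
    · intro μ y j hj
      have h1 : 2 ≤ spatialSq y / (Rn n) ^ 2 := by
        rw [le_div_iff₀ (by positivity)]
        have := sq_le_spatialSq y j
        rw [← sq_abs] at this
        nlinarith
      simp [radialCutoff, cutoff_of_ge h1]
  have hlim : Filter.Tendsto
      (fun n => ∫ y in slab T, ∑ μ, partialDeriv μ (fun z => radialCutoff (Rn n) z * J μ z) y)
      Filter.atTop (𝓝 (∫ y in slab T, ∑ μ, partialDeriv μ (J μ) y)) := by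
    -- Where the cutoff has nonzero derivative, |y_k| ≤ 2R, so 1 + ∑|y_k| ≤ 7R since R ≥ 1, while
    -- the factor 2|y_j|/R² is at most 4/R. This gives 28K per direction and 84K for the three
    -- directions.
    refine tendsto_integral_of_dominated_convergence
      (fun y => |∑ μ, partialDeriv μ (J μ) y| + 84 * K * ε y) ?_ ?_ ?_ ?_
    · intro n
      exact (continuous_finsetSum _ fun μ _ => (contDiff_partialDeriv
        ((contDiff_radialCutoff _).mul (hJ μ)) μ).continuous).aestronglyMeasurable
    · exact hdiv.abs.add (hε.const_mul _)
    · intro n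
      refine Filter.Eventually.of_forall fun y => ?_
      rw [hdivR, Real.norm_eq_abs]
      refine (abs_add_le _ _).trans (add_le_add ?_ ?_)
      · rw [abs_mul]
        exact mul_le_of_le_one_left (abs_nonneg _) (abs_radialCutoff_le _ _)
      · have hR := hR1 n
        set R := Rn n
        by_cases hs : 2 < spatialSq y / R ^ 2
        · simp only [deriv_cutoff_of_gt hs, zero_mul, Finset.sum_const_zero, abs_zero]
          exact mul_nonneg (by positivity) (hεn y)
        have hyk : ∀ k : Fin 3, |y k.succ| ≤ 2 * R := by
          intro k
          rw [not_lt, div_le_iff₀ (by positivity)] at hs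
          refine abs_le_of_sq_le_sq ?_ (by linarith)
          nlinarith [sq_le_spatialSq y k]
        have hsum : ∑ k : Fin 3, |y k.succ| ≤ 6 * R := by
          rw [Fin.sum_univ_three]; linarith [hyk 0, hyk 1, hyk 2]
        have hterm : ∀ j : Fin 3,
            |deriv cutoff (spatialSq y / R ^ 2) * (2 * y j.succ / R ^ 2) * J j.succ y|
              ≤ 28 * K * ε y := by
          intro j
          have hR2 : 0 < R ^ 2 := by positivity
          rw [abs_mul, abs_mul, abs_div, abs_of_pos hR2, abs_mul, abs_two]
          have a1 : 2 * |y j.succ| / R ^ 2 ≤ 4 / R := by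
            rw [div_le_div_iff₀ hR2 (by linarith)]
            nlinarith [hyk j]
          have a2 : |J j.succ y| ≤ 7 * R * ε y :=
            (hbound y j).trans (mul_le_mul_of_nonneg_right (by linarith) (hεn y))
          calc _ ≤ K * (4 / R) * (7 * R * ε y) := by
                  gcongr
                  exact hK _
            _ = 28 * K * ε y := by field_simp; ring
        calc _ ≤ ∑ j : Fin 3, 28 * K * ε y :=
              (Finset.abs_sum_le_sum_abs _ _).trans (Finset.sum_le_sum fun j _ => hterm j)
          _ = 84 * K * ε y := by simp; ring
    · refine Filter.Eventually.of_forall fun y => ?_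
      refine tendsto_const_nhds.congr' ?_
      obtain ⟨N, hN⟩ := exists_nat_gt (spatialSq y)
      filter_upwards [Filter.eventually_ge_atTop N] with n hn
      -- Once R exceeds the distance of `y` to the axis, the cutoff is 1 near `y`, so the cut-off
      -- divergence equals the original one.
      have h1 : spatialSq y / (Rn n) ^ 2 < 1 := by
        have hR := hR1 n
        rw [div_lt_one (by positivity)]
        have : (N : ℝ) ≤ n := by exact_mod_cast hn
        have : (n : ℝ) ≤ Rn n := by simp [hRn]
        nlinarith
      rw [hdivR]
      simp [radialCutoff, cutoff_of_le h1.le, deriv_cutoff_of_lt h1]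
  simp only [hzero] at hlim
  exact tendsto_nhds_unique hlim tendsto_const_nhds

end Slab

/-! ### From the Euler-Lagrange equations to the field equations. -/

section EulerLagrangeEquations

variable {e m : ℝ} {Ψ : Spacetime → FieldValue}

theorem hasDerivAt_norm_sq_line (a b : ℂ) :
    HasDerivAt (fun t : ℝ => ‖a + t * b‖ ^ 2) (2 * reDot a b) 0 := by
  have h1 : (fun t : ℝ => ‖a + t * b‖ ^ 2)
      = fun t : ℝ => (a.re + t * b.re) ^ 2 + (a.im + t * b.im) ^ 2 := by
    funext t
    rw [← reDot_self]
    simp [reDot]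
    ring
  have h2 : ∀ r s : ℝ, HasDerivAt (fun t : ℝ => (r + t * s) ^ 2) (2 * (r * s)) 0 := by
    intro r s
    have := (((hasDerivAt_id (0 : ℝ)).mul_const s).const_add r).pow 2
    convert! this using 1
    simp; ring
  rw [h1]
  convert! (h2 a.re b.re).add (h2 a.im b.im) using 1
  simp [reDot]; ring

theorem hasDerivAt_sq_line (r s : ℝ) :
    HasDerivAt (fun t : ℝ => (r + t * s) ^ 2) (2 * (r * s)) 0 := by
  have := (((hasDerivAt_id (0 : ℝ)).mul_const s).const_add r).pow 2
  convert! this using 1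
  simp; ring

/-- The first variation of the Lagrangian along a curve on which the field strengths and the
vector field are affine functions of the parameter. -/
theorem deriv_lagrangian_line {u : ℝ → FieldValue} {p : ℝ → Fin 4 → FieldValue}
    {G g : Fin 4 → Fin 4 → ℂ} {F f : Fin 4 → Fin 4 → ℝ} {W w : Fin 4 → ℂ}
    (hG : ∀ t α β, strengthW e (u t) (p t) α β = G α β + (t : ℝ) * g α β)
    (hF : ∀ t α β, strengthF (p t) α β = F α β + t * f α β)
    (hW : ∀ t α, (u t).1 α = W α + (t : ℝ) * w α) :
    deriv (fun t => lagrangian e m (u t) (p t)) 0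
      = -∑ α, ∑ β, eta α * eta β * reDot (G α β) (g α β)
        + 2 * m ^ 2 * ∑ α, eta α * reDot (W α) (w α)
        - 1 / 2 * ∑ α, ∑ β, eta α * eta β * (F α β * f α β) := by
  have h1 : HasDerivAt (fun t => lagrangian e m (u t) (p t))
      (-(1 / 2) * ∑ α, ∑ β, eta α * eta β * (2 * reDot (G α β) (g α β))
        + m ^ 2 * ∑ α, eta α * (2 * reDot (W α) (w α))
        - (1 / 4) * ∑ α, ∑ β, eta α * eta β * (2 * (F α β * f α β))) 0 := by
    simp only [lagrangian, hG, hF, hW]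
    refine ((HasDerivAt.const_mul _ ?_).add (HasDerivAt.const_mul _ ?_)).sub
      (HasDerivAt.const_mul _ ?_)
    · exact HasDerivAt.fun_sum fun α _ => HasDerivAt.fun_sum fun β _ =>
        (hasDerivAt_norm_sq_line _ _).const_mul _
    · exact HasDerivAt.fun_sum fun α _ => (hasDerivAt_norm_sq_line _ _).const_mul _
    · exact HasDerivAt.fun_sum fun α _ => HasDerivAt.fun_sum fun β _ =>
        (hasDerivAt_sq_line _ _).const_mul _
  rw [h1.deriv]
  simp only [mul_left_comm _ (2 : ℝ), ← Finset.mul_sum]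
  ring

theorem sum_antisymm_reDot {G : Fin 4 → Fin 4 → ℂ} (hG : ∀ α β, G α β = -G β α)
    (x w : Fin 4 → ℂ) :
    ∑ α, ∑ β, eta α * eta β * reDot (G α β) (x α * w β - x β * w α)
      = 2 * ∑ α, ∑ β, eta α * eta β * reDot (G α β) (x α * w β) := by
  have h : ∀ α β, eta α * eta β * reDot (G α β) (x α * w β - x β * w α)
      = eta α * eta β * reDot (G α β) (x α * w β) + eta β * eta α * reDot (G β α) (x β * w α) := by
    intro α β
    rw [hG β α]
    simp [reDot]
    ring
  simp only [h, Finset.sum_add_distrib]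
  rw [Finset.sum_comm (f := fun α β => eta β * eta α * reDot (G β α) (x β * w α))]
  ring

theorem sum_antisymm_mul {F : Fin 4 → Fin 4 → ℝ} (hF : ∀ α β, F α β = -F β α)
    (x a : Fin 4 → ℝ) :
    ∑ α, ∑ β, eta α * eta β * (F α β * (x α * a β - x β * a α))
      = 2 * ∑ α, ∑ β, eta α * eta β * (F α β * (x α * a β)) := by
  have h : ∀ α β, eta α * eta β * (F α β * (x α * a β - x β * a α))
      = eta α * eta β * (F α β * (x α * a β)) + eta β * eta α * (F β α * (x β * a α)) := by
    intro α β
    rw [hF β α]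
    ring
  simp only [h, Finset.sum_add_distrib]
  rw [Finset.sum_comm (f := fun α β => eta β * eta α * (F β α * (x β * a α)))]
  ring

theorem lineDeriv_lagrangian_momentum (y : Spacetime) (μ : Fin 4) (v : FieldValue) :
    lineDeriv ℝ (fun p => lagrangian e m (Ψ y) p) (grad Ψ y) (Pi.single μ v)
      = -(2 * eta μ * ∑ β, eta β * reDot (fieldG e Ψ μ β y) (v.1 β))
        - eta μ * ∑ β, eta β * (fieldF Ψ μ β y * v.2 β) := by
  have hc : ∀ α, ((Pi.single μ v : Fin 4 → FieldValue) α).1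
      = fun β => (Pi.single μ 1 : Fin 4 → ℂ) α * v.1 β := by
    intro α; funext β
    by_cases h : α = μ
    · subst h; simp
    · simp [h]
  have hr : ∀ α, ((Pi.single μ v : Fin 4 → FieldValue) α).2
      = fun β => (Pi.single μ 1 : Fin 4 → ℝ) α * v.2 β := by
    intro α; funext β
    by_cases h : α = μ
    · subst h; simp
    · simp [h]
  have key := deriv_lagrangian_line (e := e) (m := m) (u := fun _ => Ψ y)
    (p := fun t => grad Ψ y + t • (Pi.single μ v : Fin 4 → FieldValue))
    (G := fun α β => fieldG e Ψ α β y) (F := fun α β => fieldF Ψ α β y)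
    (g := fun α β => (Pi.single μ 1 : Fin 4 → ℂ) α * v.1 β - (Pi.single μ 1 : Fin 4 → ℂ) β * v.1 α)
    (f := fun α β => (Pi.single μ 1 : Fin 4 → ℝ) α * v.2 β - (Pi.single μ 1 : Fin 4 → ℝ) β * v.2 α)
    (W := (Ψ y).1) (w := 0)
    (by intro t α β; simp [fieldG, strengthW, covDeriv, hc]; ring)
    (by intro t α β; simp [fieldF, strengthF, hr]; ring)
    (by intro t α; simp)
  rw [lineDeriv, key, sum_antisymm_reDot (fun α β => fieldG_antisymm α β y),
    sum_antisymm_mul (fun α β => fieldF_antisymm α β y)]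
  have e1 : ∑ α, ∑ β, eta α * eta β * reDot (fieldG e Ψ α β y)
      ((Pi.single μ 1 : Fin 4 → ℂ) α * v.1 β)
      = eta μ * ∑ β, eta β * reDot (fieldG e Ψ μ β y) (v.1 β) := by
    rw [Finset.sum_eq_single μ]
    · simp [Finset.mul_sum, mul_assoc]
    · intro α _ h; simp [h, reDot]
    · simp
  have e2 : ∑ α, ∑ β, eta α * eta β * (fieldF Ψ α β y *
      ((Pi.single μ 1 : Fin 4 → ℝ) α * v.2 β))
      = eta μ * ∑ β, eta β * (fieldF Ψ μ β y * v.2 β) := by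
    rw [Finset.sum_eq_single μ]
    · simp [Finset.mul_sum, mul_assoc]
    · intro α _ h; simp [h]
    · simp
  rw [e1, e2]
  simp [reDot]
  ring

/-- W and A are varied separately: `strengthW` contains the product A·W, so it is affine along a
line only if one of the two is kept fixed. -/
theorem lineDeriv_lagrangian_vector (x : Spacetime) (w : Fin 4 → ℂ) :
    lineDeriv ℝ (fun u => lagrangian e m u (grad Ψ x)) (Ψ x) (w, 0)
      = -(2 * ∑ α, ∑ β, eta α * eta β *
          reDot (fieldG e Ψ α β x) (-(Complex.I * e * (Ψ x).2 α) * w β))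
        + 2 * m ^ 2 * ∑ α, eta α * reDot ((Ψ x).1 α) (w α) := by
  have key := deriv_lagrangian_line (e := e) (m := m) (u := fun t => Ψ x + t • (w, 0))
    (p := fun _ => grad Ψ x)
    (G := fun α β => fieldG e Ψ α β x) (F := fun α β => fieldF Ψ α β x)
    (g := fun α β => -(Complex.I * e * (Ψ x).2 α) * w β - -(Complex.I * e * (Ψ x).2 β) * w α)
    (f := 0) (W := (Ψ x).1) (w := w)
    (by intro t α β; simp [fieldG, strengthW, covDeriv]; ring)
    (by intro t α β; simp [fieldF])
    (by intro t α; simp)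
  rw [lineDeriv, key, sum_antisymm_reDot (fun α β => fieldG_antisymm α β x)]
  simp

theorem lineDeriv_lagrangian_potential (x : Spacetime) (a : Fin 4 → ℝ) :
    lineDeriv ℝ (fun u => lagrangian e m u (grad Ψ x)) (Ψ x) (0, a)
      = -(2 * ∑ α, ∑ β, eta α * eta β *
          reDot (fieldG e Ψ α β x) (-(Complex.I * e * a α) * (Ψ x).1 β)) := by
  have key := deriv_lagrangian_line (e := e) (m := m) (u := fun t => Ψ x + t • (0, a))
    (p := fun _ => grad Ψ x)
    (G := fun α β => fieldG e Ψ α β x) (F := fun α β => fieldF Ψ α β x)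
    (g := fun α β => -(Complex.I * e * a α) * (Ψ x).1 β - -(Complex.I * e * a β) * (Ψ x).1 α)
    (f := 0) (W := (Ψ x).1) (w := 0)
    (by intro t α β; simp [fieldG, strengthW, covDeriv]; ring)
    (by intro t α β; simp [fieldF])
    (by intro t α; simp)
  rw [lineDeriv, key, sum_antisymm_reDot (fun α β => fieldG_antisymm α β x)]
  simp [reDot]

theorem eta_mul_self (μ : Fin 4) : eta μ * eta μ = 1 := by
  fin_cases μ <;> simp [eta]

/-- The Euler-Lagrange equations of the action are the field equations. -/
theorem EulerLagrange.fieldEquations (h : EulerLagrange (lagrangian e m) Ψ)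
    (hΨ : ContDiff ℝ ∞ Ψ) : FieldEquations e m Ψ := by
  constructor
  · intro x ν
    set X := ∑ μ, (eta μ : ℂ) * gaugeDeriv e (fun y => (Ψ y).2) μ (fieldG e Ψ μ ν) x
      + m ^ 2 * (Ψ x).1 ν with hX
    -- Varying the component ν of W in the complex direction `z` yields the real inner product of
    -- the equation with `z`; taking `z = X` then gives ‖X‖² = 0.
    have hz : ∀ z : ℂ, reDot X z = 0 := by
      intro z
      have hEL := h x (Pi.single ν z, 0)
      rw [lineDeriv_lagrangian_vector] at hEL
      have e1 : ∀ μ y, lineDeriv ℝ (fun p => lagrangian e m (Ψ y) p) (grad Ψ y)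
          (Pi.single μ ((Pi.single ν z : Fin 4 → ℂ), (0 : Fin 4 → ℝ)))
          = -(2 * eta μ * eta ν) * reDot (fieldG e Ψ μ ν y) z := by
        intro μ y
        rw [lineDeriv_lagrangian_momentum, Finset.sum_eq_single ν]
        · simp; ring
        · intro β _ hβ; simp [hβ, reDot]
        · simp
      have e2 : ∀ μ, partialDeriv μ (fun y => -(2 * eta μ * eta ν) * reDot (fieldG e Ψ μ ν y) z) x
          = -(2 * eta μ * eta ν) * reDot (partialDeriv μ (fieldG e Ψ μ ν) x) z := by
        intro μ
        have hs := contDiff_fieldG (e := e) hΨ μ ν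
        rw [partialDeriv_const_mul (contDiff_reDot hs contDiff_const).differentiableAt_infty,
          -- Charge 0 is used because the constant `z` is to be differentiated without the
          -- connection.
          partialDeriv_reDot hs contDiff_const 0 (fun y => (Ψ y).2)]
        simp [gaugeDeriv, partialDeriv, reDot]
      have e3 : ∀ α, ∑ β, eta α * eta β *
          reDot (fieldG e Ψ α β x) (-(Complex.I * e * (Ψ x).2 α) * (Pi.single ν z : Fin 4 → ℂ) β)
          = eta α * eta ν * reDot (fieldG e Ψ α ν x) (-(Complex.I * e * (Ψ x).2 α) * z) := by
        intro α
        rw [Finset.sum_eq_single ν]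
        · simp
        · intro β _ hβ; simp [hβ, reDot]
        · simp
      have e4 : ∑ α, eta α * reDot ((Ψ x).1 α) ((Pi.single ν z : Fin 4 → ℂ) α)
          = eta ν * reDot ((Ψ x).1 ν) z := by
        rw [Finset.sum_eq_single ν]
        · simp
        · intro β _ hβ; simp [hβ, reDot]
        · simp
      simp only [e1, e2, e3, e4] at hEL
      have hη := eta_mul_self ν
      have e5 : reDot X z = ∑ μ, eta μ *
          (reDot (partialDeriv μ (fieldG e Ψ μ ν) x) z
            - reDot (fieldG e Ψ μ ν x) (-(Complex.I * e * (Ψ x).2 μ) * z))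
          + m ^ 2 * reDot ((Ψ x).1 ν) z := by
        rw [hX, Fin.sum_univ_four, Fin.sum_univ_four]
        simp [gaugeDeriv, reDot, ← Complex.ofReal_pow]
        ring
      rw [e5]
      rw [Fin.sum_univ_four] at hEL ⊢
      rw [Fin.sum_univ_four] at hEL
      -- The variation carries the overall factor `-2 * eta ν`; it is removed using `eta ν * eta ν =
      -- 1`.
      linear_combination -(eta ν / 2) * hEL - (eta 0 *
          (reDot (partialDeriv 0 (fieldG e Ψ 0 ν) x) z
            - reDot (fieldG e Ψ 0 ν x) (-(Complex.I * e * (Ψ x).2 0) * z)) + eta 1 *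
          (reDot (partialDeriv 1 (fieldG e Ψ 1 ν) x) z
            - reDot (fieldG e Ψ 1 ν x) (-(Complex.I * e * (Ψ x).2 1) * z)) + eta 2 *
          (reDot (partialDeriv 2 (fieldG e Ψ 2 ν) x) z
            - reDot (fieldG e Ψ 2 ν x) (-(Complex.I * e * (Ψ x).2 2) * z)) + eta 3 *
          (reDot (partialDeriv 3 (fieldG e Ψ 3 ν) x) z
            - reDot (fieldG e Ψ 3 ν x) (-(Complex.I * e * (Ψ x).2 3) * z))
          + m ^ 2 * reDot ((Ψ x).1 ν) z) * hη
    have := hz X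
    rw [reDot_self] at this
    exact norm_eq_zero.1 (pow_eq_zero_iff (two_ne_zero) |>.1 this)
  · intro x ρ
    have hEL := h x (0, Pi.single ρ 1)
    rw [lineDeriv_lagrangian_potential] at hEL
    have e1 : ∀ μ y, lineDeriv ℝ (fun p => lagrangian e m (Ψ y) p) (grad Ψ y)
        (Pi.single μ ((0 : Fin 4 → ℂ), (Pi.single ρ 1 : Fin 4 → ℝ)))
        = -(eta μ * eta ρ) * fieldF Ψ μ ρ y := by
      intro μ y
      rw [lineDeriv_lagrangian_momentum, Finset.sum_eq_single (s := Finset.univ)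
        (f := fun β => eta β * (fieldF Ψ μ β y * (Pi.single ρ 1 : Fin 4 → ℝ) β)) ρ]
      · simp [reDot]; ring
      · intro β _ hβ; simp [hβ]
      · simp
    have e2 : ∀ μ, partialDeriv μ (fun y => -(eta μ * eta ρ) * fieldF Ψ μ ρ y) x
        = -(eta μ * eta ρ) * partialDeriv μ (fieldF Ψ μ ρ) x := fun μ =>
      partialDeriv_const_mul (contDiff_fieldF hΨ μ ρ).differentiableAt_infty _ μ
    have e3 : ∑ α, ∑ β, eta α * eta β * reDot (fieldG e Ψ α β x)
        (-(Complex.I * e * ((Pi.single ρ 1 : Fin 4 → ℝ) α : ℝ)) * (Ψ x).1 β)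
        = eta ρ * (e * ∑ β, eta β * imDot (fieldG e Ψ ρ β x) ((Ψ x).1 β)) := by
      rw [Finset.sum_eq_single ρ]
      · rw [Finset.mul_sum, Finset.mul_sum]
        refine Finset.sum_congr rfl fun β _ => ?_
        simp [reDot, imDot]; ring
      · intro β _ hβ; simp [hβ, reDot]
      · simp
    simp only [e1, e2] at hEL
    rw [e3] at hEL
    have hη := eta_mul_self ρ
    rw [Fin.sum_univ_four] at hEL ⊢
    linear_combination -eta ρ * hEL - (eta 0 * partialDeriv 0 (fieldF Ψ 0 ρ) x
      + eta 1 * partialDeriv 1 (fieldF Ψ 1 ρ) x + eta 2 * partialDeriv 2 (fieldF Ψ 2 ρ) x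
      + eta 3 * partialDeriv 3 (fieldF Ψ 3 ρ) x
      - 2 * e * ∑ β, eta β * imDot (fieldG e Ψ ρ β x) ((Ψ x).1 β)) * hη

end EulerLagrangeEquations

/-! ### Covariance under affine changes of coordinates. -/

section FrameChange

/-- The fields `Φ` are the fields `Ψ` expressed in the coordinates `y`, where the coordinates of
`Ψ` are `M y + c`. -/
structure IsFrameChange (M : Matrix (Fin 4) (Fin 4) ℝ) (c : Spacetime)
    (Ψ Φ : Spacetime → FieldValue) : Prop where
  vector : ∀ y μ, (Φ y).1 μ = ∑ ν, (M ν μ : ℂ) * (Ψ (M.mulVec y + c)).1 ν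
  potential : ∀ y μ, (Φ y).2 μ = ∑ ν, M ν μ * (Ψ (M.mulVec y + c)).2 ν

variable {e m : ℝ} {M : Matrix (Fin 4) (Fin 4) ℝ} {c : Spacetime} {Ψ Φ : Spacetime → FieldValue}

theorem contDiff_mulVec_add (M : Matrix (Fin 4) (Fin 4) ℝ) (c : Spacetime) :
    ContDiff ℝ ∞ fun y : Spacetime => M.mulVec y + c :=
  (Matrix.toLin' M).toContinuousLinearMap.contDiff.add contDiff_const

theorem IsFrameChange.contDiff (h : IsFrameChange M c Ψ Φ) (hΨ : ContDiff ℝ ∞ Ψ) :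
    ContDiff ℝ ∞ Φ := by
  refine ContDiff.prodMk (f := fun y => (Φ y).1) (g := fun y => (Φ y).2)
    (contDiff_pi.2 fun μ => ?_) (contDiff_pi.2 fun μ => ?_)
  · simp only [h.vector]
    exact ContDiff.sum fun ν _ => contDiff_const.mul
      ((contDiff_W hΨ ν).comp (contDiff_mulVec_add M c))
  · simp only [h.potential]
    exact ContDiff.sum fun ν _ => contDiff_const.mul
      ((contDiff_A hΨ ν).comp (contDiff_mulVec_add M c))

theorem IsFrameChange.gaugeDeriv_comp (h : IsFrameChange M c Ψ Φ) {f : Spacetime → ℂ}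
    (hf : ContDiff ℝ ∞ f) (μ : Fin 4) (y : Spacetime) :
    gaugeDeriv e (fun y => (Φ y).2) μ (fun y => f (M.mulVec y + c)) y
      = ∑ α, (M α μ : ℂ) * gaugeDeriv e (fun y => (Ψ y).2) α f (M.mulVec y + c) := by
  rw [gaugeDeriv, partialDeriv_comp_mulVec (hf.differentiable (by simp)), h.potential]
  simp only [gaugeDeriv, Complex.real_smul, Fin.sum_univ_four]
  push_cast
  ring

theorem IsFrameChange.fieldG_eq (h : IsFrameChange M c Ψ Φ) (hΨ : ContDiff ℝ ∞ Ψ) (μ ν : Fin 4) :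
    fieldG e Φ μ ν = fun y =>
      ∑ α, ∑ β, ((M α μ * M β ν : ℝ) : ℂ) * fieldG e Ψ α β (M.mulVec y + c) := by
  have key : ∀ μ ν y, gaugeDeriv e (fun y => (Φ y).2) μ (fun y => (Φ y).1 ν) y
      = ∑ β, (M β ν : ℂ) * ∑ α, (M α μ : ℂ) *
        gaugeDeriv e (fun y => (Ψ y).2) α (fun y => (Ψ y).1 β) (M.mulVec y + c) := by
    intro μ ν y
    simp only [h.vector]
    have hc : ∀ β, ContDiff ℝ ∞ fun y => (Ψ (M.mulVec y + c)).1 β := fun β =>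
      (contDiff_W hΨ β).comp (contDiff_mulVec_add M c)
    rw [gaugeDeriv_sum _ fun β => contDiff_const.mul (hc β)]
    refine Finset.sum_congr rfl fun β _ => ?_
    rw [gaugeDeriv_const_mul (hc β), h.gaugeDeriv_comp (contDiff_W hΨ β)]
  funext y
  rw [ChargedVector.fieldG_eq (h.contDiff hΨ)]
  beta_reduce
  rw [key, key]
  simp only [ChargedVector.fieldG_eq hΨ, Finset.mul_sum]
  rw [Finset.sum_comm, ← Finset.sum_sub_distrib]
  refine Finset.sum_congr rfl fun α _ => ?_
  rw [← Finset.sum_sub_distrib]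
  refine Finset.sum_congr rfl fun β _ => ?_
  push_cast
  ring

theorem IsFrameChange.fieldF_eq (h : IsFrameChange M c Ψ Φ) (hΨ : ContDiff ℝ ∞ Ψ) (μ ν : Fin 4) :
    fieldF Φ μ ν = fun y =>
      ∑ α, ∑ β, (M α μ * M β ν) * fieldF Ψ α β (M.mulVec y + c) := by
  have key : ∀ μ ν y, partialDeriv μ (fun y => (Φ y).2 ν) y
      = ∑ β, M β ν * ∑ α, M α μ *
        partialDeriv α (fun y => (Ψ y).2 β) (M.mulVec y + c) := by
    intro μ ν y
    simp only [h.potential]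
    have hc : ∀ β, ContDiff ℝ ∞ fun y => (Ψ (M.mulVec y + c)).2 β := fun β =>
      (contDiff_A hΨ β).comp (contDiff_mulVec_add M c)
    rw [partialDeriv_sum _ fun β _ => (contDiff_const.mul (hc β)).differentiableAt_infty]
    refine Finset.sum_congr rfl fun β _ => ?_
    rw [partialDeriv_const_mul (hc β).differentiableAt_infty,
      partialDeriv_comp_mulVec ((contDiff_A hΨ β).differentiable (by simp))]
    simp only [smul_eq_mul]
  funext y
  rw [ChargedVector.fieldF_eq (h.contDiff hΨ)]
  beta_reduce
  rw [key, key]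
  simp only [ChargedVector.fieldF_eq hΨ, Finset.mul_sum]
  rw [Finset.sum_comm, ← Finset.sum_sub_distrib]
  refine Finset.sum_congr rfl fun α _ => ?_
  rw [← Finset.sum_sub_distrib]
  refine Finset.sum_congr rfl fun β _ => ?_
  ring

/-- The matrix `M` is a Lorentz transformation. -/
def IsLorentz (M : Matrix (Fin 4) (Fin 4) ℝ) : Prop :=
  M * Matrix.diagonal eta * M.transpose = Matrix.diagonal eta

theorem IsLorentz.apply (hM : IsLorentz M) (α β : Fin 4) :
    ∑ μ, eta μ * (M α μ * M β μ) = if α = β then eta α else 0 := by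
  have := congrFun (congrFun hM α) β
  rw [Matrix.diagonal_apply] at this
  rw [← this, Matrix.mul_apply]
  refine Finset.sum_congr rfl fun μ _ => ?_
  rw [Matrix.mul_diagonal, Matrix.transpose_apply]
  ring

/-- Covariant components are pulled back by the transpose of `M`, so contracting two of them with η
produces M η Mᵀ; this is why `IsLorentz` is phrased with that product. The general module `V` covers
real and complex tensors at once. -/
theorem IsLorentz.contract (hM : IsLorentz M) {V : Type*} [AddCommGroup V] [Module ℝ V]
    (H : Fin 4 → Fin 4 → V) :
    ∑ μ, eta μ • ∑ α, ∑ γ, (M α μ * M γ μ) • H α γ = ∑ α, eta α • H α α := by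
  simp only [Finset.smul_sum, smul_smul]
  rw [Finset.sum_comm]
  refine Finset.sum_congr rfl fun α _ => ?_
  rw [Finset.sum_comm]
  simp only [← Finset.sum_smul, hM.apply]
  simp

theorem IsLorentz.contract_mul (hM : IsLorentz M) (a b : Fin 4 → ℝ) :
    ∑ μ, eta μ * ((∑ α, M α μ * a α) * ∑ γ, M γ μ * b γ) = ∑ α, eta α * (a α * b α) := by
  have := hM.contract fun α γ => a α * b γ
  simp only [smul_eq_mul] at this
  rw [← this]
  refine Finset.sum_congr rfl fun μ _ => ?_
  rw [Finset.sum_mul_sum]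
  congr 1
  exact Finset.sum_congr rfl fun α _ => Finset.sum_congr rfl fun γ _ => by ring

theorem IsLorentz.contract_reDot (hM : IsLorentz M) (a b : Fin 4 → ℂ) :
    ∑ μ, eta μ * reDot (∑ α, (M α μ : ℂ) * a α) (∑ γ, (M γ μ : ℂ) * b γ)
      = ∑ α, eta α * reDot (a α) (b α) := by
  simp only [reDot, Complex.re_sum, Complex.im_sum, Complex.re_ofReal_mul, Complex.im_ofReal_mul,
    mul_add, Finset.sum_add_distrib]
  rw [hM.contract_mul, hM.contract_mul]

theorem IsLorentz.contract_imDot (hM : IsLorentz M) (a b : Fin 4 → ℂ) :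
    ∑ μ, eta μ * imDot (∑ α, (M α μ : ℂ) * a α) (∑ γ, (M γ μ : ℂ) * b γ)
      = ∑ α, eta α * imDot (a α) (b α) := by
  simp only [imDot, Complex.re_sum, Complex.im_sum, Complex.re_ofReal_mul, Complex.im_ofReal_mul,
    mul_sub, Finset.sum_sub_distrib]
  rw [hM.contract_mul, hM.contract_mul]

/-- The field equations are Lorentz covariant. -/
theorem IsFrameChange.fieldEquations (h : IsFrameChange M c Ψ Φ) (hM : IsLorentz M)
    (hΨ : ContDiff ℝ ∞ Ψ) (hEq : FieldEquations e m Ψ) : FieldEquations e m Φ := by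
  constructor
  · intro y ν
    set z := M.mulVec y + c
    set D := gaugeDeriv e (fun y => (Ψ y).2)
    have e1 : ∀ μ, gaugeDeriv e (fun y => (Φ y).2) μ (fieldG e Φ μ ν) y
        = ∑ α, ∑ γ, (M α μ * M γ μ) • ∑ β, (M β ν : ℂ) * D γ (fieldG e Ψ α β) z := by
      intro μ
      have hc : ∀ α β, ContDiff ℝ ∞ fun y => fieldG e Ψ α β (M.mulVec y + c) := fun α β =>
        (contDiff_fieldG hΨ α β).comp (contDiff_mulVec_add M c)
      rw [h.fieldG_eq hΨ, gaugeDeriv_sum _ fun α => ContDiff.sum fun β _ =>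
        contDiff_const.mul (hc α β)]
      refine Finset.sum_congr rfl fun α _ => ?_
      rw [gaugeDeriv_sum _ fun β => contDiff_const.mul (hc α β)]
      simp only [gaugeDeriv_const_mul (hc α _), h.gaugeDeriv_comp (contDiff_fieldG hΨ α _),
        Finset.mul_sum, Finset.smul_sum, Complex.real_smul]
      rw [Finset.sum_comm]
      refine Finset.sum_congr rfl fun γ _ => Finset.sum_congr rfl fun β _ => ?_
      push_cast
      ring
    have e2 := hM.contract fun α γ => ∑ β, (M β ν : ℂ) * D γ (fieldG e Ψ α β) z
    simp only [← e1] at e2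
    simp only [Complex.real_smul] at e2
    rw [e2, h.vector]
    simp only [Finset.mul_sum]
    rw [Finset.sum_comm, ← Finset.sum_add_distrib]
    refine Finset.sum_eq_zero fun β _ => ?_
    have e3 := hEq.vector z β
    calc _ = (M β ν : ℂ) * (∑ μ, (eta μ : ℂ) * D μ (fieldG e Ψ μ β) z
          + m ^ 2 * (Ψ z).1 β) := by
          rw [mul_add, Finset.mul_sum]
          congr 1
          · exact Finset.sum_congr rfl fun _ _ => by ring
          · ring
      _ = 0 := by rw [e3, mul_zero]
  · intro y ρ
    set z := M.mulVec y + c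
    have e1 : ∀ μ, partialDeriv μ (fieldF Φ μ ρ) y
        = ∑ α, ∑ γ, (M α μ * M γ μ) • ∑ β, M β ρ * partialDeriv γ (fieldF Ψ α β) z := by
      intro μ
      have hc : ∀ α β, ContDiff ℝ ∞ fun y => fieldF Ψ α β (M.mulVec y + c) := fun α β =>
        (contDiff_fieldF hΨ α β).comp (contDiff_mulVec_add M c)
      rw [h.fieldF_eq hΨ, partialDeriv_sum _ fun α _ => (ContDiff.sum fun β _ =>
        contDiff_const.mul (hc α β)).differentiableAt_infty]
      refine Finset.sum_congr rfl fun α _ => ?_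
      rw [partialDeriv_sum _ fun β _ => (contDiff_const.mul (hc α β)).differentiableAt_infty]
      simp only [partialDeriv_const_mul (hc α _).differentiableAt_infty,
        partialDeriv_comp_mulVec ((contDiff_fieldF hΨ α _).differentiable (by simp)),
        Finset.mul_sum, smul_eq_mul]
      rw [Finset.sum_comm]
      refine Finset.sum_congr rfl fun γ _ => Finset.sum_congr rfl fun β _ => ?_
      ring
    have e2 := hM.contract fun α γ => ∑ β, M β ρ * partialDeriv γ (fieldF Ψ α β) z
    simp only [← e1] at e2
    simp only [smul_eq_mul] at e2
    have e4 : ∀ σ, fieldG e Φ ρ σ y = ∑ β, (M β σ : ℂ) * ∑ α, (M α ρ : ℂ) * fieldG e Ψ α β z := by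
      intro σ
      rw [h.fieldG_eq hΨ]
      beta_reduce
      rw [Finset.sum_comm]
      simp only [Finset.mul_sum]
      exact Finset.sum_congr rfl fun β _ => Finset.sum_congr rfl fun α _ => by push_cast; ring
    have e5 := hM.contract_imDot (fun β => ∑ α, (M α ρ : ℂ) * fieldG e Ψ α β z)
      (fun β => (Ψ z).1 β)
    simp only [← e4, z, ← h.vector] at e5
    rw [e2, e5]
    simp only [Finset.mul_sum, imDot, Complex.re_sum, Complex.im_sum, Complex.re_ofReal_mul,
      Complex.im_ofReal_mul, Finset.sum_mul, ← Finset.sum_sub_distrib]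
    rw [Finset.sum_comm, Finset.sum_comm (s := Finset.univ) (t := Finset.univ)
      (f := fun σ i => 2 * e * (eta σ * (M i ρ * (fieldG e Ψ i σ (M.mulVec y + c)).re *
        ((Ψ (M.mulVec y + c)).1 σ).im - M i ρ * (fieldG e Ψ i σ (M.mulVec y + c)).im *
        ((Ψ (M.mulVec y + c)).1 σ).re)))]
    refine Finset.sum_congr rfl fun β _ => ?_
    have e3 := hEq.maxwell z β
    calc _ = M β ρ * ∑ μ, eta μ * partialDeriv μ (fieldF Ψ μ β) z := by
          rw [Finset.mul_sum]
          exact Finset.sum_congr rfl fun _ _ => by ring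
      _ = _ := by
          rw [e3, Finset.mul_sum, Finset.mul_sum]
          exact Finset.sum_congr rfl fun _ _ => by simp only [imDot, z]; ring

end FrameChange

/-! ### The boost is a Lorentz transformation. -/

section Boost

theorem isFrameChange_changeFrame (M : Matrix (Fin 4) (Fin 4) ℝ) (Ψ : Spacetime → FieldValue) :
    IsFrameChange M 0 Ψ (changeFrame M Ψ) :=
  ⟨fun y μ => by simp [changeFrame], fun y μ => by simp [changeFrame]⟩

theorem lorentzFactor_sq {v : Fin 3 → ℝ} (hv : v ⬝ᵥ v < 1) :
    lorentzFactor v ^ 2 * (1 - v ⬝ᵥ v) = 1 := by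
  have : 0 < 1 - v ⬝ᵥ v := by linarith
  rw [lorentzFactor, div_pow, Real.sq_sqrt this.le]
  field_simp

theorem lorentzFactor_pos {v : Fin 3 → ℝ} (hv : v ⬝ᵥ v < 1) : 0 < lorentzFactor v :=
  one_div_pos.2 (Real.sqrt_pos.2 (by linarith))

theorem boost_transpose (v : Fin 3 → ℝ) : (boost v).transpose = boost v := by
  ext μ ν
  refine Fin.cases ?_ (fun i => ?_) μ <;> refine Fin.cases ?_ (fun j => ?_) ν
  · rfl
  · simp [boost]
  · simp [boost]
  · simp [boost, eq_comm]; ring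

theorem isLorentz_boost {v : Fin 3 → ℝ} (hv : v ⬝ᵥ v < 1) : IsLorentz (boost v) := by
  have h1 := lorentzFactor_sq hv
  have hpos := lorentzFactor_pos hv
  rw [IsLorentz, boost_transpose]
  set γ := lorentzFactor v with hγ
  set k := γ ^ 2 / (1 + γ) with hk
  have hk1 : k * (1 + γ) = γ ^ 2 := by rw [hk]; field_simp
  have hvv : v ⬝ᵥ v = v 0 * v 0 + v 1 * v 1 + v 2 * v 2 := by
    simp [dotProduct, Fin.sum_univ_three]
  rw [hvv] at h1
  -- This is γ²|v|² = γ² - 1 = (γ - 1)(γ + 1) divided by 1 + γ; it holds also at v = 0.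
  have h2 : k * (v 0 * v 0 + v 1 * v 1 + v 2 * v 2) = γ - 1 := by
    have : (1 + γ) * (k * (v 0 * v 0 + v 1 * v 1 + v 2 * v 2)) = (1 + γ) * (γ - 1) := by
      linear_combination (v 0 * v 0 + v 1 * v 1 + v 2 * v 2) * hk1 - h1
    exact mul_left_cancel₀ (by positivity) this
  have hb : boost v = !![γ, γ * v 0, γ * v 1, γ * v 2;
      γ * v 0, 1 + k * v 0 * v 0, k * v 0 * v 1, k * v 0 * v 2;
      γ * v 1, k * v 1 * v 0, 1 + k * v 1 * v 1, k * v 1 * v 2;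
      γ * v 2, k * v 2 * v 0, k * v 2 * v 1, 1 + k * v 2 * v 2] := by
    ext i j
    fin_cases i <;> fin_cases j <;> simp [boost, hk, hγ]
  rw [hb]
  have hspace : ∀ a b : Fin 3, γ ^ 2 * (v a * v b) - 2 * k * (v a * v b)
      - k ^ 2 * (v 0 * v 0 + v 1 * v 1 + v 2 * v 2) * (v a * v b) = 0 := by
    intro a b
    linear_combination -(k * (v a * v b)) * h2 - (v a * v b) * hk1
  clear_value k γ
  ext i j
  rw [Matrix.mul_apply]
  simp only [Matrix.mul_diagonal, Fin.sum_univ_four]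
  fin_cases i <;> fin_cases j <;> simp [eta]
  · linear_combination h1
  · linear_combination -(γ * v 0) * h2
  · linear_combination -(γ * v 1) * h2
  · linear_combination -(γ * v 2) * h2
  · linear_combination -(γ * v 0) * h2
  · linear_combination hspace 0 0
  · linear_combination hspace 0 1
  · linear_combination hspace 0 2
  · linear_combination -(γ * v 1) * h2
  · linear_combination hspace 1 0
  · linear_combination hspace 1 1
  · linear_combination hspace 1 2
  · linear_combination -(γ * v 2) * h2
  · linear_combination hspace 2 0
  · linear_combination hspace 2 1
  · linear_combination hspace 2 2

end Boost

/-! ### Stress-energy conservation and the virial current. -/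

section Currents

theorem reDot_comm (a b : ℂ) : reDot a b = reDot b a := by
  simp only [reDot]; ring

/-- Here `k μ α β` plays the role of ∂_μ K_αβ. Antisymmetry of K lets 2 K^{μρ} k_{μνρ} be written as
K^{μρ}(k_{μνρ} + k_{ρμν}); together with the gradient of the Lagrangian this completes the cyclic
sum, to which a Bianchi identity applies. What remains is the divergence k^μ_{μρ}, governed by the
field equation. -/
theorem kinetic_identity {K : Fin 4 → Fin 4 → ℝ} {k : Fin 4 → Fin 4 → Fin 4 → ℝ}
    (hK : ∀ α β, K α β = -K β α) (hk : ∀ μ α β, k μ α β = -k μ β α) (ν : Fin 4) :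
    ∑ μ, eta μ * (-2 * ∑ ρ, eta ρ * (k μ μ ρ * K ν ρ + K μ ρ * k μ ν ρ))
        + ∑ μ, ∑ ρ, eta μ * eta ρ * (K μ ρ * k ν μ ρ)
      = -2 * ∑ ρ, eta ρ * ((∑ μ, eta μ * k μ μ ρ) * K ν ρ)
        - ∑ μ, ∑ ρ, eta μ * eta ρ * (K μ ρ * (k μ ν ρ + k ν ρ μ + k ρ μ ν)) := by
  have h1 : ∑ μ, ∑ ρ, eta μ * eta ρ * (K μ ρ * k ρ μ ν)
      = ∑ μ, ∑ ρ, eta μ * eta ρ * (K μ ρ * k μ ν ρ) := by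
    rw [Finset.sum_comm]
    refine Finset.sum_congr rfl fun μ _ => Finset.sum_congr rfl fun ρ _ => ?_
    rw [hK ρ μ, hk μ ρ ν]; ring
  have h2 : ∑ ρ, eta ρ * ((∑ μ, eta μ * k μ μ ρ) * K ν ρ)
      = ∑ μ, ∑ ρ, eta μ * eta ρ * (k μ μ ρ * K ν ρ) := by
    rw [Finset.sum_comm]
    refine Finset.sum_congr rfl fun ρ _ => ?_
    rw [Finset.sum_mul, Finset.mul_sum]
    exact Finset.sum_congr rfl fun μ _ => by ring
  have h3 : ∑ μ, eta μ * (-2 * ∑ ρ, eta ρ * (k μ μ ρ * K ν ρ + K μ ρ * k μ ν ρ))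
      = -2 * ∑ μ, ∑ ρ, eta μ * eta ρ * (k μ μ ρ * K ν ρ)
        - 2 * ∑ μ, ∑ ρ, eta μ * eta ρ * (K μ ρ * k μ ν ρ) := by
    simp only [Finset.mul_sum, ← Finset.sum_sub_distrib]
    exact Finset.sum_congr rfl fun μ _ => Finset.sum_congr rfl fun ρ _ => by ring
  have h4 : ∑ μ, ∑ ρ, eta μ * eta ρ * (K μ ρ * (k μ ν ρ + k ν ρ μ + k ρ μ ν))
      = ∑ μ, ∑ ρ, eta μ * eta ρ * (K μ ρ * k μ ν ρ)
        - ∑ μ, ∑ ρ, eta μ * eta ρ * (K μ ρ * k ν μ ρ)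
        + ∑ μ, ∑ ρ, eta μ * eta ρ * (K μ ρ * k ρ μ ν) := by
    simp only [← Finset.sum_sub_distrib, ← Finset.sum_add_distrib]
    refine Finset.sum_congr rfl fun μ _ => Finset.sum_congr rfl fun ρ _ => ?_
    rw [hk ν ρ μ]; ring
  rw [h2, h3, h4, h1]
  ring

theorem kinetic_identity_reDot {G : Fin 4 → Fin 4 → ℂ} {dG : Fin 4 → Fin 4 → Fin 4 → ℂ}
    (hG : ∀ α β, G α β = -G β α) (hdG : ∀ μ α β, dG μ α β = -dG μ β α) (ν : Fin 4) :
    ∑ μ, eta μ * (-2 * ∑ ρ, eta ρ * (reDot (dG μ μ ρ) (G ν ρ) + reDot (G μ ρ) (dG μ ν ρ)))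
        + ∑ μ, ∑ ρ, eta μ * eta ρ * reDot (G μ ρ) (dG ν μ ρ)
      = -2 * ∑ ρ, eta ρ * reDot (∑ μ, (eta μ : ℂ) * dG μ μ ρ) (G ν ρ)
        - ∑ μ, ∑ ρ, eta μ * eta ρ * reDot (G μ ρ) (dG μ ν ρ + dG ν ρ μ + dG ρ μ ν) := by
  have hre := kinetic_identity (K := fun α β => (G α β).re) (k := fun μ α β => (dG μ α β).re)
    (fun α β => by rw [hG α β, Complex.neg_re]) (fun μ α β => by rw [hdG μ α β, Complex.neg_re]) ν
  have him := kinetic_identity (K := fun α β => (G α β).im) (k := fun μ α β => (dG μ α β).im)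
    (fun α β => by rw [hG α β, Complex.neg_im]) (fun μ α β => by rw [hdG μ α β, Complex.neg_im]) ν
  have h := congrArg₂ (· + ·) hre him
  simp only [reDot, Complex.re_sum, Complex.im_sum, Complex.re_ofReal_mul, Complex.im_ofReal_mul,
    Complex.add_re, Complex.add_im]
  simp only [Finset.mul_sum, Finset.sum_mul, ← Finset.sum_add_distrib, ← Finset.sum_sub_distrib]
    at h ⊢
  convert! h using 1
  · refine Finset.sum_congr rfl fun _ _ => ?_
    refine Finset.sum_congr rfl fun _ _ => ?_
    ring
  · refine Finset.sum_congr rfl fun _ _ => ?_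
    refine Finset.sum_congr rfl fun _ _ => ?_
    ring

theorem reDot_sum_left {ι : Type*} (s : Finset ι) (a : ι → ℂ) (b : ℂ) :
    reDot (∑ i ∈ s, a i) b = ∑ i ∈ s, reDot (a i) b := by
  simp only [reDot, Complex.re_sum, Complex.im_sum, Finset.sum_mul, Finset.sum_add_distrib]

/-- The algebraic part of the conservation of the stress-energy tensor. The arrays stand for the
values of the fields and of their covariant derivatives at one point. -/
theorem stress_conservation_algebra {e m : ℝ} {G : Fin 4 → Fin 4 → ℂ}
    {dG : Fin 4 → Fin 4 → Fin 4 → ℂ} {F : Fin 4 → Fin 4 → ℝ} {dF : Fin 4 → Fin 4 → Fin 4 → ℝ}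
    {W : Fin 4 → ℂ} {dW : Fin 4 → Fin 4 → ℂ}
    (hG : ∀ α β, G α β = -G β α) (hdG : ∀ μ α β, dG μ α β = -dG μ β α)
    (hF : ∀ α β, F α β = -F β α) (hdF : ∀ μ α β, dF μ α β = -dF μ β α)
    (hGW : ∀ α β, G α β = dW α β - dW β α)
    (hvec : ∀ ν, ∑ μ, (eta μ : ℂ) * dG μ μ ν + m ^ 2 * W ν = 0)
    (hmax : ∀ ρ, ∑ μ, eta μ * dF μ μ ρ = 2 * e * ∑ σ, eta σ * imDot (G ρ σ) (W σ))
    (hbG : ∀ μ ν ρ, dG μ ν ρ + dG ν ρ μ + dG ρ μ ν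
      = -(Complex.I * e * (F μ ν * W ρ + F ν ρ * W μ + F ρ μ * W ν)))
    (hbF : ∀ μ ν ρ, dF μ ν ρ + dF ν ρ μ + dF ρ μ ν = 0)
    (hdiv : m ^ 2 * ∑ ν, (eta ν : ℂ) * dW ν ν
      = -(Complex.I * e / 2 * ∑ μ, ∑ ν, (eta μ : ℂ) * eta ν * F μ ν * G μ ν)) (ν : Fin 4) :
    ∑ μ, eta μ * (-2 * ∑ ρ, eta ρ * (reDot (dG μ μ ρ) (G ν ρ) + reDot (G μ ρ) (dG μ ν ρ))
        + 2 * m ^ 2 * (reDot (dW μ μ) (W ν) + reDot (W μ) (dW μ ν))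
        - ∑ ρ, eta ρ * (dF μ μ ρ * F ν ρ + F μ ρ * dF μ ν ρ))
      - (-∑ α, ∑ β, eta α * eta β * reDot (G α β) (dG ν α β)
        + 2 * m ^ 2 * ∑ α, eta α * reDot (W α) (dW ν α)
        - 1 / 2 * ∑ α, ∑ β, eta α * eta β * (F α β * dF ν α β)) = 0 := by
  have kG := kinetic_identity_reDot hG hdG ν
  have kF := kinetic_identity hF hdF ν
  simp only [hbF, mul_zero, Finset.sum_const_zero, sub_zero] at kF
  simp only [hbG] at kG
  -- the field equations
  have e1 : ∑ ρ, eta ρ * reDot (∑ μ, (eta μ : ℂ) * dG μ μ ρ) (G ν ρ)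
      = -(m ^ 2 * ∑ ρ, eta ρ * reDot (W ρ) (G ν ρ)) := by
    rw [Finset.mul_sum, ← Finset.sum_neg_distrib]
    refine Finset.sum_congr rfl fun ρ _ => ?_
    rw [show ∑ μ, (eta μ : ℂ) * dG μ μ ρ = ((-(m ^ 2) : ℝ) : ℂ) * W ρ by
      push_cast; linear_combination hvec ρ]
    simp only [reDot, Complex.re_ofReal_mul, Complex.im_ofReal_mul]
    ring
  -- All interaction terms reduce to two contractions. P, up to a factor, is the Lorentz force on
  -- the charge current: the Maxwell part and the Bianchi part produce it with opposite signs. Q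
  -- cancels against the divergence of W.
  set P := ∑ μ, ∑ ρ, eta μ * eta ρ * (F μ ν * imDot (G μ ρ) (W ρ)) with hP
  set Q := ∑ μ, ∑ ρ, eta μ * eta ρ * (F μ ρ * imDot (G μ ρ) (W ν)) with hQ
  have e2 : ∑ ρ, eta ρ * ((∑ μ, eta μ * dF μ μ ρ) * F ν ρ) = -(2 * e * P) := by
    rw [hP, Finset.mul_sum, ← Finset.sum_neg_distrib]
    refine Finset.sum_congr rfl fun ρ _ => ?_
    rw [hmax, hF ν ρ, Finset.mul_sum, Finset.mul_sum, Finset.sum_mul, Finset.mul_sum,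
      ← Finset.sum_neg_distrib]
    exact Finset.sum_congr rfl fun σ _ => by ring
  have e3 : ∑ μ, ∑ ρ, eta μ * eta ρ * (F ν ρ * imDot (G μ ρ) (W μ)) = P := by
    rw [hP, Finset.sum_comm]
    refine Finset.sum_congr rfl fun μ _ => Finset.sum_congr rfl fun ρ _ => ?_
    rw [hF ν μ, hG ρ μ]
    simp only [imDot, Complex.neg_re, Complex.neg_im]
    ring
  have e4 : ∑ μ, ∑ ρ, eta μ * eta ρ * reDot (G μ ρ)
      (-(Complex.I * e * (F μ ν * W ρ + F ν ρ * W μ + F ρ μ * W ν)))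
      = 2 * e * P - e * Q := by
    have : ∀ μ ρ, eta μ * eta ρ * reDot (G μ ρ)
        (-(Complex.I * e * (F μ ν * W ρ + F ν ρ * W μ + F ρ μ * W ν)))
        = e * (eta μ * eta ρ * (F μ ν * imDot (G μ ρ) (W ρ)))
          + e * (eta μ * eta ρ * (F ν ρ * imDot (G μ ρ) (W μ)))
          - e * (eta μ * eta ρ * (F μ ρ * imDot (G μ ρ) (W ν))) := by
      intro μ ρ
      rw [hF ρ μ]
      simp [reDot, imDot]
      ring
    simp only [this, Finset.sum_add_distrib, Finset.sum_sub_distrib, ← Finset.mul_sum]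
    rw [e3, ← hP, ← hQ]
    ring
  -- the divergence of the vector field
  have e5 : m ^ 2 * ∑ μ, eta μ * reDot (dW μ μ) (W ν) = -(e / 2 * Q) := by
    have h1 : m ^ 2 * ∑ μ, eta μ * reDot (dW μ μ) (W ν)
        = reDot (m ^ 2 * ∑ μ, (eta μ : ℂ) * dW μ μ) (W ν) := by
      rw [← Complex.ofReal_pow]
      simp only [reDot, Complex.re_ofReal_mul, Complex.im_ofReal_mul, Complex.re_sum,
        Complex.im_sum, Finset.mul_sum, Finset.sum_mul, ← Finset.sum_add_distrib]
      exact Finset.sum_congr rfl fun μ _ => by ring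
    rw [h1, hdiv, Finset.mul_sum, ← Finset.sum_neg_distrib, reDot_sum_left, hQ, Finset.mul_sum,
      ← Finset.sum_neg_distrib]
    refine Finset.sum_congr rfl fun μ _ => ?_
    rw [Finset.mul_sum, ← Finset.sum_neg_distrib, reDot_sum_left, Finset.mul_sum,
      ← Finset.sum_neg_distrib]
    refine Finset.sum_congr rfl fun ρ _ => ?_
    simp [reDot, imDot]
    ring
  have e6 : ∑ μ, eta μ * reDot (W μ) (dW μ ν) - ∑ α, eta α * reDot (W α) (dW ν α)
      = -∑ ρ, eta ρ * reDot (W ρ) (G ν ρ) := by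
    rw [← Finset.sum_sub_distrib, ← Finset.sum_neg_distrib]
    refine Finset.sum_congr rfl fun μ _ => ?_
    rw [hGW ν μ]
    simp only [reDot, Complex.sub_re, Complex.sub_im]
    ring
  have e7 : ∑ μ, eta μ * (-2 * ∑ ρ, eta ρ * (reDot (dG μ μ ρ) (G ν ρ) + reDot (G μ ρ) (dG μ ν ρ))
        + 2 * m ^ 2 * (reDot (dW μ μ) (W ν) + reDot (W μ) (dW μ ν))
        - ∑ ρ, eta ρ * (dF μ μ ρ * F ν ρ + F μ ρ * dF μ ν ρ))
      = ∑ μ, eta μ * (-2 * ∑ ρ, eta ρ * (reDot (dG μ μ ρ) (G ν ρ) + reDot (G μ ρ) (dG μ ν ρ)))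
        + 2 * (m ^ 2 * ∑ μ, eta μ * reDot (dW μ μ) (W ν))
        + 2 * m ^ 2 * ∑ μ, eta μ * reDot (W μ) (dW μ ν)
        + 1 / 2 * ∑ μ, eta μ * (-2 * ∑ ρ, eta ρ * (dF μ μ ρ * F ν ρ + F μ ρ * dF μ ν ρ)) := by
    rw [Finset.mul_sum (s := Finset.univ) (f := fun μ => eta μ * reDot (dW μ μ) (W ν)),
      Finset.mul_sum, Finset.mul_sum, Finset.mul_sum, ← Finset.sum_add_distrib,
      ← Finset.sum_add_distrib, ← Finset.sum_add_distrib]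
    exact Finset.sum_congr rfl fun μ _ => by ring
  rw [e1, e4] at kG
  rw [e2] at kF
  rw [e7]
  linear_combination kG + 1 / 2 * kF + 2 * e5 + 2 * m ^ 2 * e6

variable (e m : ℝ) (Ψ : Spacetime → FieldValue)

/-- The Lagrangian density of a field configuration as a function on space-time. -/
def lagrangianDensity (y : Spacetime) : ℝ :=
  -(1 / 2) * ∑ α, ∑ β, eta α * eta β * reDot (fieldG e Ψ α β y) (fieldG e Ψ α β y)
    + m ^ 2 * ∑ α, eta α * reDot ((Ψ y).1 α) ((Ψ y).1 α)
    - 1 / 4 * ∑ α, ∑ β, eta α * eta β * (fieldF Ψ α β y * fieldF Ψ α β y)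

/-- The stress-energy tensor without the term proportional to the metric. -/
def stressCore (μ ν : Fin 4) (y : Spacetime) : ℝ :=
  -2 * ∑ ρ, eta ρ * reDot (fieldG e Ψ μ ρ y) (fieldG e Ψ ν ρ y)
    + 2 * m ^ 2 * reDot ((Ψ y).1 μ) ((Ψ y).1 ν)
    - ∑ ρ, eta ρ * (fieldF Ψ μ ρ y * fieldF Ψ ν ρ y)

/-- The stress-energy tensor. -/
def stress (μ ν : Fin 4) (y : Spacetime) : ℝ :=
  stressCore e m Ψ μ ν y - (if μ = ν then eta μ else 0) * lagrangianDensity e m Ψ y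

/-- The current whose divergence is the vector-field part of the Lagrangian. -/
def virialCurrent (μ : Fin 4) (y : Spacetime) : ℝ :=
  eta μ * ∑ ν, eta ν * reDot ((Ψ y).1 ν) (fieldG e Ψ μ ν y)

variable {e m Ψ}

theorem contDiff_lagrangianDensity (hΨ : ContDiff ℝ ∞ Ψ) :
    ContDiff ℝ ∞ (lagrangianDensity e m Ψ) :=
  ((contDiff_const.mul (ContDiff.sum fun α _ => ContDiff.sum fun β _ => contDiff_const.mul
    (contDiff_reDot (contDiff_fieldG hΨ α β) (contDiff_fieldG hΨ α β)))).add
    (contDiff_const.mul (ContDiff.sum fun α _ => contDiff_const.mul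
      (contDiff_reDot (contDiff_W hΨ α) (contDiff_W hΨ α))))).sub
    (contDiff_const.mul (ContDiff.sum fun α _ => ContDiff.sum fun β _ => contDiff_const.mul
      ((contDiff_fieldF hΨ α β).mul (contDiff_fieldF hΨ α β))))

theorem contDiff_stressCore (hΨ : ContDiff ℝ ∞ Ψ) (μ ν : Fin 4) :
    ContDiff ℝ ∞ (stressCore e m Ψ μ ν) :=
  ((contDiff_const.mul (ContDiff.sum fun ρ _ => contDiff_const.mul
    (contDiff_reDot (contDiff_fieldG hΨ μ ρ) (contDiff_fieldG hΨ ν ρ)))).add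
    (contDiff_const.mul (contDiff_reDot (contDiff_W hΨ μ) (contDiff_W hΨ ν)))).sub
    (ContDiff.sum fun ρ _ => contDiff_const.mul
      ((contDiff_fieldF hΨ μ ρ).mul (contDiff_fieldF hΨ ν ρ)))

theorem contDiff_stress (hΨ : ContDiff ℝ ∞ Ψ) (μ ν : Fin 4) :
    ContDiff ℝ ∞ (stress e m Ψ μ ν) :=
  (contDiff_stressCore hΨ μ ν).sub (contDiff_const.mul (contDiff_lagrangianDensity hΨ))

theorem contDiff_virialCurrent (hΨ : ContDiff ℝ ∞ Ψ) (μ : Fin 4) :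
    ContDiff ℝ ∞ (virialCurrent e Ψ μ) :=
  contDiff_const.mul (ContDiff.sum fun ν _ => contDiff_const.mul
    (contDiff_reDot (contDiff_W hΨ ν) (contDiff_fieldG hΨ μ ν)))

theorem partialDeriv_sum_const_mul {ι : Type*} (s : Finset ι) (c : ι → ℝ) {f : ι → Spacetime → ℝ}
    (hf : ∀ i, ContDiff ℝ ∞ (f i)) (μ : Fin 4) (x : Spacetime) :
    partialDeriv μ (fun y => ∑ i ∈ s, c i * f i y) x = ∑ i ∈ s, c i * partialDeriv μ (f i) x := by
  rw [partialDeriv_sum s fun i _ => (contDiff_const.mul (hf i)).differentiableAt_infty]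
  exact Finset.sum_congr rfl fun i _ => partialDeriv_const_mul (hf i).differentiableAt_infty _ μ

theorem partialDeriv_stressCore (hΨ : ContDiff ℝ ∞ Ψ) (κ μ ν : Fin 4) (x : Spacetime) :
    partialDeriv κ (stressCore e m Ψ μ ν) x
      = -2 * ∑ ρ, eta ρ *
          (reDot (gaugeDeriv e (fun y => (Ψ y).2) κ (fieldG e Ψ μ ρ) x) (fieldG e Ψ ν ρ x)
          + reDot (fieldG e Ψ μ ρ x) (gaugeDeriv e (fun y => (Ψ y).2) κ (fieldG e Ψ ν ρ) x))
        + 2 * m ^ 2 *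
          (reDot (gaugeDeriv e (fun y => (Ψ y).2) κ (fun y => (Ψ y).1 μ) x) ((Ψ x).1 ν)
          + reDot ((Ψ x).1 μ) (gaugeDeriv e (fun y => (Ψ y).2) κ (fun y => (Ψ y).1 ν) x))
        - ∑ ρ, eta ρ * (partialDeriv κ (fieldF Ψ μ ρ) x * fieldF Ψ ν ρ x
          + fieldF Ψ μ ρ x * partialDeriv κ (fieldF Ψ ν ρ) x) := by
  have cG : ∀ ρ, ContDiff ℝ ∞ fun y => reDot (fieldG e Ψ μ ρ y) (fieldG e Ψ ν ρ y) := fun ρ =>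
    contDiff_reDot (contDiff_fieldG hΨ μ ρ) (contDiff_fieldG hΨ ν ρ)
  have cW : ContDiff ℝ ∞ fun y => reDot ((Ψ y).1 μ) ((Ψ y).1 ν) :=
    contDiff_reDot (contDiff_W hΨ μ) (contDiff_W hΨ ν)
  have cF : ∀ ρ, ContDiff ℝ ∞ fun y => fieldF Ψ μ ρ y * fieldF Ψ ν ρ y := fun ρ =>
    (contDiff_fieldF hΨ μ ρ).mul (contDiff_fieldF hΨ ν ρ)
  have sG : ContDiff ℝ ∞ fun y => ∑ ρ, eta ρ * reDot (fieldG e Ψ μ ρ y) (fieldG e Ψ ν ρ y) :=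
    ContDiff.sum fun ρ _ => contDiff_const.mul (cG ρ)
  have sF : ContDiff ℝ ∞ fun y => ∑ ρ, eta ρ * (fieldF Ψ μ ρ y * fieldF Ψ ν ρ y) :=
    ContDiff.sum fun ρ _ => contDiff_const.mul (cF ρ)
  unfold stressCore
  rw [partialDeriv_sub ((contDiff_const.mul sG).add (contDiff_const.mul cW)).differentiableAt_infty
      sF.differentiableAt_infty,
    partialDeriv_add (contDiff_const.mul sG).differentiableAt_infty
      (contDiff_const.mul cW).differentiableAt_infty,
    partialDeriv_const_mul sG.differentiableAt_infty,
    partialDeriv_const_mul cW.differentiableAt_infty,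
    partialDeriv_sum_const_mul _ _ cG, partialDeriv_sum_const_mul _ _ cF,
    partialDeriv_reDot (contDiff_W hΨ μ) (contDiff_W hΨ ν) e (fun y => (Ψ y).2)]
  simp only [partialDeriv_reDot (contDiff_fieldG hΨ μ _) (contDiff_fieldG hΨ ν _) e
      (fun y => (Ψ y).2),
    partialDeriv_mul (contDiff_fieldF hΨ μ _).differentiableAt_infty
      (contDiff_fieldF hΨ ν _).differentiableAt_infty]

theorem partialDeriv_lagrangianDensity (hΨ : ContDiff ℝ ∞ Ψ) (ν : Fin 4) (x : Spacetime) :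
    partialDeriv ν (lagrangianDensity e m Ψ) x
      = -∑ α, ∑ β, eta α * eta β * reDot (fieldG e Ψ α β x)
          (gaugeDeriv e (fun y => (Ψ y).2) ν (fieldG e Ψ α β) x)
        + 2 * m ^ 2 * ∑ α, eta α * reDot ((Ψ x).1 α)
          (gaugeDeriv e (fun y => (Ψ y).2) ν (fun y => (Ψ y).1 α) x)
        - 1 / 2 * ∑ α, ∑ β, eta α * eta β *
          (fieldF Ψ α β x * partialDeriv ν (fieldF Ψ α β) x) := by
  have cG : ∀ α β, ContDiff ℝ ∞ fun y => reDot (fieldG e Ψ α β y) (fieldG e Ψ α β y) := fun α β =>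
    contDiff_reDot (contDiff_fieldG hΨ α β) (contDiff_fieldG hΨ α β)
  have cW : ∀ α, ContDiff ℝ ∞ fun y => reDot ((Ψ y).1 α) ((Ψ y).1 α) := fun α =>
    contDiff_reDot (contDiff_W hΨ α) (contDiff_W hΨ α)
  have cF : ∀ α β, ContDiff ℝ ∞ fun y => fieldF Ψ α β y * fieldF Ψ α β y := fun α β =>
    (contDiff_fieldF hΨ α β).mul (contDiff_fieldF hΨ α β)
  have sG1 : ∀ α, ContDiff ℝ ∞ fun y =>
      ∑ β, eta α * eta β * reDot (fieldG e Ψ α β y) (fieldG e Ψ α β y) := fun α =>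
    ContDiff.sum fun β _ => contDiff_const.mul (cG α β)
  have sF1 : ∀ α, ContDiff ℝ ∞ fun y =>
      ∑ β, eta α * eta β * (fieldF Ψ α β y * fieldF Ψ α β y) := fun α =>
    ContDiff.sum fun β _ => contDiff_const.mul (cF α β)
  have sG : ContDiff ℝ ∞ fun y => ∑ α, ∑ β, eta α * eta β *
      reDot (fieldG e Ψ α β y) (fieldG e Ψ α β y) := ContDiff.sum fun α _ => sG1 α
  have sF : ContDiff ℝ ∞ fun y => ∑ α, ∑ β, eta α * eta β *
      (fieldF Ψ α β y * fieldF Ψ α β y) := ContDiff.sum fun α _ => sF1 α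
  have sW : ContDiff ℝ ∞ fun y => ∑ α, eta α * reDot ((Ψ y).1 α) ((Ψ y).1 α) :=
    ContDiff.sum fun α _ => contDiff_const.mul (cW α)
  unfold lagrangianDensity
  rw [partialDeriv_sub ((contDiff_const.mul sG).add (contDiff_const.mul sW)).differentiableAt_infty
      (contDiff_const.mul sF).differentiableAt_infty,
    partialDeriv_add (contDiff_const.mul sG).differentiableAt_infty
      (contDiff_const.mul sW).differentiableAt_infty,
    partialDeriv_const_mul sG.differentiableAt_infty,
    partialDeriv_const_mul sW.differentiableAt_infty,
    partialDeriv_const_mul sF.differentiableAt_infty,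
    partialDeriv_sum _ fun α _ => (sG1 α).differentiableAt_infty,
    partialDeriv_sum _ fun α _ => (sF1 α).differentiableAt_infty,
    partialDeriv_sum_const_mul _ _ cW]
  simp only [partialDeriv_sum_const_mul _ _ (cG _), partialDeriv_sum_const_mul _ _ (cF _),
    partialDeriv_reDot (contDiff_fieldG hΨ _ _) (contDiff_fieldG hΨ _ _) e (fun y => (Ψ y).2),
    partialDeriv_reDot (contDiff_W hΨ _) (contDiff_W hΨ _) e (fun y => (Ψ y).2),
    partialDeriv_mul (contDiff_fieldF hΨ _ _).differentiableAt_infty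
      (contDiff_fieldF hΨ _ _).differentiableAt_infty]
  simp only [reDot_comm (gaugeDeriv _ _ _ _ _), mul_comm (partialDeriv _ _ _) (fieldF _ _ _ _),
    ← two_mul, mul_left_comm _ (2 : ℝ), ← Finset.mul_sum]
  ring

/-- Conservation of the stress-energy tensor. -/
theorem FieldEquations.stress_conservation (h : FieldEquations e m Ψ) (hΨ : ContDiff ℝ ∞ Ψ)
    (ν : Fin 4) (x : Spacetime) :
    ∑ μ, eta μ * partialDeriv μ (stress e m Ψ μ ν) x = 0 := by
  have key := stress_conservation_algebra (e := e) (m := m)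
    (G := fun α β => fieldG e Ψ α β x)
    (dG := fun μ α β => gaugeDeriv e (fun y => (Ψ y).2) μ (fieldG e Ψ α β) x)
    (F := fun α β => fieldF Ψ α β x) (dF := fun μ α β => partialDeriv μ (fieldF Ψ α β) x)
    (W := (Ψ x).1) (dW := fun μ α => gaugeDeriv e (fun y => (Ψ y).2) μ (fun y => (Ψ y).1 α) x)
    (fun α β => fieldG_antisymm α β x) (fun μ α β => gaugeDeriv_fieldG_antisymm hΨ μ α β x)
    (fun α β => fieldF_antisymm α β x) (fun μ α β => partialDeriv_fieldF_antisymm hΨ μ α β x)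
    (fun α β => congrFun (fieldG_eq hΨ α β) x)
    (h.vector x) (h.maxwell x) (fun μ ν ρ => fieldG_bianchi hΨ μ ν ρ x)
    (fun μ ν ρ => fieldF_bianchi hΨ μ ν ρ x) (h.divergence hΨ x) ν
  have hs : ∀ μ, partialDeriv μ (stress e m Ψ μ ν) x
      = partialDeriv μ (stressCore e m Ψ μ ν) x
        - (if μ = ν then eta μ else 0) * partialDeriv μ (lagrangianDensity e m Ψ) x := by
    intro μ
    unfold stress
    rw [partialDeriv_sub (contDiff_stressCore hΨ μ ν).differentiableAt_infty
      (contDiff_const.mul (contDiff_lagrangianDensity hΨ)).differentiableAt_infty,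
      partialDeriv_const_mul (contDiff_lagrangianDensity hΨ).differentiableAt_infty]
  have hd : ∑ μ, eta μ * ((if μ = ν then eta μ else 0)
      * partialDeriv μ (lagrangianDensity e m Ψ) x)
      = partialDeriv ν (lagrangianDensity e m Ψ) x := by
    rw [Finset.sum_eq_single ν]
    · rw [if_pos rfl, ← mul_assoc, eta_mul_self, one_mul]
    · intro μ _ hμ; simp [hμ]
    · simp
  simp only [hs, mul_sub, Finset.sum_sub_distrib]
  rw [hd, partialDeriv_lagrangianDensity hΨ]
  simp only [partialDeriv_stressCore hΨ]
  simp only [mul_sub, Finset.sum_sub_distrib] at key ⊢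
  exact key

/-- By the product rule, the term with the divergence of G becomes the mass term through the field
equation, and in the term with D_μ W_ν the antisymmetry of G replaces D_μ W_ν by half of G_μν. -/
theorem FieldEquations.divergence_virialCurrent (h : FieldEquations e m Ψ) (hΨ : ContDiff ℝ ∞ Ψ)
    (x : Spacetime) :
    ∑ μ, partialDeriv μ (virialCurrent e Ψ μ) x
      = 1 / 2 * ∑ α, ∑ β, eta α * eta β * reDot (fieldG e Ψ α β x) (fieldG e Ψ α β x)
        - m ^ 2 * ∑ α, eta α * reDot ((Ψ x).1 α) ((Ψ x).1 α) := by
  have cW : ∀ μ ν, ContDiff ℝ ∞ fun y => reDot ((Ψ y).1 ν) (fieldG e Ψ μ ν y) := fun μ ν =>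
    contDiff_reDot (contDiff_W hΨ ν) (contDiff_fieldG hΨ μ ν)
  have h1 : ∀ μ, partialDeriv μ (virialCurrent e Ψ μ) x
      = ∑ ν, (eta μ * eta ν * reDot (gaugeDeriv e (fun y => (Ψ y).2) μ (fun y => (Ψ y).1 ν) x)
          (fieldG e Ψ μ ν x)
        + eta ν * reDot (eta μ * gaugeDeriv e (fun y => (Ψ y).2) μ (fieldG e Ψ μ ν) x)
          ((Ψ x).1 ν)) := by
    intro μ
    unfold virialCurrent
    rw [partialDeriv_const_mul (ContDiff.sum fun ν _ =>
      contDiff_const.mul (cW μ ν)).differentiableAt_infty,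
      partialDeriv_sum_const_mul _ _ (cW μ), Finset.mul_sum]
    refine Finset.sum_congr rfl fun ν _ => ?_
    rw [partialDeriv_reDot (contDiff_W hΨ ν) (contDiff_fieldG hΨ μ ν) e (fun y => (Ψ y).2)]
    simp only [reDot, Complex.re_ofReal_mul, Complex.im_ofReal_mul]
    ring
  simp only [h1, Finset.sum_add_distrib]
  have h2 : ∑ μ, ∑ ν, eta ν * reDot (eta μ * gaugeDeriv e (fun y => (Ψ y).2) μ
      (fieldG e Ψ μ ν) x) ((Ψ x).1 ν) = -(m ^ 2 * ∑ α, eta α * reDot ((Ψ x).1 α) ((Ψ x).1 α)) := by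
    rw [Finset.sum_comm, Finset.mul_sum, ← Finset.sum_neg_distrib]
    refine Finset.sum_congr rfl fun ν _ => ?_
    rw [← Finset.mul_sum, ← reDot_sum_left,
      show ∑ μ, (eta μ : ℂ) * gaugeDeriv e (fun y => (Ψ y).2) μ (fieldG e Ψ μ ν) x
        = ((-(m ^ 2) : ℝ) : ℂ) * (Ψ x).1 ν by push_cast; linear_combination h.vector x ν]
    simp only [reDot, Complex.re_ofReal_mul, Complex.im_ofReal_mul]
    ring
  have h3 : ∑ μ, ∑ ν, eta μ * eta ν * reDot (gaugeDeriv e (fun y => (Ψ y).2) μ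
      (fun y => (Ψ y).1 ν) x) (fieldG e Ψ μ ν x)
      = -∑ μ, ∑ ν, eta μ * eta ν * reDot (gaugeDeriv e (fun y => (Ψ y).2) ν
      (fun y => (Ψ y).1 μ) x) (fieldG e Ψ μ ν x) := by
    rw [Finset.sum_comm, ← Finset.sum_neg_distrib]
    refine Finset.sum_congr rfl fun μ _ => ?_
    rw [← Finset.sum_neg_distrib]
    refine Finset.sum_congr rfl fun ν _ => ?_
    rw [fieldG_antisymm ν μ]
    simp only [reDot, Complex.neg_re, Complex.neg_im]
    ring
  have h4 : ∑ α, ∑ β, eta α * eta β * reDot (fieldG e Ψ α β x) (fieldG e Ψ α β x)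
      = ∑ μ, ∑ ν, eta μ * eta ν * reDot (gaugeDeriv e (fun y => (Ψ y).2) μ
          (fun y => (Ψ y).1 ν) x) (fieldG e Ψ μ ν x)
        - ∑ μ, ∑ ν, eta μ * eta ν * reDot (gaugeDeriv e (fun y => (Ψ y).2) ν
          (fun y => (Ψ y).1 μ) x) (fieldG e Ψ μ ν x) := by
    simp only [← Finset.sum_sub_distrib]
    refine Finset.sum_congr rfl fun μ _ => Finset.sum_congr rfl fun ν _ => ?_
    have : fieldG e Ψ μ ν x = gaugeDeriv e (fun y => (Ψ y).2) μ (fun y => (Ψ y).1 ν) x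
      - gaugeDeriv e (fun y => (Ψ y).2) ν (fun y => (Ψ y).1 μ) x := congrFun (fieldG_eq hΨ μ ν) x
    rw [this]
    simp only [reDot, Complex.sub_re, Complex.sub_im]
    ring
  rw [h2]
  linear_combination -1 / 2 * h4 + 1 / 2 * h3

end Currents

/-! ### The currents in terms of the six densities, and pointwise bounds. -/

section Densities

variable {e m : ℝ} {Ψ : Spacetime → FieldValue}

/-- The densities of the six integrals as functions on space-time. -/
def fieldDensity (e m : ℝ) (Ψ : Spacetime → FieldValue) (k : Fin 6) (y : Spacetime) : ℝ :=
  density e m (Ψ y) (grad Ψ y) k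

/-- The sum of the squares of all components of the fields and field strengths. -/
def energyBound (e m : ℝ) (Ψ : Spacetime → FieldValue) (y : Spacetime) : ℝ :=
  ∑ α, ∑ β, ‖fieldG e Ψ α β y‖ ^ 2 + m ^ 2 * ∑ α, ‖(Ψ y).1 α‖ ^ 2 + ∑ α, ∑ β, fieldF Ψ α β y ^ 2

theorem fieldG_self (μ : Fin 4) (y : Spacetime) : fieldG e Ψ μ μ y = 0 := by
  simp [fieldG, strengthW]

theorem fieldF_self (μ : Fin 4) (y : Spacetime) : fieldF Ψ μ μ y = 0 := by
  simp [fieldF, strengthF]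

theorem fieldDensity_zero (y : Spacetime) : fieldDensity e m Ψ 0 y
    = ∑ i : Fin 3, ‖fieldG e Ψ 0 i.succ y‖ ^ 2 := rfl

theorem fieldDensity_one (y : Spacetime) : fieldDensity e m Ψ 1 y
    = ∑ i : Fin 3, ∑ j : Fin 3, (1 / 2) * ‖fieldG e Ψ i.succ j.succ y‖ ^ 2 := rfl

theorem fieldDensity_two (y : Spacetime) : fieldDensity e m Ψ 2 y
    = m ^ 2 * ‖(Ψ y).1 0‖ ^ 2 := rfl

theorem fieldDensity_three (y : Spacetime) : fieldDensity e m Ψ 3 y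
    = m ^ 2 * ∑ i : Fin 3, ‖(Ψ y).1 i.succ‖ ^ 2 := rfl

theorem fieldDensity_four (y : Spacetime) : fieldDensity e m Ψ 4 y
    = ∑ i : Fin 3, (1 / 2) * fieldF Ψ 0 i.succ y ^ 2 := rfl

theorem fieldDensity_five (y : Spacetime) : fieldDensity e m Ψ 5 y
    = ∑ i : Fin 3, ∑ j : Fin 3, (1 / 4) * fieldF Ψ i.succ j.succ y ^ 2 := rfl

theorem fieldDensity_nonneg (k : Fin 6) (y : Spacetime) : 0 ≤ fieldDensity e m Ψ k y := by
  fin_cases k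
  · exact (fieldDensity_zero (e := e) (m := m) y).symm ▸ by positivity
  · exact (fieldDensity_one (e := e) (m := m) y).symm ▸ by positivity
  · exact (fieldDensity_two (e := e) (m := m) y).symm ▸ by positivity
  · exact (fieldDensity_three (e := e) (m := m) y).symm ▸ by positivity
  · exact (fieldDensity_four (e := e) (m := m) y).symm ▸ by positivity
  · exact (fieldDensity_five (e := e) (m := m) y).symm ▸ by positivity

theorem contDiff_norm_sq {f : Spacetime → ℂ} (hf : ContDiff ℝ ∞ f) :
    ContDiff ℝ ∞ fun y => ‖f y‖ ^ 2 := by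
  simp only [← reDot_self]
  exact contDiff_reDot hf hf

theorem continuous_fieldDensity (hΨ : ContDiff ℝ ∞ Ψ) (k : Fin 6) :
    Continuous (fieldDensity e m Ψ k) := by
  refine ContDiff.continuous (𝕜 := ℝ) (n := ∞) ?_
  fin_cases k
  · exact (ContDiff.sum fun i _ => contDiff_norm_sq (contDiff_fieldG hΨ 0 i.succ) :
      ContDiff ℝ ∞ fun y => ∑ i : Fin 3, ‖fieldG e Ψ 0 i.succ y‖ ^ 2)
  · exact (ContDiff.sum fun i _ => ContDiff.sum fun j _ =>
      contDiff_const.mul (contDiff_norm_sq (contDiff_fieldG hΨ i.succ j.succ)) :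
      ContDiff ℝ ∞ fun y => ∑ i : Fin 3, ∑ j : Fin 3, (1 / 2) * ‖fieldG e Ψ i.succ j.succ y‖ ^ 2)
  · exact contDiff_const.mul (contDiff_norm_sq (contDiff_W hΨ _))
  · exact contDiff_const.mul (ContDiff.sum fun i _ => contDiff_norm_sq (contDiff_W hΨ _))
  · exact (ContDiff.sum fun i _ => contDiff_const.mul ((contDiff_fieldF hΨ 0 i.succ).pow 2) :
      ContDiff ℝ ∞ fun y => ∑ i : Fin 3, (1 / 2) * fieldF Ψ 0 i.succ y ^ 2)
  · exact (ContDiff.sum fun i _ => ContDiff.sum fun j _ =>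
      contDiff_const.mul ((contDiff_fieldF hΨ i.succ j.succ).pow 2) :
      ContDiff ℝ ∞ fun y => ∑ i : Fin 3, ∑ j : Fin 3, (1 / 4) * fieldF Ψ i.succ j.succ y ^ 2)

/-- This makes `energyBound` integrable over a period; it serves as the majorant for all currents.
The factors account for the ordered pairs (0, i), (i, 0) and for the weights 1/2 and 1/4 in the
densities. -/
theorem energyBound_eq (y : Spacetime) : energyBound e m Ψ y
    = 2 * fieldDensity e m Ψ 0 y + 2 * fieldDensity e m Ψ 1 y + fieldDensity e m Ψ 2 y
      + fieldDensity e m Ψ 3 y + 4 * fieldDensity e m Ψ 4 y + 4 * fieldDensity e m Ψ 5 y := by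
  rw [fieldDensity_zero, fieldDensity_one, fieldDensity_two, fieldDensity_three,
    fieldDensity_four, fieldDensity_five, energyBound]
  simp only [Fin.sum_univ_succ (n := 3), fieldG_self, fieldF_self, norm_zero]
  have hG : ∀ i : Fin 3, ‖fieldG e Ψ i.succ 0 y‖ = ‖fieldG e Ψ 0 i.succ y‖ := fun i => by
    rw [fieldG_antisymm, norm_neg]
  have hF : ∀ i : Fin 3, fieldF Ψ i.succ 0 y ^ 2 = fieldF Ψ 0 i.succ y ^ 2 := fun i => by
    rw [fieldF_antisymm, neg_sq]
  simp only [hG, hF, Finset.sum_add_distrib, ← Finset.mul_sum]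
  ring

theorem divergence_virialCurrent_eq_density (h : FieldEquations e m Ψ) (hΨ : ContDiff ℝ ∞ Ψ)
    (y : Spacetime) :
    ∑ μ, partialDeriv μ (virialCurrent e Ψ μ) y
      = -fieldDensity e m Ψ 0 y + fieldDensity e m Ψ 1 y - fieldDensity e m Ψ 2 y
        + fieldDensity e m Ψ 3 y := by
  rw [h.divergence_virialCurrent hΨ, fieldDensity_zero, fieldDensity_one, fieldDensity_two,
    fieldDensity_three]
  simp only [reDot_self, Fin.sum_univ_succ (n := 3), fieldG_self, norm_zero]
  have hG : ∀ i : Fin 3, ‖fieldG e Ψ i.succ 0 y‖ = ‖fieldG e Ψ 0 i.succ y‖ := fun i => by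
    rw [fieldG_antisymm, norm_neg]
  simp only [hG]
  simp [eta, Fin.sum_univ_three]
  ring

/-- Densities 0 and 3 occur here with the signs opposite to those in
`divergence_virialCurrent_eq_density`. Adding the two leaves only nonnegative terms. -/
theorem stress_trace (y : Spacetime) :
    ∑ k : Fin 3, stress e m Ψ k.succ k.succ y
      = fieldDensity e m Ψ 0 y + fieldDensity e m Ψ 1 y + 3 * fieldDensity e m Ψ 2 y
        - fieldDensity e m Ψ 3 y + fieldDensity e m Ψ 4 y + fieldDensity e m Ψ 5 y := by
  rw [fieldDensity_zero, fieldDensity_one, fieldDensity_two, fieldDensity_three,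
    fieldDensity_four, fieldDensity_five]
  simp only [stress, stressCore, lagrangianDensity, reDot_self, ← sq, Fin.sum_univ_succ (n := 3),
    fieldG_self, fieldF_self, norm_zero]
  have hG : ∀ i : Fin 3, ‖fieldG e Ψ i.succ 0 y‖ = ‖fieldG e Ψ 0 i.succ y‖ := fun i => by
    rw [fieldG_antisymm, norm_neg]
  have hF : ∀ i : Fin 3, fieldF Ψ i.succ 0 y ^ 2 = fieldF Ψ 0 i.succ y ^ 2 := fun i => by
    rw [fieldF_antisymm, neg_sq]
  simp only [hG, hF]
  simp [eta, Fin.sum_univ_three]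
  ring

theorem norm_sq_fieldG_row_le (μ : Fin 4) (y : Spacetime) :
    ∑ ρ, ‖fieldG e Ψ μ ρ y‖ ^ 2 ≤ ∑ α, ∑ β, ‖fieldG e Ψ α β y‖ ^ 2 :=
  Finset.single_le_sum (f := fun α => ∑ β, ‖fieldG e Ψ α β y‖ ^ 2)
    (fun _ _ => by positivity) (Finset.mem_univ μ)

theorem abs_eta (μ : Fin 4) : |eta μ| = 1 := by
  fin_cases μ <;> simp [eta]

theorem abs_sum_eta_le (a : Fin 4 → ℝ) : |∑ ρ, eta ρ * a ρ| ≤ ∑ ρ, |a ρ| := by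
  refine (Finset.abs_sum_le_sum_abs _ _).trans (Finset.sum_le_sum fun ρ _ => ?_)
  rw [abs_mul, abs_eta, one_mul]

/-- The energy controls W only through m²‖W‖²; this is the source of the factor `(m ^ 2)⁻¹`. -/
theorem abs_virialCurrent_le (hm : m ≠ 0) (μ : Fin 4) (y : Spacetime) :
    |virialCurrent e Ψ μ y| ≤ (1 + (m ^ 2)⁻¹) * energyBound e m Ψ y := by
  have h1 : |virialCurrent e Ψ μ y| ≤ ∑ ν, (‖(Ψ y).1 ν‖ ^ 2 + ‖fieldG e Ψ μ ν y‖ ^ 2) := by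
    rw [virialCurrent, abs_mul, abs_eta, one_mul]
    exact (abs_sum_eta_le _).trans (Finset.sum_le_sum fun ν _ => abs_reDot_le _ _)
  rw [Finset.sum_add_distrib] at h1
  have h2 := norm_sq_fieldG_row_le (e := e) (Ψ := Ψ) μ y
  set a := ∑ α, ∑ β, ‖fieldG e Ψ α β y‖ ^ 2 with ha
  set b := ∑ ν, ‖(Ψ y).1 ν‖ ^ 2 with hb
  set c := ∑ α, ∑ β, fieldF Ψ α β y ^ 2 with hc
  have ha0 : 0 ≤ a := by positivity
  have hb0 : 0 ≤ b := by positivity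
  have hc0 : 0 ≤ c := by positivity
  have hE : energyBound e m Ψ y = a + m ^ 2 * b + c := rfl
  clear_value a b c
  have h3 : (1 + (m ^ 2)⁻¹) * energyBound e m Ψ y
      = a + m ^ 2 * b + c + ((m ^ 2)⁻¹ * (a + c) + b) := by
    rw [hE]
    field_simp
    ring
  rw [h3]
  have h4 : 0 ≤ m ^ 2 * b := by positivity
  have h5 : 0 ≤ (m ^ 2)⁻¹ * (a + c) := by positivity
  linarith

theorem abs_sum_sum_eta_le (a : Fin 4 → Fin 4 → ℝ) :
    |∑ α, ∑ β, eta α * eta β * a α β| ≤ ∑ α, ∑ β, |a α β| := by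
  refine (Finset.abs_sum_le_sum_abs _ _).trans (Finset.sum_le_sum fun α _ => ?_)
  refine (Finset.abs_sum_le_sum_abs _ _).trans (Finset.sum_le_sum fun β _ => ?_)
  rw [abs_mul, abs_mul, abs_eta, abs_eta, one_mul, one_mul]

theorem abs_stress_le (μ ν : Fin 4) (y : Spacetime) :
    |stress e m Ψ μ ν y| ≤ 10 * energyBound e m Ψ y := by
  set a := ∑ α, ∑ β, ‖fieldG e Ψ α β y‖ ^ 2 with ha
  set b := ∑ ν, ‖(Ψ y).1 ν‖ ^ 2 with hb
  set c := ∑ α, ∑ β, fieldF Ψ α β y ^ 2 with hc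
  have ha0 : 0 ≤ a := by positivity
  have hb0 : 0 ≤ m ^ 2 * b := by positivity
  have hc0 : 0 ≤ c := by positivity
  have h1 : |∑ ρ, eta ρ * reDot (fieldG e Ψ μ ρ y) (fieldG e Ψ ν ρ y)| ≤ 2 * a := by
    refine (abs_sum_eta_le _).trans
      ((Finset.sum_le_sum fun ρ _ => abs_reDot_le _ _).trans ?_)
    rw [Finset.sum_add_distrib]
    linarith [norm_sq_fieldG_row_le (e := e) (Ψ := Ψ) μ y,
      norm_sq_fieldG_row_le (e := e) (Ψ := Ψ) ν y]
  have hW : ∀ α, ‖(Ψ y).1 α‖ ^ 2 ≤ b := fun α =>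
    Finset.single_le_sum (f := fun α => ‖(Ψ y).1 α‖ ^ 2) (fun _ _ => by positivity)
      (Finset.mem_univ α)
  have h2 : |m ^ 2 * reDot ((Ψ y).1 μ) ((Ψ y).1 ν)| ≤ 2 * (m ^ 2 * b) := by
    rw [abs_mul, abs_of_nonneg (sq_nonneg m)]
    have := (abs_reDot_le ((Ψ y).1 μ) ((Ψ y).1 ν)).trans (add_le_add (hW μ) (hW ν))
    nlinarith [sq_nonneg m]
  have hrow : ∀ α, ∑ ρ, fieldF Ψ α ρ y ^ 2 ≤ c := fun α =>
    Finset.single_le_sum (f := fun α => ∑ ρ, fieldF Ψ α ρ y ^ 2) (fun _ _ => by positivity)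
      (Finset.mem_univ α)
  have h3 : |∑ ρ, eta ρ * (fieldF Ψ μ ρ y * fieldF Ψ ν ρ y)| ≤ 2 * c := by
    refine (abs_sum_eta_le _).trans ((Finset.sum_le_sum (g := fun ρ =>
      fieldF Ψ μ ρ y ^ 2 + fieldF Ψ ν ρ y ^ 2) fun ρ _ => ?_).trans ?_)
    · rw [abs_le]
      constructor <;> nlinarith [sq_nonneg (fieldF Ψ μ ρ y + fieldF Ψ ν ρ y),
        sq_nonneg (fieldF Ψ μ ρ y - fieldF Ψ ν ρ y)]
    · rw [Finset.sum_add_distrib]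
      linarith [hrow μ, hrow ν]
  have h4 : |∑ α, ∑ β, eta α * eta β * reDot (fieldG e Ψ α β y) (fieldG e Ψ α β y)| ≤ a := by
    refine (abs_sum_sum_eta_le _).trans (le_of_eq ?_)
    simp [reDot_self, ha]
  have h5 : |m ^ 2 * ∑ α, eta α * reDot ((Ψ y).1 α) ((Ψ y).1 α)| ≤ m ^ 2 * b := by
    rw [abs_mul, abs_of_nonneg (sq_nonneg m)]
    refine mul_le_mul_of_nonneg_left ((abs_sum_eta_le _).trans (le_of_eq ?_)) (sq_nonneg m)
    simp [reDot_self, hb]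
  have h6 : |∑ α, ∑ β, eta α * eta β * (fieldF Ψ α β y * fieldF Ψ α β y)| ≤ c := by
    refine (abs_sum_sum_eta_le _).trans (le_of_eq ?_)
    simp [← sq, hc]
  have hE : energyBound e m Ψ y = a + m ^ 2 * b + c := rfl
  clear_value a b c
  have hL : |lagrangianDensity e m Ψ y| ≤ a + m ^ 2 * b + c := by
    rw [lagrangianDensity]
    rw [abs_le] at h4 h5 h6 ⊢
    constructor <;> linarith
  have hC : |(if μ = ν then eta μ else 0) * lagrangianDensity e m Ψ y| ≤ a + m ^ 2 * b + c := by
    split_ifs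
    · rwa [abs_mul, abs_eta, one_mul]
    · simp; positivity
  rw [hE, stress, stressCore]
  rw [abs_le] at h1 h2 h3 hC ⊢
  constructor <;> linarith

end Densities

/-! ### The dilation current and its nonnegative divergence. -/

section Dilation

variable {e m : ℝ} {Ψ : Spacetime → FieldValue}

theorem contDiff_coord (ν : Fin 4) : ContDiff ℝ ∞ fun y : Spacetime => y ν :=
  contDiff_apply ℝ ℝ ν

/-- Contraction of a family of tensor components with the spatial position vector. -/
def contractPosition (S : Fin 3 → Spacetime → ℝ) (y : Spacetime) : ℝ :=
  ∑ k : Fin 3, y k.succ * S k y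

theorem contDiff_contractPosition {S : Fin 3 → Spacetime → ℝ} (hS : ∀ k, ContDiff ℝ ∞ (S k)) :
    ContDiff ℝ ∞ (contractPosition S) :=
  ContDiff.sum fun k _ => (contDiff_coord k.succ).mul (hS k)

theorem partialDeriv_contractPosition {S : Fin 3 → Spacetime → ℝ} (hS : ∀ k, ContDiff ℝ ∞ (S k))
    (μ : Fin 4) (y : Spacetime) :
    partialDeriv μ (contractPosition S) y
      = ∑ k : Fin 3, ((if μ = k.succ then 1 else 0) * S k y
        + y k.succ * partialDeriv μ (S k) y) := by
  unfold contractPosition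
  rw [partialDeriv_sum _ fun k _ => ((contDiff_coord _).mul (hS k)).differentiableAt_infty]
  refine Finset.sum_congr rfl fun k _ => ?_
  rw [partialDeriv_mul (contDiff_coord _).differentiableAt_infty (hS k).differentiableAt_infty,
    partialDeriv_coord]

theorem abs_contractPosition_le {S : Fin 3 → Spacetime → ℝ} {y : Spacetime} {b : ℝ}
    (hb : ∀ k, |S k y| ≤ b) : |contractPosition S y| ≤ (∑ k : Fin 3, |y k.succ|) * b := by
  rw [Finset.sum_mul]
  refine (Finset.abs_sum_le_sum_abs _ _).trans (Finset.sum_le_sum fun k _ => ?_)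
  rw [abs_mul]
  exact mul_le_mul_of_nonneg_left (hb k) (abs_nonneg _)

/-- The divergence of the contraction with the position vector of a conserved tensor is its
spatial trace. -/
theorem divergence_contractPosition {S : Fin 4 → Fin 3 → Spacetime → ℝ}
    (hS : ∀ μ k, ContDiff ℝ ∞ (S μ k)) {y : Spacetime}
    (hcons : ∀ k, ∑ μ, partialDeriv μ (S μ k) y = 0) :
    ∑ μ, partialDeriv μ (contractPosition (S μ)) y = ∑ k : Fin 3, S k.succ k y := by
  simp only [partialDeriv_contractPosition (hS _)]
  rw [Finset.sum_comm]
  refine Finset.sum_congr rfl fun k _ => ?_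
  rw [Finset.sum_add_distrib, ← Finset.mul_sum, hcons, mul_zero, add_zero,
    Finset.sum_eq_single k.succ]
  · simp
  · intro μ _ hμ; simp [hμ]
  · simp

/-- The current `η_μ (W̄^ν G_μν - x^k T_μk)`. -/
def dilationCurrent (e m : ℝ) (Ψ : Spacetime → FieldValue) (μ : Fin 4) (y : Spacetime) : ℝ :=
  virialCurrent e Ψ μ y - contractPosition (fun k y => eta μ * stress e m Ψ μ k.succ y) y

theorem contDiff_dilationCurrent (hΨ : ContDiff ℝ ∞ Ψ) (μ : Fin 4) :
    ContDiff ℝ ∞ (dilationCurrent e m Ψ μ) :=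
  (contDiff_virialCurrent hΨ μ).sub
    (contDiff_contractPosition fun k => contDiff_const.mul (contDiff_stress hΨ μ k.succ))

theorem divergence_dilationCurrent (h : FieldEquations e m Ψ) (hΨ : ContDiff ℝ ∞ Ψ)
    (y : Spacetime) :
    ∑ μ, partialDeriv μ (dilationCurrent e m Ψ μ) y
      = 2 * fieldDensity e m Ψ 1 y + 2 * fieldDensity e m Ψ 2 y + fieldDensity e m Ψ 4 y
        + fieldDensity e m Ψ 5 y := by
  have hS : ∀ (μ : Fin 4) (k : Fin 3), ContDiff ℝ ∞ fun y => eta μ * stress e m Ψ μ k.succ y :=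
    fun μ k => contDiff_const.mul (contDiff_stress hΨ μ k.succ)
  have h1 : ∀ μ, partialDeriv μ (dilationCurrent e m Ψ μ) y
      = partialDeriv μ (virialCurrent e Ψ μ) y
        - partialDeriv μ (contractPosition fun k y => eta μ * stress e m Ψ μ k.succ y) y := fun μ =>
    partialDeriv_sub (contDiff_virialCurrent hΨ μ).differentiableAt_infty
      (contDiff_contractPosition (hS μ)).differentiableAt_infty μ
  have h2 := divergence_contractPosition hS (y := y) fun k => by
    simp only [partialDeriv_const_mul (contDiff_stress hΨ _ _).differentiableAt_infty]
    exact h.stress_conservation hΨ k.succ y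
  -- Raising the first index of the stress tensor flips the sign of its spatial trace, so the minus
  -- sign in `dilationCurrent` makes the trace enter positively.
  have h3 : ∑ k : Fin 3, eta k.succ * stress e m Ψ k.succ k.succ y
      = -∑ k : Fin 3, stress e m Ψ k.succ k.succ y := by
    simp [eta, Fin.sum_univ_three]; ring
  simp only [h1, Finset.sum_sub_distrib]
  rw [h2, h3, stress_trace, divergence_virialCurrent_eq_density h hΨ]
  ring

theorem energyBound_nonneg (y : Spacetime) : 0 ≤ energyBound e m Ψ y := by
  unfold energyBound; positivity

theorem abs_dilationCurrent_le (hm : m ≠ 0) (μ : Fin 4) (y : Spacetime) :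
    |dilationCurrent e m Ψ μ y|
      ≤ (1 + ∑ k : Fin 3, |y k.succ|) * ((11 + (m ^ 2)⁻¹) * energyBound e m Ψ y) := by
  have h1 := abs_virialCurrent_le (e := e) (Ψ := Ψ) hm μ y
  have h2 := abs_contractPosition_le (S := fun k y => eta μ * stress e m Ψ μ k.succ y) (y := y)
    (b := 10 * energyBound e m Ψ y) fun k => by
      rw [abs_mul, abs_eta, one_mul]; exact abs_stress_le μ k.succ y
  have h3 : 0 ≤ ∑ k : Fin 3, |y k.succ| := by positivity
  have h4 := energyBound_nonneg (e := e) (m := m) (Ψ := Ψ) y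
  have h5 : 0 ≤ (m ^ 2)⁻¹ := by positivity
  refine (abs_sub _ _).trans ((add_le_add h1 h2).trans ?_)
  nlinarith [mul_nonneg h3 h4, mul_nonneg (mul_nonneg h3 h4) h5]

end Dilation

/-! ### Rotations of space-time and invariance of the charge density of the dilation current. -/

section Rotation

/-- The action of a rotation on space-time. -/
def rotationMatrix (Ω : Matrix.specialOrthogonalGroup (Fin 3) ℝ) : Matrix (Fin 4) (Fin 4) ℝ :=
  Matrix.of (Matrix.vecCons (Matrix.vecCons 1 0) fun i => Matrix.vecCons 0 (Ω.1 i))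

variable {e m : ℝ} {Ψ Φ : Spacetime → FieldValue} (Ω : Matrix.specialOrthogonalGroup (Fin 3) ℝ)

@[simp] theorem rotationMatrix_zero_zero : rotationMatrix Ω 0 0 = 1 := rfl

@[simp] theorem rotationMatrix_zero_succ (j : Fin 3) : rotationMatrix Ω 0 j.succ = 0 := rfl

@[simp] theorem rotationMatrix_succ_zero (i : Fin 3) : rotationMatrix Ω i.succ 0 = 0 := rfl

@[simp] theorem rotationMatrix_succ_succ (i j : Fin 3) :
    rotationMatrix Ω i.succ j.succ = Ω.1 i j := rfl

theorem rotation_mul_transpose : Ω.1 * Ω.1.transpose = 1 := by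
  have := (Matrix.mem_orthogonalGroup_iff (Fin 3) ℝ).1
    (Matrix.mem_specialOrthogonalGroup_iff.1 Ω.2).1
  simpa [Matrix.star_eq_conjTranspose] using this

theorem rotation_row (i j : Fin 3) : ∑ k, Ω.1 i k * Ω.1 j k = if i = j then 1 else 0 := by
  have := congrFun (congrFun (rotation_mul_transpose Ω) i) j
  rw [Matrix.mul_apply, Matrix.one_apply] at this
  simpa using this

theorem rotationMatrix_mulVec (y : Spacetime) :
    (rotationMatrix Ω).mulVec y = event (y 0) (Ω.1.mulVec fun j => y j.succ) := by
  ext μ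
  refine Fin.cases ?_ (fun i => ?_) μ
  · simp [Matrix.mulVec, dotProduct, Fin.sum_univ_succ (n := 3), event]
  · simp [Matrix.mulVec, dotProduct, Fin.sum_univ_succ (n := 3), event]

theorem event_add (s t : ℝ) (x z : Fin 3 → ℝ) : event s x + event t z = event (s + t) (x + z) := by
  ext μ
  refine Fin.cases ?_ (fun i => ?_) μ <;> simp [event]

theorem rotationMatrix_mulVec_event (t T : ℝ) (x : Fin 3 → ℝ) :
    (rotationMatrix Ω).mulVec (event t x) + event T 0 = event (t + T) (Ω.1.mulVec x) := by
  rw [rotationMatrix_mulVec, event_add, add_zero]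
  rfl

theorem isLorentz_rotationMatrix : IsLorentz (rotationMatrix Ω) := by
  unfold IsLorentz
  ext μ ν
  rw [Matrix.mul_apply]
  simp only [Matrix.mul_diagonal, Matrix.transpose_apply, Fin.sum_univ_succ (n := 3)]
  have heta : ∀ i : Fin 3, eta i.succ = -1 := fun i => by fin_cases i <;> simp [eta]
  refine Fin.cases ?_ (fun i => ?_) μ <;> refine Fin.cases ?_ (fun j => ?_) ν
  · simp [eta]
  · simp [(Fin.succ_ne_zero _).symm]
  · simp
  · have := rotation_row Ω i j
    simp only [rotationMatrix_succ_zero, rotationMatrix_succ_succ, heta]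
    simp only [mul_zero, zero_add, mul_neg, mul_one, neg_mul, Finset.sum_neg_distrib, this,
      Matrix.diagonal_apply, Fin.succ_inj, heta]
    split_ifs <;> simp

theorem rotationMatrix_mul_transpose :
    rotationMatrix Ω * (rotationMatrix Ω).transpose = 1 := by
  ext μ ν
  rw [Matrix.mul_apply]
  simp only [Matrix.transpose_apply, Fin.sum_univ_succ (n := 3)]
  refine Fin.cases ?_ (fun i => ?_) μ <;> refine Fin.cases ?_ (fun j => ?_) ν
  · simp
  · simp [(Fin.succ_ne_zero _).symm]
  · simp
  · have := rotation_row Ω i j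
    simp [Matrix.one_apply, this]

/-- The summed index is handled by Lorentz invariance of η; the free indices carry `M`. The part
without the metric is enough, since only the components (0, k) of the stress tensor are compared
later and the metric term vanishes there. -/
theorem IsFrameChange.stressCore {M : Matrix (Fin 4) (Fin 4) ℝ} {c : Spacetime}
    (h : IsFrameChange M c Ψ Φ) (hM : IsLorentz M) (hΨ : ContDiff ℝ ∞ Ψ) (μ ν : Fin 4)
    (y : Spacetime) :
    ChargedVector.stressCore e m Φ μ ν y
      = ∑ α, ∑ β, M α μ * M β ν * ChargedVector.stressCore e m Ψ α β (M.mulVec y + c) := by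
  set z := M.mulVec y + c
  have eG : ∀ μ σ, fieldG e Φ μ σ y
      = ∑ β, (M β σ : ℂ) * ∑ α, (M α μ : ℂ) * fieldG e Ψ α β z := by
    intro μ σ
    rw [h.fieldG_eq hΨ]
    beta_reduce
    rw [Finset.sum_comm]
    simp only [Finset.mul_sum]
    exact Finset.sum_congr rfl fun β _ => Finset.sum_congr rfl fun α _ => by push_cast; ring
  have eF : ∀ μ σ, fieldF Φ μ σ y = ∑ β, M β σ * ∑ α, M α μ * fieldF Ψ α β z := by
    intro μ σ
    rw [h.fieldF_eq hΨ]
    beta_reduce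
    rw [Finset.sum_comm]
    simp only [Finset.mul_sum]
    exact Finset.sum_congr rfl fun β _ => Finset.sum_congr rfl fun α _ => by ring
  have h1 : ∑ ρ, eta ρ * reDot (fieldG e Φ μ ρ y) (fieldG e Φ ν ρ y)
      = ∑ α, ∑ β, M α μ * M β ν * ∑ ρ, eta ρ * reDot (fieldG e Ψ α ρ z) (fieldG e Ψ β ρ z) := by
    simp only [eG]
    rw [hM.contract_reDot]
    simp only [reDot, Complex.re_sum, Complex.im_sum, Complex.re_ofReal_mul,
      Complex.im_ofReal_mul, Finset.sum_mul_sum, ← Finset.sum_add_distrib]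
    simp only [Finset.mul_sum]
    rw [Finset.sum_comm]
    refine Finset.sum_congr rfl fun α _ => ?_
    rw [Finset.sum_comm]
    exact Finset.sum_congr rfl fun β _ => Finset.sum_congr rfl fun ρ _ => by ring
  have h2 : ∑ ρ, eta ρ * (fieldF Φ μ ρ y * fieldF Φ ν ρ y)
      = ∑ α, ∑ β, M α μ * M β ν * ∑ ρ, eta ρ * (fieldF Ψ α ρ z * fieldF Ψ β ρ z) := by
    simp only [eF]
    rw [hM.contract_mul]
    simp only [Finset.sum_mul_sum]
    simp only [Finset.mul_sum]
    rw [Finset.sum_comm]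
    refine Finset.sum_congr rfl fun α _ => ?_
    rw [Finset.sum_comm]
    exact Finset.sum_congr rfl fun β _ => Finset.sum_congr rfl fun ρ _ => by ring
  have h3 : reDot ((Φ y).1 μ) ((Φ y).1 ν)
      = ∑ α, ∑ β, M α μ * M β ν * reDot ((Ψ z).1 α) ((Ψ z).1 β) := by
    simp only [h.vector, reDot, Complex.re_sum, Complex.im_sum, Complex.re_ofReal_mul,
      Complex.im_ofReal_mul, Finset.sum_mul_sum, ← Finset.sum_add_distrib]
    exact Finset.sum_congr rfl fun α _ => Finset.sum_congr rfl fun β _ => by ring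
  rw [ChargedVector.stressCore, h1, h2, h3]
  have lin : ∀ (r s : ℝ) (w f g k : Fin 4 → Fin 4 → ℝ),
      r * ∑ α, ∑ β, w α β * f α β + s * ∑ α, ∑ β, w α β * g α β - ∑ α, ∑ β, w α β * k α β
        = ∑ α, ∑ β, w α β * (r * f α β + s * g α β - k α β) := by
    intro r s w f g k
    simp only [Finset.mul_sum, ← Finset.sum_add_distrib, ← Finset.sum_sub_distrib]
    exact Finset.sum_congr rfl fun α _ => Finset.sum_congr rfl fun β _ => by ring
  exact lin (-2) (2 * m ^ 2) (fun α β => M α μ * M β ν)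
    (fun α β => ∑ ρ, eta ρ * reDot (fieldG e Ψ α ρ z) (fieldG e Ψ β ρ z))
    (fun α β => reDot ((Ψ z).1 α) ((Ψ z).1 β))
    (fun α β => ∑ ρ, eta ρ * (fieldF Ψ α ρ z * fieldF Ψ β ρ z))

theorem IsFrameChange.virialCurrent_zero {c : Spacetime}
    (h : IsFrameChange (rotationMatrix Ω) c Ψ Φ) (hΨ : ContDiff ℝ ∞ Ψ) (y : Spacetime) :
    virialCurrent e Φ 0 y = virialCurrent e Ψ 0 ((rotationMatrix Ω).mulVec y + c) := by
  have eG : ∀ σ, fieldG e Φ 0 σ y = ∑ β, (rotationMatrix Ω β σ : ℂ) *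
      fieldG e Ψ 0 β ((rotationMatrix Ω).mulVec y + c) := by
    intro σ
    rw [h.fieldG_eq hΨ]
    beta_reduce
    rw [Fin.sum_univ_succ]
    simp
  unfold virialCurrent
  simp only [eG, h.vector]
  rw [(isLorentz_rotationMatrix Ω).contract_reDot]

/-- The momentum density and the position vector turn by the same rotation, so their contraction is
invariant. Periodicity is the case `Φ = Ψ`, which matches the two time faces in the virial theorem.
-/
theorem IsFrameChange.dilationCurrent_zero {T : ℝ}
    (h : IsFrameChange (rotationMatrix Ω) (event T 0) Ψ Φ) (hΨ : ContDiff ℝ ∞ Ψ)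
    (x : Fin 3 → ℝ) :
    dilationCurrent e m Ψ 0 (event T (Ω.1.mulVec x)) = dilationCurrent e m Φ 0 (event 0 x) := by
  unfold dilationCurrent
  rw [h.virialCurrent_zero Ω hΨ, rotationMatrix_mulVec_event, zero_add]
  congr 1
  have hs : ∀ Θ k y, stress e m Θ 0 (Fin.succ k) y = ChargedVector.stressCore e m Θ 0 k.succ y :=
    fun Θ k y => by simp [stress, (Fin.succ_ne_zero _).symm]
  simp only [contractPosition, hs]
  have hk : ∀ k : Fin 3, ChargedVector.stressCore e m Φ 0 k.succ (event 0 x)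
      = ∑ j : Fin 3, Ω.1 j k * ChargedVector.stressCore e m Ψ 0 j.succ
        (event T (Ω.1.mulVec x)) := by
    intro k
    rw [h.stressCore (isLorentz_rotationMatrix Ω) hΨ, rotationMatrix_mulVec_event, zero_add,
      Fin.sum_univ_succ]
    simp only [Fin.sum_univ_succ (n := 3)]
    simp
  simp only [hk]
  simp only [event, Matrix.cons_val_succ, Matrix.mulVec, dotProduct, Finset.sum_mul,
    Finset.mul_sum]
  rw [Finset.sum_comm]
  exact Finset.sum_congr rfl fun k _ => Finset.sum_congr rfl fun j _ => by ring

end Rotation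

/-! ### Vanishing of all fields in the rest frame. -/

section Vanishing

open MeasureTheory

variable {e m T : ℝ} {Ψ Φ : Spacetime → FieldValue}

/-- The interior of the slab `0 ≤ t ≤ T`. -/
def openSlab (T : ℝ) : Set Spacetime := {x | 0 < x 0 ∧ x 0 < T}

theorem isOpen_openSlab (T : ℝ) : IsOpen (openSlab T) :=
  (isOpen_lt continuous_const (continuous_apply 0)).inter
    (isOpen_lt (continuous_apply 0) continuous_const)

theorem openSlab_subset_slab (T : ℝ) : openSlab T ⊆ slab T := fun _ h => ⟨h.1.le, h.2.le⟩

theorem slab_eq_closure (hT : 0 < T) : slab T = closure (openSlab T) := by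
  have h := (isOpenMap_eval (X := fun _ : Fin 4 => ℝ) 0).preimage_closure_eq_closure_preimage
    (continuous_apply 0) (Set.Ioo 0 T)
  rw [closure_Ioo hT.ne] at h
  exact h

theorem slab_ae_eq_openSlab (T : ℝ) : slab T =ᵐ[volume] openSlab T := by
  have h : ∀ c : ℝ, volume {x : Spacetime | x 0 = c} = 0 := fun c =>
    Measure.pi_hyperplane (fun _ : Fin 4 => (volume : Measure ℝ)) 0 c
  refine Filter.EventuallyLE.antisymm ?_ (openSlab_subset_slab T).eventuallyLE
  rw [ae_le_set]
  refine measure_mono_null (t := {x : Spacetime | x 0 = 0} ∪ {x | x 0 = T}) ?_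
    (measure_union_null (h 0) (h T))
  rintro x ⟨⟨h1, h2⟩, h3⟩
  by_contra hx
  simp only [Set.mem_union, Set.mem_ofPred_eq, not_or] at hx
  exact h3 ⟨lt_of_le_of_ne h1 (Ne.symm hx.1), lt_of_le_of_ne h2 hx.2⟩

/-- Almost-everywhere vanishing becomes pointwise on the open interior by continuity. An open set is
also what the later steps need, since they differentiate the vanishing components. -/
theorem eq_zero_of_integral_slab_eq_zero {g : Spacetime → ℝ} (hg : Continuous g)
    (hnonneg : ∀ y, 0 ≤ g y) (hint : IntegrableOn g (slab T)) (h0 : ∫ y in slab T, g y = 0)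
    {y : Spacetime} (hy : y ∈ openSlab T) : g y = 0 := by
  have h1 : g =ᵐ[volume.restrict (slab T)] 0 :=
    (integral_eq_zero_iff_of_nonneg hnonneg hint).1 h0
  have h2 : g =ᵐ[volume.restrict (openSlab T)] 0 := by
    rwa [Measure.restrict_congr_set (slab_ae_eq_openSlab T)] at h1
  exact Measure.eqOn_open_of_ae_eq h2 (isOpen_openSlab T) hg.continuousOn continuousOn_const hy

theorem FiniteIntegrals.integrableOn (h : FiniteIntegrals e m T Ψ) (k : Fin 6) :
    IntegrableOn (fieldDensity e m Ψ k) (slab T) := h k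

theorem FiniteIntegrals.integrableOn_energyBound (h : FiniteIntegrals e m T Ψ) :
    IntegrableOn (energyBound e m Ψ) (slab T) := by
  have : energyBound e m Ψ = fun y => 2 * fieldDensity e m Ψ 0 y + 2 * fieldDensity e m Ψ 1 y
      + fieldDensity e m Ψ 2 y + fieldDensity e m Ψ 3 y + 4 * fieldDensity e m Ψ 4 y
      + 4 * fieldDensity e m Ψ 5 y := funext energyBound_eq
  rw [this]
  exact ((((((h.integrableOn 0).const_mul 2).add ((h.integrableOn 1).const_mul 2)).add
    (h.integrableOn 2)).add (h.integrableOn 3)).add ((h.integrableOn 4).const_mul 4)).add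
    ((h.integrableOn 5).const_mul 4)

/-- The virial identity of the dilation current: the magnetic-type field strengths, the time
component of the vector field and the electromagnetic field vanish. -/
theorem densities_vanish (hm : m ≠ 0) (hΨ : ContDiff ℝ ∞ Ψ) (h : FieldEquations e m Ψ)
    (hT : 0 < T) (Ω : Matrix.specialOrthogonalGroup (Fin 3) ℝ)
    (hper : IsFrameChange (rotationMatrix Ω) (event T 0) Ψ Ψ) (hfin : FiniteIntegrals e m T Ψ)
    {y : Spacetime} (hy : y ∈ openSlab T) :
    2 * fieldDensity e m Ψ 1 y + 2 * fieldDensity e m Ψ 2 y + fieldDensity e m Ψ 4 y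
        + fieldDensity e m Ψ 5 y = 0 := by
  set g : Spacetime → ℝ := fun y => 2 * fieldDensity e m Ψ 1 y + 2 * fieldDensity e m Ψ 2 y
    + fieldDensity e m Ψ 4 y + fieldDensity e m Ψ 5 y with hg
  have hdiv : (fun y => ∑ μ, partialDeriv μ (dilationCurrent e m Ψ μ) y) = g :=
    funext fun y => divergence_dilationCurrent h hΨ y
  have hint : IntegrableOn g (slab T) :=
    ((((hfin.integrableOn 1).const_mul 2).add ((hfin.integrableOn 2).const_mul 2)).add
      (hfin.integrableOn 4)).add (hfin.integrableOn 5)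
  have h0 := integral_slab_divergence_eq_zero (J := dilationCurrent e m Ψ)
    (contDiff_dilationCurrent hΨ) hT.le Ω (hper.dilationCurrent_zero Ω hΨ)
    (hfin.integrableOn_energyBound.const_mul (11 + (m ^ 2)⁻¹))
    (fun y j => abs_dilationCurrent_le hm j.succ y) (by rw [hdiv]; exact hint)
  rw [hdiv] at h0
  have hc : ∀ k, Continuous (fieldDensity e m Ψ k) := continuous_fieldDensity hΨ
  refine eq_zero_of_integral_slab_eq_zero (g := g) ?_ (fun y => ?_) hint h0 hy
  · exact ((((hc 1).const_mul 2).add ((hc 2).const_mul 2)).add (hc 4)).add (hc 5)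
  · have := fun k => fieldDensity_nonneg (e := e) (m := m) (Ψ := Ψ) k y
    have h1 := this 1
    have h2 := this 2
    have h4 := this 4
    have h5 := this 5
    simp only [hg]
    positivity

theorem fields_vanish_of_densities (hm : m ≠ 0) {y : Spacetime}
    (h : 2 * fieldDensity e m Ψ 1 y + 2 * fieldDensity e m Ψ 2 y + fieldDensity e m Ψ 4 y
        + fieldDensity e m Ψ 5 y = 0) :
    (∀ i j : Fin 3, fieldG e Ψ i.succ j.succ y = 0) ∧ (Ψ y).1 0 = 0 ∧
      ∀ μ ν, fieldF Ψ μ ν y = 0 := by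
  have h1 := fieldDensity_nonneg (e := e) (m := m) (Ψ := Ψ) 1 y
  have h2 := fieldDensity_nonneg (e := e) (m := m) (Ψ := Ψ) 2 y
  have h4 := fieldDensity_nonneg (e := e) (m := m) (Ψ := Ψ) 4 y
  have h5 := fieldDensity_nonneg (e := e) (m := m) (Ψ := Ψ) 5 y
  have z1 : fieldDensity e m Ψ 1 y = 0 := by linarith
  have z2 : fieldDensity e m Ψ 2 y = 0 := by linarith
  have z4 : fieldDensity e m Ψ 4 y = 0 := by linarith
  have z5 : fieldDensity e m Ψ 5 y = 0 := by linarith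
  rw [fieldDensity_one] at z1
  rw [fieldDensity_two] at z2
  rw [fieldDensity_four] at z4
  rw [fieldDensity_five] at z5
  have hF0 : ∀ i : Fin 3, fieldF Ψ 0 i.succ y = 0 := fun i => by
    have := (Finset.sum_eq_zero_iff_of_nonneg (fun i _ => by positivity)).1 z4 i (Finset.mem_univ i)
    simpa using this
  have hFs : ∀ i j : Fin 3, fieldF Ψ i.succ j.succ y = 0 := fun i j => by
    have := (Finset.sum_eq_zero_iff_of_nonneg (fun i _ => by positivity)).1 z5 i (Finset.mem_univ i)
    have := (Finset.sum_eq_zero_iff_of_nonneg (fun i _ => by positivity)).1 this j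
      (Finset.mem_univ j)
    simpa using this
  refine ⟨fun i j => ?_, ?_, fun μ ν => ?_⟩
  · have := (Finset.sum_eq_zero_iff_of_nonneg (fun i _ => by positivity)).1 z1 i (Finset.mem_univ i)
    have := (Finset.sum_eq_zero_iff_of_nonneg (fun i _ => by positivity)).1 this j
      (Finset.mem_univ j)
    simpa using this
  · simpa [hm] using z2
  · refine Fin.cases ?_ (fun i => ?_) μ <;> refine Fin.cases ?_ (fun j => ?_) ν
    · exact fieldF_self 0 y
    · exact hF0 j
    · rw [fieldF_antisymm, hF0, neg_zero]
    · exact hFs i j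

/-- The Maxwell-type spatial stress tensor of the electric-type field strength `G_{0i}`. -/
def electricStress (e : ℝ) (Ψ : Spacetime → FieldValue) (j k : Fin 3) (y : Spacetime) : ℝ :=
  2 * reDot (fieldG e Ψ 0 j.succ y) (fieldG e Ψ 0 k.succ y)
    - (if j = k then 1 else 0) * ∑ i : Fin 3,
      reDot (fieldG e Ψ 0 i.succ y) (fieldG e Ψ 0 i.succ y)

theorem contDiff_electricStress (hΨ : ContDiff ℝ ∞ Ψ) (j k : Fin 3) :
    ContDiff ℝ ∞ (electricStress e Ψ j k) :=
  (contDiff_const.mul (contDiff_reDot (contDiff_fieldG hΨ _ _) (contDiff_fieldG hΨ _ _))).sub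
    (contDiff_const.mul (ContDiff.sum fun _ _ =>
      contDiff_reDot (contDiff_fieldG hΨ _ _) (contDiff_fieldG hΨ _ _)))

theorem abs_electricStress_le (j k : Fin 3) (y : Spacetime) :
    |electricStress e Ψ j k y| ≤ 5 * energyBound e m Ψ y := by
  have h1 : ∑ i : Fin 3, ‖fieldG e Ψ 0 i.succ y‖ ^ 2 ≤ energyBound e m Ψ y := by
    have hk := fun k => fieldDensity_nonneg (e := e) (m := m) (Ψ := Ψ) k y
    rw [energyBound_eq, ← fieldDensity_zero (e := e) (m := m)]
    linarith [hk 0, hk 1, hk 2, hk 3, hk 4, hk 5]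
  have h2 : ∀ i : Fin 3, ‖fieldG e Ψ 0 i.succ y‖ ^ 2 ≤ energyBound e m Ψ y := fun i =>
    (Finset.single_le_sum (f := fun i : Fin 3 => ‖fieldG e Ψ 0 i.succ y‖ ^ 2)
      (fun _ _ => by positivity) (Finset.mem_univ i)).trans h1
  have h3 := (abs_reDot_le (fieldG e Ψ 0 j.succ y) (fieldG e Ψ 0 k.succ y)).trans
    (add_le_add (h2 j) (h2 k))
  have h4 : 0 ≤ ∑ i : Fin 3, ‖fieldG e Ψ 0 i.succ y‖ ^ 2 := by positivity
  have h5 : |(if j = k then (1 : ℝ) else 0) * ∑ i : Fin 3,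
      reDot (fieldG e Ψ 0 i.succ y) (fieldG e Ψ 0 i.succ y)| ≤ energyBound e m Ψ y := by
    simp only [reDot_self]
    split_ifs
    · rwa [one_mul, abs_of_nonneg h4]
    · rw [zero_mul, abs_zero]; exact energyBound_nonneg y
  refine (abs_sub _ _).trans ?_
  rw [abs_mul, abs_two]
  linarith

theorem electricStress_trace (y : Spacetime) :
    ∑ k : Fin 3, electricStress e Ψ k k y = -fieldDensity e m Ψ 0 y := by
  rw [fieldDensity_zero]
  simp [electricStress, reDot_self, Fin.sum_univ_three]
  ring

/-- Where the magnetic-type field strengths, the time component of the vector field and the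
electromagnetic field vanish, the electric-type field strength is divergence- and curl-free, and
its stress tensor is conserved. -/
theorem electricStress_conservation (hΨ : ContDiff ℝ ∞ Ψ) (h : FieldEquations e m Ψ)
    {y : Spacetime} (hev : ∀ᶠ z in 𝓝 y, (∀ i j : Fin 3, fieldG e Ψ i.succ j.succ z = 0) ∧
      (Ψ z).1 0 = 0 ∧ ∀ μ ν, fieldF Ψ μ ν z = 0) (k : Fin 3) :
    ∑ j : Fin 3, partialDeriv j.succ (electricStress e Ψ j k) y = 0 := by
  set D := gaugeDeriv e (fun y => (Ψ y).2) with hD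
  obtain ⟨-, hW0, hF⟩ := hev.self_of_nhds
  -- In the Bianchi identity for (0, i, j) the time derivative drops out because G_ij vanishes near
  -- `y`, and the right side drops out because F = 0.
  have hcurl : ∀ i j : Fin 3, D i.succ (fieldG e Ψ 0 j.succ) y = D j.succ (fieldG e Ψ 0 i.succ) y := by
    intro i j
    have h1 := fieldG_bianchi (e := e) hΨ 0 i.succ j.succ y
    have h2 : D 0 (fieldG e Ψ i.succ j.succ) y = 0 := by
      have : fieldG e Ψ i.succ j.succ =ᶠ[𝓝 y] fun _ => 0 := hev.mono fun z hz => hz.1 i j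
      rw [hD, gaugeDeriv_congr this, gaugeDeriv_zero]
    simp only [hF] at h1
    have h3 : D i.succ (fieldG e Ψ j.succ 0) y = -D i.succ (fieldG e Ψ 0 j.succ) y :=
      gaugeDeriv_fieldG_antisymm hΨ i.succ j.succ 0 y
    rw [← hD, h2, h3] at h1
    simp only [Complex.ofReal_zero, zero_mul, add_zero, mul_zero, neg_zero, zero_add] at h1
    linear_combination -h1
  -- This is the Gauss law, the field equation for ν = 0, without its source m² W_0.
  have hdiv : ∑ i : Fin 3, D i.succ (fieldG e Ψ 0 i.succ) y = 0 := by
    have h1 := h.vector y 0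
    rw [hW0, mul_zero, add_zero, Fin.sum_univ_succ] at h1
    have h2 : D 0 (fieldG e Ψ 0 0) y = 0 := by
      have : fieldG e Ψ 0 0 =ᶠ[𝓝 y] fun _ => 0 := Filter.Eventually.of_forall (fieldG_self 0)
      rw [hD, gaugeDeriv_congr this, gaugeDeriv_zero]
    rw [← hD, h2, mul_zero, zero_add] at h1
    rw [← h1]
    refine Finset.sum_congr rfl fun i _ => ?_
    have heta : eta i.succ = -1 := by fin_cases i <;> simp [eta]
    rw [hD, gaugeDeriv_fieldG_antisymm hΨ i.succ 0 i.succ, heta]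
    push_cast
    ring
  have hder : ∀ j : Fin 3, partialDeriv j.succ (electricStress e Ψ j k) y
      = 2 * (reDot (D j.succ (fieldG e Ψ 0 j.succ) y) (fieldG e Ψ 0 k.succ y)
          + reDot (fieldG e Ψ 0 j.succ y) (D j.succ (fieldG e Ψ 0 k.succ) y))
        - (if j = k then 1 else 0) * (2 * ∑ i : Fin 3,
          reDot (fieldG e Ψ 0 i.succ y) (D j.succ (fieldG e Ψ 0 i.succ) y)) := by
    intro j
    have c1 : ∀ i l : Fin 3, ContDiff ℝ ∞ fun z =>
        reDot (fieldG e Ψ 0 i.succ z) (fieldG e Ψ 0 l.succ z) := fun i l =>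
      contDiff_reDot (contDiff_fieldG hΨ _ _) (contDiff_fieldG hΨ _ _)
    have c2 : ContDiff ℝ ∞ fun z => ∑ i : Fin 3,
        reDot (fieldG e Ψ 0 i.succ z) (fieldG e Ψ 0 i.succ z) := ContDiff.sum fun i _ => c1 i i
    unfold electricStress
    rw [partialDeriv_sub (contDiff_const.mul (c1 j k)).differentiableAt_infty
        (contDiff_const.mul c2).differentiableAt_infty,
      partialDeriv_const_mul (c1 j k).differentiableAt_infty,
      partialDeriv_const_mul c2.differentiableAt_infty,
      partialDeriv_sum _ fun i _ => (c1 i i).differentiableAt_infty]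
    simp only [partialDeriv_reDot (contDiff_fieldG hΨ 0 _) (contDiff_fieldG hΨ 0 _) e
      (fun y => (Ψ y).2), ← hD]
    simp only [reDot_comm (D _ _ y) (fieldG e Ψ 0 _ y), ← two_mul, ← Finset.mul_sum]
  have hsel : ∑ j : Fin 3, (if j = k then (1 : ℝ) else 0) * (2 * ∑ i : Fin 3,
      reDot (fieldG e Ψ 0 i.succ y) (D j.succ (fieldG e Ψ 0 i.succ) y))
      = 2 * ∑ i : Fin 3, reDot (fieldG e Ψ 0 i.succ y) (D k.succ (fieldG e Ψ 0 i.succ) y) := by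
    rw [Finset.sum_eq_single k]
    · rw [if_pos rfl, one_mul]
    · intro j _ hj; rw [if_neg hj, zero_mul]
    · simp
  simp only [hder, Finset.sum_sub_distrib]
  -- The divergence term is gone; by `hcurl` the two remaining sums, E_j·D_j E_k and E_j·D_k E_j
  -- with E_j = G_0j, coincide.
  rw [hsel, ← Finset.mul_sum, Finset.sum_add_distrib, ← reDot_sum_left, hdiv]
  simp only [hcurl k]
  simp [reDot]

/-- A second virial identity, for the electric-type stress contracted with position. Its current has
no time component, so the matching of the time faces is trivial and the rotation in the virial
theorem can be taken to be 1. -/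
theorem fieldDensity_zero_vanish (hΨ : ContDiff ℝ ∞ Ψ) (h : FieldEquations e m Ψ)
    (hT : 0 < T) (hfin : FiniteIntegrals e m T Ψ)
    (hvan : ∀ y ∈ openSlab T, (∀ i j : Fin 3, fieldG e Ψ i.succ j.succ y = 0) ∧
      (Ψ y).1 0 = 0 ∧ ∀ μ ν, fieldF Ψ μ ν y = 0)
    {y : Spacetime} (hy : y ∈ openSlab T) : fieldDensity e m Ψ 0 y = 0 := by
  set S : Fin 4 → Fin 3 → Spacetime → ℝ :=
    fun μ k => (Fin.cons 0 (fun j => electricStress e Ψ j k) : Fin 4 → Spacetime → ℝ) μ with hS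
  have hSs : ∀ j k, S j.succ k = electricStress e Ψ j k := fun j k => rfl
  have hS0 : ∀ k, S 0 k = 0 := fun k => rfl
  have hSc : ∀ μ k, ContDiff ℝ ∞ (S μ k) := by
    intro μ k
    refine Fin.cases ?_ (fun j => ?_) μ
    · exact contDiff_const
    · exact contDiff_electricStress hΨ j k
  have hcons : ∀ z ∈ openSlab T, ∀ k, ∑ μ, partialDeriv μ (S μ k) z = 0 := by
    intro z hz k
    rw [Fin.sum_univ_succ, hS0]
    simp only [hSs]
    rw [electricStress_conservation hΨ h (Filter.eventually_of_mem
      ((isOpen_openSlab T).mem_nhds hz) hvan)]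
    simp [partialDeriv]
  -- Conservation is available only in the open slab, where the other components vanish in a
  -- neighbourhood; the two bounding hyperplanes have measure zero.
  have hdiv : (fun z => ∑ μ, partialDeriv μ (contractPosition (S μ)) z)
      =ᵐ[volume.restrict (slab T)] fun z => -fieldDensity e m Ψ 0 z := by
    rw [Measure.restrict_congr_set (slab_ae_eq_openSlab T)]
    filter_upwards [ae_restrict_mem (isOpen_openSlab T).measurableSet] with z hz
    rw [divergence_contractPosition hSc (hcons z hz), ← electricStress_trace]
    rfl
  have h0 := integral_slab_divergence_eq_zero (J := fun μ => contractPosition (S μ))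
    (fun μ => contDiff_contractPosition (hSc μ)) hT.le 1
    (fun x => by simp [contractPosition, hS0])
    (hfin.integrableOn_energyBound.const_mul 5)
    (fun z j => (abs_contractPosition_le fun k => by
      rw [hSs]; exact abs_electricStress_le (m := m) j k z).trans
      (mul_le_mul_of_nonneg_right (by linarith)
        (mul_nonneg (by norm_num) (energyBound_nonneg z))))
    (((hfin.integrableOn 0).neg).congr hdiv.symm)
  rw [integral_congr_ae hdiv, integral_neg, neg_eq_zero] at h0
  exact eq_zero_of_integral_slab_eq_zero (continuous_fieldDensity hΨ 0)
    (fieldDensity_nonneg 0) (hfin.integrableOn 0) h0 hy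

theorem fields_vanish_on_slab (hm : m ≠ 0) (hΨ : ContDiff ℝ ∞ Ψ) (h : FieldEquations e m Ψ)
    (hT : 0 < T) (Ω : Matrix.specialOrthogonalGroup (Fin 3) ℝ)
    (hper : IsFrameChange (rotationMatrix Ω) (event T 0) Ψ Ψ) (hfin : FiniteIntegrals e m T Ψ)
    {y : Spacetime} (hy : y ∈ slab T) : (Ψ y).1 = 0 ∧ ∀ μ ν, fieldF Ψ μ ν y = 0 := by
  have hvan : ∀ y ∈ openSlab T, (∀ i j : Fin 3, fieldG e Ψ i.succ j.succ y = 0) ∧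
      (Ψ y).1 0 = 0 ∧ ∀ μ ν, fieldF Ψ μ ν y = 0 := fun y hy =>
    fields_vanish_of_densities hm (densities_vanish hm hΨ h hT Ω hper hfin hy)
  have hG : ∀ y ∈ openSlab T, ∀ μ ν, fieldG e Ψ μ ν y = 0 := by
    intro y hy
    have hE : ∀ i : Fin 3, fieldG e Ψ 0 i.succ y = 0 := fun i => by
      have h1 := fieldDensity_zero_vanish hΨ h hT hfin hvan hy
      rw [fieldDensity_zero] at h1
      have := (Finset.sum_eq_zero_iff_of_nonneg (fun i _ => by positivity)).1 h1 i
        (Finset.mem_univ i)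
      simpa using this
    intro μ ν
    refine Fin.cases ?_ (fun i => ?_) μ <;> refine Fin.cases ?_ (fun j => ?_) ν
    · exact fieldG_self 0 y
    · exact hE j
    · rw [fieldG_antisymm, hE, neg_zero]
    · exact (hvan y hy).1 i j
  -- With G = 0 near the point, the field equation reads m² W_ν = 0.
  have hW : ∀ y ∈ openSlab T, ∀ ν, (Ψ y).1 ν = 0 := by
    intro y hy ν
    have h1 := h.vector y ν
    have h2 : ∀ μ, gaugeDeriv e (fun y => (Ψ y).2) μ (fieldG e Ψ μ ν) y = 0 := fun μ => by
      have : fieldG e Ψ μ ν =ᶠ[𝓝 y] fun _ => 0 := Filter.eventually_of_mem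
        ((isOpen_openSlab T).mem_nhds hy) fun z hz => hG z hz μ ν
      rw [gaugeDeriv_congr this, gaugeDeriv_zero]
    simpa [h2, hm] using h1
  have hclosed : IsClosed {y | ∀ ν, (Ψ y).1 ν = 0 ∧ ∀ μ, fieldF Ψ μ ν y = 0} := by
    simp only [Set.ofPred_forall, Set.ofPred_and]
    exact isClosed_iInter fun ν => (isClosed_eq (contDiff_W hΨ ν).continuous
      continuous_const).inter (isClosed_iInter fun μ =>
        isClosed_eq (contDiff_fieldF hΨ μ ν).continuous continuous_const)
  have hsub : slab T ⊆ {y | ∀ ν, (Ψ y).1 ν = 0 ∧ ∀ μ, fieldF Ψ μ ν y = 0} := by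
    rw [slab_eq_closure hT]
    exact hclosed.closure_subset_iff.2 fun y hy ν =>
      ⟨hW y hy ν, fun μ => (hvan y hy).2.2 μ ν⟩
  exact ⟨funext fun ν => (hsub hy ν).1, fun μ ν => (hsub hy ν).2 μ⟩

/-- Used twice: to step back by one period, and to return from the rest frame to the original one.
-/
theorem IsFrameChange.inverse {M M' : Matrix (Fin 4) (Fin 4) ℝ} {c : Spacetime}
    (h : IsFrameChange M c Ψ Φ) (hM : M * M' = 1) :
    IsFrameChange M' (-M'.mulVec c) Φ Ψ := by
  have hz : ∀ y, M.mulVec (M'.mulVec y + -M'.mulVec c) + c = y := fun y => by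
    rw [← sub_eq_add_neg, Matrix.mulVec_sub, Matrix.mulVec_mulVec, Matrix.mulVec_mulVec, hM]
    simp
  have hsum : ∀ α μ, ∑ ν, M' ν μ * M α ν = if α = μ then 1 else 0 := fun α μ => by
    rw [← Matrix.one_apply, ← hM, Matrix.mul_apply]
    exact Finset.sum_congr rfl fun ν _ => mul_comm _ _
  constructor
  · intro y μ
    simp only [h.vector, hz, Finset.mul_sum]
    rw [Finset.sum_comm]
    simp only [← mul_assoc, ← Finset.sum_mul, ← Complex.ofReal_mul, ← Complex.ofReal_sum, hsum]
    rw [Finset.sum_eq_single μ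
      (fun x _ hx => by rw [if_neg hx, Complex.ofReal_zero, zero_mul])
      (fun hμ => absurd (Finset.mem_univ μ) hμ), if_pos rfl, Complex.ofReal_one, one_mul]
  · intro y μ
    simp only [h.potential, hz, Finset.mul_sum]
    rw [Finset.sum_comm]
    simp only [← mul_assoc, ← Finset.sum_mul, hsum]
    rw [Finset.sum_eq_single μ (fun x _ hx => by rw [if_neg hx, zero_mul])
      (fun hμ => absurd (Finset.mem_univ μ) hμ), if_pos rfl, one_mul]

theorem IsFrameChange.vanish {M : Matrix (Fin 4) (Fin 4) ℝ} {c : Spacetime}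
    (h : IsFrameChange M c Ψ Φ) (hΨ : ContDiff ℝ ∞ Ψ) {y : Spacetime}
    (hy : (Ψ (M.mulVec y + c)).1 = 0 ∧ ∀ μ ν, fieldF Ψ μ ν (M.mulVec y + c) = 0) :
    (Φ y).1 = 0 ∧ ∀ μ ν, fieldF Φ μ ν y = 0 := by
  refine ⟨funext fun μ => ?_, fun μ ν => ?_⟩
  · rw [h.vector, hy.1]; simp
  · rw [h.fieldF_eq hΨ]; simp [hy.2]

theorem forall_of_slab_of_shift {P : Spacetime → Prop} (hT : 0 < T) (hP : ∀ y ∈ slab T, P y)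
    {f g : Spacetime → Spacetime} (hf : ∀ y, f y 0 = y 0 + T) (hg : ∀ y, g y 0 = y 0 - T)
    (hPf : ∀ y, P (f y) → P y) (hPg : ∀ y, P (g y) → P y) (y : Spacetime) : P y := by
  -- The known time interval is [-nT, (n + 1)T], which is the slab itself at n = 0; each step
  -- extends it by one period on either side.
  have key : ∀ n : ℕ, ∀ y : Spacetime, -(n * T) ≤ y 0 → y 0 ≤ (n + 1) * T → P y := by
    intro n
    induction n with
    | zero => exact fun y h1 h2 => hP y ⟨by simpa using h1, by simpa using h2⟩
    | succ n ih =>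
      intro y h1 h2
      push_cast at h1 h2
      have hn : 0 ≤ (n : ℝ) * T := by positivity
      rcases le_total (y 0) 0 with h3 | h3
      · exact hPf y (ih _ (by rw [hf]; linarith) (by rw [hf]; linarith))
      rcases le_total (y 0) T with h4 | h4
      · exact hP y ⟨h3, h4⟩
      · exact hPg y (ih _ (by rw [hg]; linarith) (by rw [hg]; linarith))
  obtain ⟨n, hn⟩ := exists_nat_gt (|y 0| / T)
  rw [div_lt_iff₀ hT] at hn
  obtain ⟨h1, h2⟩ := abs_lt.1 hn
  exact key n y h1.le (by linarith)

/-- A solution that is periodic in time up to a rotation and has finite integrals is trivial. -/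
theorem fields_vanish (hm : m ≠ 0) (hΨ : ContDiff ℝ ∞ Ψ) (h : FieldEquations e m Ψ)
    (hT : 0 < T) (Ω : Matrix.specialOrthogonalGroup (Fin 3) ℝ)
    (hper : IsFrameChange (rotationMatrix Ω) (event T 0) Ψ Ψ) (hfin : FiniteIntegrals e m T Ψ)
    (y : Spacetime) : (Ψ y).1 = 0 ∧ ∀ μ ν, fieldF Ψ μ ν y = 0 := by
  have hinv := hper.inverse (rotationMatrix_mul_transpose Ω)
  refine forall_of_slab_of_shift (P := fun y => (Ψ y).1 = 0 ∧ ∀ μ ν, fieldF Ψ μ ν y = 0) hT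
    (fun y hy => fields_vanish_on_slab hm hΨ h hT Ω hper hfin hy)
    (f := fun y => (rotationMatrix Ω).mulVec y + event T 0)
    (g := fun y => (rotationMatrix Ω).transpose.mulVec y
      + -(rotationMatrix Ω).transpose.mulVec (event T 0))
    (fun y => ?_) (fun y => ?_) (fun y hy => hper.vanish hΨ hy) (fun y hy => hinv.vanish hΨ hy) y
  · simp [rotationMatrix_mulVec, event]
  · simp [Matrix.mulVec, dotProduct, Fin.sum_univ_succ (n := 3), event, sub_eq_add_neg]

end Vanishing

/-! ### Passage to the rest frame, and the gauge potential. -/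

section RestFrame

variable {e m T : ℝ} {Ψ : Spacetime → FieldValue}

/-- The boost is built from `v` alone, and Ω fixes `v` both as a column and, being orthogonal, as a
row. -/
theorem rotationMatrix_commute_boost {Ω : Matrix.specialOrthogonalGroup (Fin 3) ℝ}
    {v : Fin 3 → ℝ} (hv : Ω.1.mulVec v = v) :
    rotationMatrix Ω * boost v = boost v * rotationMatrix Ω := by
  have h1 : ∀ i, ∑ j, Ω.1 i j * v j = v i := fun i => congrFun hv i
  have h2 : ∀ i, ∑ j, v j * Ω.1 j i = v i := fun i => by
    have h3 : Matrix.vecMul v Ω.1 = v := by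
      have h4 : Ω.1.transpose * Ω.1 = 1 := mul_eq_one_comm.1 (rotation_mul_transpose Ω)
      have h5 : Ω.1.transpose.mulVec (Ω.1.mulVec v) = v := by
        rw [Matrix.mulVec_mulVec, h4, Matrix.one_mulVec]
      rwa [hv, Matrix.mulVec_transpose] at h5
    exact congrFun h3 i
  have b00 : boost v 0 0 = lorentzFactor v := rfl
  have b0s : ∀ j : Fin 3, boost v 0 j.succ = lorentzFactor v * v j := fun _ => rfl
  have bs0 : ∀ j : Fin 3, boost v j.succ 0 = lorentzFactor v * v j := fun _ => rfl
  have bss : ∀ i j : Fin 3, boost v i.succ j.succ = (if i = j then 1 else 0)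
    + lorentzFactor v ^ 2 / (1 + lorentzFactor v) * v i * v j := fun _ _ => rfl
  ext μ ν
  rw [Matrix.mul_apply, Matrix.mul_apply]
  simp only [Fin.sum_univ_succ (n := 3)]
  refine Fin.cases ?_ (fun i => ?_) μ <;> refine Fin.cases ?_ (fun j => ?_) ν
  · simp
  · simp only [rotationMatrix_zero_zero, rotationMatrix_zero_succ, rotationMatrix_succ_succ, b0s,
      b00, mul_assoc, ← Finset.mul_sum, h2]
    simp
  · simp only [rotationMatrix_zero_zero, rotationMatrix_succ_zero, rotationMatrix_succ_succ, bs0,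
      b00, mul_left_comm _ (lorentzFactor v), ← Finset.mul_sum, h1]
    simp
  · simp only [rotationMatrix_zero_succ, rotationMatrix_succ_zero, rotationMatrix_succ_succ, bss]
    set k := lorentzFactor v ^ 2 / (1 + lorentzFactor v)
    have e1 : ∑ x, Ω.1 i x * ((if x = j then 1 else 0) + k * v x * v j)
        = Ω.1 i j + k * v j * ∑ x, Ω.1 i x * v x := by
      simp only [mul_add, Finset.sum_add_distrib, Finset.mul_sum]
      congr 1
      · simp
      · exact Finset.sum_congr rfl fun x _ => by ring
    have e2 : ∑ x, ((if i = x then 1 else 0) + k * v i * v x) * Ω.1 x j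
        = Ω.1 i j + k * v i * ∑ x, v x * Ω.1 x j := by
      simp only [add_mul, Finset.sum_add_distrib, Finset.mul_sum]
      congr 1
      · simp
      · exact Finset.sum_congr rfl fun x _ => by ring
    rw [e1, e2, h1, h2]
    ring

theorem rotate_eq_sum {K : Type*} [Semiring K] [Algebra ℝ K]
    (Ω : Matrix.specialOrthogonalGroup (Fin 3) ℝ) (a : Fin 4 → K) (μ : Fin 4) :
    rotate Ω a μ = ∑ ν, rotationMatrix Ω μ ν • a ν := by
  rw [Fin.sum_univ_succ]
  refine Fin.cases ?_ (fun i => ?_) μ <;> simp [rotate]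

/-- Evaluating periodicity at Ωx + l, where Ω⁻¹l = l, makes the argument on the right simply x. The
symmetry becomes the affine map z ↦ Nz + (T, l), with N the rotation of space-time. -/
theorem PeriodicUpTo.apply {Ω : Matrix.specialOrthogonalGroup (Fin 3) ℝ} {l : Fin 3 → ℝ}
    (h : PeriodicUpTo T Ω l Ψ) (hl : Ω.1.mulVec l = l) (z : Spacetime) :
    (Ψ ((rotationMatrix Ω).mulVec z + event T l)).1 = rotate Ω (Ψ z).1 ∧
    (Ψ ((rotationMatrix Ω).mulVec z + event T l)).2 = rotate Ω (Ψ z).2 := by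
  have hz : z = event (z 0) (fun j => z j.succ) := by
    ext μ
    refine Fin.cases ?_ (fun i => ?_) μ <;> simp [event]
  have h1 := h (z 0) (Ω.1.mulVec (fun j => z j.succ) + l)
  have h2 : (Ω⁻¹).1.mulVec (Ω.1.mulVec (fun j => z j.succ) + l) - l = fun j => z j.succ := by
    have hinv : (Ω⁻¹).1 * Ω.1 = 1 :=
      congrArg Subtype.val (inv_mul_cancel Ω)
    have hl' : (Ω⁻¹).1.mulVec l = l := by
      conv_lhs => rw [← hl]
      rw [Matrix.mulVec_mulVec, hinv, Matrix.one_mulVec]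
    rw [Matrix.mulVec_add, Matrix.mulVec_mulVec, hinv, Matrix.one_mulVec, hl', add_sub_cancel_right]
  rw [h2, ← hz] at h1
  rw [rotationMatrix_mulVec, event_add]
  exact h1

theorem boost_mulVec_event (v : Fin 3 → ℝ) (t : ℝ) :
    (boost v).mulVec (event t 0) = event (lorentzFactor v * t) ((lorentzFactor v * t) • v) := by
  ext μ
  refine Fin.cases ?_ (fun i => ?_) μ
  · simp [boost, event, Matrix.mulVec, dotProduct, Fin.sum_univ_succ (n := 3)]
  · simp [boost, event, Matrix.mulVec, dotProduct, Fin.sum_univ_succ (n := 3)]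
    ring

/-- In the frame moving with the velocity of the shift the fields are periodic up to a rotation. -/
theorem isFrameChange_boosted (hT : 0 < T) {Ω : Matrix.specialOrthogonalGroup (Fin 3) ℝ}
    {l : Fin 3 → ℝ} (hl : Ω.1.mulVec l = l) (hv : (T⁻¹ • l) ⬝ᵥ (T⁻¹ • l) < 1)
    (h : PeriodicUpTo T Ω l Ψ) :
    IsFrameChange (rotationMatrix Ω) (event (T / lorentzFactor (T⁻¹ • l)) 0)
      (changeFrame (boost (T⁻¹ • l)) Ψ) (changeFrame (boost (T⁻¹ • l)) Ψ) := by
  set v := T⁻¹ • l with hvdef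
  set N := rotationMatrix Ω
  set B := boost v
  have hΩv : Ω.1.mulVec v = v := by rw [hvdef, Matrix.mulVec_smul, hl]
  have hcomm : N * B = B * N := rotationMatrix_commute_boost hΩv
  have hγ := lorentzFactor_pos hv
  -- A pure time translation by T/γ in the moving frame is the translation by (T, l) in the original
  -- one; this fixes the proper period.
  have hshift : B.mulVec (event (T / lorentzFactor v) 0) = event T l := by
    rw [boost_mulVec_event, mul_div_cancel₀ T hγ.ne', hvdef, smul_smul, mul_inv_cancel₀ hT.ne',
      one_smul]
  have hpt : ∀ y, B.mulVec (N.mulVec y + event (T / lorentzFactor v) 0)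
      = N.mulVec (B.mulVec y) + event T l := fun y => by
    rw [Matrix.mulVec_add, hshift, Matrix.mulVec_mulVec, Matrix.mulVec_mulVec, hcomm]
  have hN : N.transpose * N = 1 := mul_eq_one_comm.1 (rotationMatrix_mul_transpose Ω)
  have hmat : N.transpose * B * N = B := by
    rw [Matrix.mul_assoc, ← hcomm, ← Matrix.mul_assoc, hN, Matrix.one_mul]
  have hsym : ∀ α β, B α β = B β α := fun α β => congrFun (congrFun (boost_transpose v) β) α
  have hcoef : ∀ μ β, ∑ ν, ∑ α, N ν μ * (B α ν * N α β) = B β μ := fun μ β => by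
    rw [← hsym μ β]
    conv_rhs => rw [← hmat, Matrix.mul_assoc, Matrix.mul_apply]
    refine Finset.sum_congr rfl fun ν _ => ?_
    rw [Matrix.mul_apply, Finset.mul_sum, Matrix.transpose_apply]
    exact Finset.sum_congr rfl fun α _ => by rw [hsym α ν]
  have hW : ∀ z α, (Ψ (N.mulVec z + event T l)).1 α = ∑ β, (N α β : ℂ) * (Ψ z).1 β :=
    fun z α => by rw [(h.apply hl z).1, rotate_eq_sum]; rfl
  have hA : ∀ z α, (Ψ (N.mulVec z + event T l)).2 α = ∑ β, N α β * (Ψ z).2 β :=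
    fun z α => by rw [(h.apply hl z).2, rotate_eq_sum]; rfl
  constructor
  · intro y μ
    simp only [changeFrame, hpt, hW, Complex.real_smul, Finset.mul_sum]
    simp only [← hcoef μ, Complex.ofReal_sum, Finset.sum_mul, Complex.ofReal_mul]
    rw [Finset.sum_comm]
    refine Finset.sum_congr rfl fun ν _ => ?_
    rw [Finset.sum_comm]
    exact Finset.sum_congr rfl fun α _ => Finset.sum_congr rfl fun β _ => by ring
  · intro y μ
    simp only [changeFrame, hpt, hA, Finset.mul_sum]
    simp only [← hcoef μ, Finset.sum_mul]
    rw [Finset.sum_comm]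
    refine Finset.sum_congr rfl fun ν _ => ?_
    rw [Finset.sum_comm]
    exact Finset.sum_congr rfl fun α _ => Finset.sum_congr rfl fun β _ => by ring

/-- A potential with vanishing field strength is a pure gauge. -/
theorem exists_potential {A : Spacetime → Fin 4 → ℝ} (hA : ∀ μ, ContDiff ℝ ∞ fun y => A y μ)
    (hF : ∀ x μ ν, partialDeriv μ (fun y => A y ν) x = partialDeriv ν (fun y => A y μ) x) :
    ∃ χ : Spacetime → ℝ, ContDiff ℝ ∞ χ ∧ ∀ x μ, A x μ = partialDeriv μ χ x := by
  set θ : Spacetime → Spacetime →L[ℝ] ℝ :=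
    fun y => ∑ ν, A y ν • ContinuousLinearMap.proj (R := ℝ) (φ := fun _ : Fin 4 => ℝ) ν with hθ
  have hθs : ContDiff ℝ ∞ θ := ContDiff.sum fun ν _ => (hA ν).smul contDiff_const
  have hθe : ∀ y μ, θ y (Pi.single μ 1) = A y μ := fun y μ => by
    simp [hθ, Pi.single_apply]
  have hbasis : ∀ a μ ν, fderiv ℝ θ a (Pi.single μ 1) (Pi.single ν 1)
      = partialDeriv μ (fun y => A y ν) a := fun a μ ν => by
    have := partialDeriv_clm (ContinuousLinearMap.apply ℝ ℝ (Pi.single ν 1 : Spacetime))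
      (hθs.differentiableAt_infty (x := a)) μ
    simp only [ContinuousLinearMap.apply_apply, hθe] at this
    rw [this]
    rfl
  have hsymm : ∀ a x y, fderiv ℝ θ a x y = fderiv ℝ θ a y x := by
    intro a x y
    have hx : ∀ z : Spacetime, z = ∑ μ, z μ • (Pi.single μ 1 : Spacetime) := fun z => by
      ext β; simp [Pi.single_apply]
    rw [hx x, hx y]
    simp only [map_sum, map_smul, sum_apply, smul_apply, smul_eq_mul, hbasis, Finset.mul_sum]
    rw [Finset.sum_comm]
    refine Finset.sum_congr rfl fun μ _ => Finset.sum_congr rfl fun ν _ => ?_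
    rw [hF a ν μ]
    ring
  -- The Poincaré lemma: F = 0 says exactly that the derivative of the one-form θ is symmetric.
  obtain ⟨χ, hχ⟩ := (convex_univ (𝕜 := ℝ) (E := Spacetime)).exists_forall_hasFDerivAt_of_fderiv_symmetric
    isOpen_univ (hθs.differentiable (by simp)).differentiableOn (fun a _ => hsymm a)
  have hfd : fderiv ℝ χ = θ := funext fun y => (hχ y (Set.mem_univ y)).fderiv
  refine ⟨χ, ?_, fun x μ => ?_⟩
  · rw [contDiff_infty_iff_fderiv, hfd]
    exact ⟨fun y => (hχ y (Set.mem_univ y)).differentiableAt, hθs⟩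
  · rw [partialDeriv, hfd, hθe]

end RestFrame

end

end ChargedVector

theorem proposition1 (e m : ℝ) (hm : m ≠ 0)
    (Ψ : ChargedVector.Spacetime → ChargedVector.FieldValue)
    (hsmooth : ContDiff ℝ ((⊤ : ℕ∞) : WithTop ℕ∞) Ψ)
    (hsol : ChargedVector.EulerLagrange (ChargedVector.lagrangian e m) Ψ)
    (hvanish : ChargedVector.VanishesAtSpatialInfinity Ψ)
    (T : ℝ) (hT : 0 < T)
    (Ω : Matrix.specialOrthogonalGroup (Fin 3) ℝ) (l : Fin 3 → ℝ)
    (hΩl : Ω.1.mulVec l = l) (hsub : √(l ⬝ᵥ l) / T < 1)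
    (hper : ChargedVector.PeriodicUpTo T Ω l Ψ)
    -- the integrals are taken over one period in the frame moving with velocity `l / T`
    (hfin : ChargedVector.FiniteIntegrals e m (T / ChargedVector.lorentzFactor (T⁻¹ • l))
      (ChargedVector.changeFrame (ChargedVector.boost (T⁻¹ • l)) Ψ)) :
    -- the complex vector field vanishes identically
    (∀ x, (Ψ x).1 = 0) ∧
    -- the electromagnetic field vanishes identically
    (∀ x μ ν, ChargedVector.strengthF (ChargedVector.grad Ψ x) μ ν = 0) ∧
    -- the electromagnetic potential is a pure gauge
    (∃ χ : ChargedVector.Spacetime → ℝ, ContDiff ℝ ((⊤ : ℕ∞) : WithTop ℕ∞) χ ∧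
      ∀ x μ, (Ψ x).2 μ = ChargedVector.partialDeriv μ χ x) := by
  have hv : (T⁻¹ • l) ⬝ᵥ (T⁻¹ • l) < 1 := by
    rw [div_lt_one hT, Real.sqrt_lt' hT] at hsub
    rw [smul_dotProduct, dotProduct_smul, smul_eq_mul, smul_eq_mul, ← mul_assoc, ← mul_inv, ← sq,
      inv_mul_lt_iff₀ (by positivity), mul_one]
    exact hsub
  have hL := ChargedVector.isLorentz_boost hv
  have hframe := ChargedVector.isFrameChange_changeFrame (ChargedVector.boost (T⁻¹ • l)) Ψ
  have hzero := ChargedVector.fields_vanish hm (hframe.contDiff hsmooth)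
    (hframe.fieldEquations hL hsmooth (hsol.fieldEquations hsmooth))
    (div_pos hT (ChargedVector.lorentzFactor_pos hv)) Ω
    (ChargedVector.isFrameChange_boosted hT hΩl hv hper) hfin
  -- The inverse of a Lorentz matrix B is η Bᵀ η, by B η Bᵀ = η and η² = 1.
  have hinv : ChargedVector.boost (T⁻¹ • l) * (Matrix.diagonal ChargedVector.eta
      * (ChargedVector.boost (T⁻¹ • l)).transpose * Matrix.diagonal ChargedVector.eta) = 1 := by
    rw [← Matrix.mul_assoc, ← Matrix.mul_assoc, show _ * _ * _ = _ from hL,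
      Matrix.diagonal_mul_diagonal]
    simp [ChargedVector.eta_mul_self]
  have hall : ∀ x, (Ψ x).1 = 0 ∧ ∀ μ ν, ChargedVector.fieldF Ψ μ ν x = 0 := fun x =>
    (hframe.inverse hinv).vanish (hframe.contDiff hsmooth) (hzero _)
  refine ⟨fun x => (hall x).1, fun x => (hall x).2, ?_⟩
  refine ChargedVector.exists_potential (A := fun y => (Ψ y).2)
    (ChargedVector.contDiff_A hsmooth) fun x μ ν => ?_
  have := (hall x).2 μ ν
  rw [ChargedVector.fieldF_eq hsmooth] at this
  exact sub_eq_zero.1 this
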